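/- Let $X$ be a diffeological space. Let $\mathbb{A}^n=\{(x_0,\dots,x_n)\in\mathbb{R}^{n+1}\mid \sum_i x_i=1\}$ carry the sub-diffeology of $\mathbb{R}^{n+1}$, and let $\Delta^n_{\mathrm{sub}}$ be the standard $n$-simplex with the sub-diffeology of $\mathbb{A}^n$. Let $S^D_\bullet(X)$ and $S^D_\bullet(X)_{\mathrm{sub}}$ be the simplicial sets of smooth maps $\mathbb{A}^n\to X$ and $\Delta^n_{\mathrm{sub}}\to X$, respectively. For a simplicial set $K$ let * $C^*(K)$ be the cochain algebra of all maps $K_p\to\mathbb{R}$, with $(df)(\sigma)=\sum_i(-1)^i f(d_i\sigma)$ and the cup product; * $\mathbb{Z}K$ be the chain complex of free abelian groups on the sets $K_p$, with differential $\sum_i(-1)^i d_i$; * $A^*_{DR}(K)$ be the cochain algebra of simplicial maps from $K$ to the simplicial cochain algebra $n\mapsto\Omega^*(\mathbb{A}^n)$, where $\Omega^*$ is Souriau's de Rham complex: a $p$-form on a diffeological space is a natural assignment of a smooth $p$-form on the domain of $P$ to each plot $P$, with the usual exterior derivative and wedge product; * $\int_K : A^*_{DR}(K)\to C^*(K)$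 be the map $\bigl(\int_K\omega\bigr)(\sigma)=\int_{\Delta^p}\omega(\sigma)$ for $\omega\in A^p_{DR}(K)$ and $\sigma\in K_p$, where $\Delta^p\subset\mathbb{A}^p$ is oriented by the coordinates $(x_1,\dots,x_p)$. Then the restriction map $\mathbb{Z}S^D_\bullet(X)\to\mathbb{Z}S^D_\bullet(X)_{\mathrm{sub}}$, $\sigma\mapsto\sigma|_{\Delta^n}$, has a homotopy inverse in the category of chain complexes. Moreover, for every homotopy inverse $k$ of it, with induced map $k^* : C^*(S^D_\bullet(X))\to C^*(S^D_\bullet(X)_{\mathrm{sub}})$, the integration map $$\int := k^*\circ\int_{S^D_\bullet(X)} : A^*_{DR}(S^D_\bullet(X))\to C^*(S^D_\bullet(X)_{\mathrm{sub}})$$ is a morphism of cochain complexes that induces an isomorphism of (graded, unital) algebras on cohomology. -/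

import Mathlib

noncomputable section

namespace DiffDeRham

open CategoryTheory Simplicial Diffeology Opposite
open scoped ContDiff Nat

universe u

section AltSum

variable {E : Type*} {ι κ : Type} [Fintype ι] [DecidableEq ι] [Fintype κ] [DecidableEq κ]

/-- The alternating sum of a function of `ι`-tuples over all permutations of `ι`. -/
def altSum (G : (ι → E) → ℝ) (v : ι → E) : ℝ :=
  ∑ σ : Equiv.Perm ι, ((Equiv.Perm.sign σ : ℤ) : ℝ) * G (v ∘ σ)

theorem altSum_perm (G : (ι → E) → ℝ) (τ : Equiv.Perm ι) (v : ι → E) :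
    altSum (fun w => G (w ∘ τ)) v = ((Equiv.Perm.sign τ : ℤ) : ℝ) * altSum G v := by
  unfold altSum
  rw [Finset.mul_sum]
  refine Fintype.sum_equiv (Equiv.mulRight τ) _ _ fun σ => ?_
  simp only [Equiv.coe_mulRight, ← mul_assoc, Equiv.Perm.sign_mul, Equiv.Perm.coe_mul,
    Function.comp_assoc]
  congr 1
  rw [mul_comm (Equiv.Perm.sign σ), Units.val_mul, Int.cast_mul, ← mul_assoc, ← Int.cast_mul,
    ← Units.val_mul, Int.units_mul_self]
  simp

theorem altSum_mul_left (c : ℝ) (G : (ι → E) → ℝ) (v : ι → E) :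
    altSum (fun w => c * G w) v = c * altSum G v := by
  simp only [altSum, Finset.mul_sum]
  exact Finset.sum_congr rfl fun σ _ => by ring

theorem altSum_sum {A : Type*} (s : Finset A) (G : A → (ι → E) → ℝ) (v : ι → E) :
    altSum (fun w => ∑ a ∈ s, G a w) v = ∑ a ∈ s, altSum (G a) v := by
  simp only [altSum, Finset.mul_sum]
  exact Finset.sum_comm

theorem altSum_inner (b : κ ↪ ι) (G : (ι → E) → (κ → E) → ℝ)
    (hG : ∀ w w' u, (∀ i, i ∉ Set.range b → w i = w' i) → G w u = G w' u) (v : ι → E) :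
    altSum (fun w => altSum (G w) (w ∘ b)) v =
      ((Fintype.card κ)! : ℝ) * altSum (fun w => G w (w ∘ b)) v := by
  have h1 : ∀ w : ι → E, altSum (G w) (w ∘ b) =
      ∑ τ : Equiv.Perm κ, ((Equiv.Perm.sign τ : ℤ) : ℝ) *
        (fun w : ι → E => G w (w ∘ b)) (w ∘ τ.viaFintypeEmbedding b) := by
    intro w
    refine Finset.sum_congr rfl fun τ _ => ?_
    congr 1
    have h2 : w ∘ b ∘ τ = (w ∘ τ.viaFintypeEmbedding b) ∘ b := by
      funext k
      simp [Equiv.Perm.viaFintypeEmbedding_apply_image]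
    simp only [← h2, Function.comp_assoc]
    refine hG _ _ _ fun i hi => ?_
    simp [Equiv.Perm.viaFintypeEmbedding_apply_notMem_range _ _ hi]
  simp only [h1]
  rw [altSum_sum]
  have h3 : ∀ τ : Equiv.Perm κ, altSum (fun w : ι → E => ((Equiv.Perm.sign τ : ℤ) : ℝ) *
        (fun w : ι → E => G w (w ∘ b)) (w ∘ τ.viaFintypeEmbedding b)) v =
        altSum (fun w => G w (w ∘ b)) v := by
    intro τ
    rw [altSum_mul_left, altSum_perm (fun w => G w (w ∘ b)), Equiv.Perm.viaFintypeEmbedding_sign,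
      ← mul_assoc, ← Int.cast_mul, ← Units.val_mul, Int.units_mul_self]
    simp
  rw [Finset.sum_congr rfl fun τ _ => h3 τ]
  simp [Fintype.card_perm]

/-- The inclusion of the first `p` indices into `Fin n`, where `p + q = n`. -/
def idxL {p q n : ℕ} (h : p + q = n) (i : Fin p) : Fin n := ⟨i, by omega⟩

/-- The inclusion of the last `q` indices into `Fin n`, where `p + q = n`. -/
def idxR {p q n : ℕ} (h : p + q = n) (i : Fin q) : Fin n := ⟨p + i, by omega⟩

theorem idxL_injective {p q n : ℕ} (h : p + q = n) : Function.Injective (idxL h) := by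
  intro i j hij
  simpa [idxL, Fin.ext_iff] using hij

theorem idxR_injective {p q n : ℕ} (h : p + q = n) : Function.Injective (idxR h) := by
  intro i j hij
  simpa [idxR, Fin.ext_iff] using hij

theorem idxR_notMem {p q n : ℕ} (h : p + q = n) (i : Fin q) : idxR h i ∉ Set.range (idxL h) := by
  rintro ⟨j, hj⟩
  simp [idxL, idxR, Fin.ext_iff] at hj
  omega

theorem idxL_notMem {p q n : ℕ} (h : p + q = n) (i : Fin p) : idxL h i ∉ Set.range (idxR h) := by
  rintro ⟨j, hj⟩
  simp [idxL, idxR, Fin.ext_iff] at hj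
  omega

theorem altSum_left {p q n : ℕ} (h : p + q = n) (G : (Fin p → E) → ℝ) (H : (Fin q → E) → ℝ)
    (v : Fin n → E) :
    altSum (fun w => altSum G (w ∘ idxL h) * H (w ∘ idxR h)) v =
      (p ! : ℝ) * altSum (fun w => G (w ∘ idxL h) * H (w ∘ idxR h)) v := by
  have := altSum_inner ⟨idxL h, idxL_injective h⟩
    (fun (w : Fin n → E) u => H (w ∘ idxR h) * G u) (fun w w' u hw => by
      have : w ∘ idxR h = w' ∘ idxR h := funext fun i => hw _ (idxR_notMem h i)
      simp only [this]) v
  simp only [altSum_mul_left, Function.Embedding.coeFn_mk, Fintype.card_fin] at this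
  simpa only [mul_comm (H _)] using this

theorem altSum_right {p q n : ℕ} (h : p + q = n) (G : (Fin p → E) → ℝ) (H : (Fin q → E) → ℝ)
    (v : Fin n → E) :
    altSum (fun w => G (w ∘ idxL h) * altSum H (w ∘ idxR h)) v =
      (q ! : ℝ) * altSum (fun w => G (w ∘ idxL h) * H (w ∘ idxR h)) v := by
  have := altSum_inner ⟨idxR h, idxR_injective h⟩
    (fun (w : Fin n → E) u => G (w ∘ idxL h) * H u) (fun w w' u hw => by
      have : w ∘ idxL h = w' ∘ idxL h := funext fun i => hw _ (idxL_notMem h i)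
      simp only [this]) v
  simpa only [altSum_mul_left, Function.Embedding.coeFn_mk, Fintype.card_fin] using this

theorem altSum_tail {n : ℕ} (G : E → (Fin n → E) → ℝ) (v : Fin (n + 1) → E) :
    altSum (fun w => altSum (G (w 0)) (w ∘ Fin.succ)) v =
      (n ! : ℝ) * altSum (fun w => G (w 0) (w ∘ Fin.succ)) v := by
  have := altSum_inner ⟨Fin.succ, Fin.succ_injective n⟩
    (fun (w : Fin (n + 1) → E) u => G (w 0) u) (fun w w' u hw => by
      have : w 0 = w' 0 := hw _ (by simp)
      simp only [this]) v
  simpa only [Function.Embedding.coeFn_mk, Fintype.card_fin] using this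

end AltSum

section Wedge

variable {E : Type*} [NormedAddCommGroup E] [NormedSpace ℝ E]

/-- The multilinear form `(v₁, …, vₙ) ↦ α (v₁, …, vₚ) * β (vₚ₊₁, …, vₙ)`, where `p + q = n`. -/
def tensorForm {p q n : ℕ} (h : p + q = n) (α : E [⋀^Fin p]→L[ℝ] ℝ) (β : E [⋀^Fin q]→L[ℝ] ℝ) :
    ContinuousMultilinearMap ℝ (fun _ : Fin n => E) ℝ :=
  ((α.toContinuousMultilinearMap.smulRight
    β.toContinuousMultilinearMap).uncurrySum).domDomCongr (finSumFinEquiv.trans (finCongr h))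

/-- The wedge product
`(α ∧ β) (v) = 1 / (p! q!) * ∑ σ, sign σ * α (v_{σ 1}, …, v_{σ p}) * β (v_{σ (p+1)}, …, v_{σ n})`
of alternating forms of degrees `p` and `q`, where `p + q = n`. -/
def wedge {p q n : ℕ} (h : p + q = n) (α : E [⋀^Fin p]→L[ℝ] ℝ) (β : E [⋀^Fin q]→L[ℝ] ℝ) :
    E [⋀^Fin n]→L[ℝ] ℝ :=
  ((p ! * q ! : ℝ)⁻¹) • ContinuousMultilinearMap.alternatization (tensorForm h α β)

theorem wedge_apply {p q n : ℕ} (h : p + q = n) (α : E [⋀^Fin p]→L[ℝ] ℝ)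
    (β : E [⋀^Fin q]→L[ℝ] ℝ) (v : Fin n → E) :
    wedge h α β v = ((p ! * q ! : ℝ)⁻¹) *
      altSum (fun w => α (w ∘ idxL h) * β (w ∘ idxR h)) v := by
  have h1 : ∀ w : Fin n → E, tensorForm h α β w = α (w ∘ idxL h) * β (w ∘ idxR h) := by
    intro w
    rfl
  simp only [wedge, ContinuousAlternatingMap.smul_apply,
    ContinuousMultilinearMap.alternatization_apply_apply, smul_eq_mul, altSum, h1]
  congr 1
  refine Finset.sum_congr rfl fun σ _ => ?_
  rw [Units.smul_def, zsmul_eq_mul]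

theorem wedge_assoc {p q r m l n : ℕ} (h₁ : p + q = m) (h₂ : m + r = n) (h₃ : q + r = l)
    (h₄ : p + l = n) (α : E [⋀^Fin p]→L[ℝ] ℝ) (β : E [⋀^Fin q]→L[ℝ] ℝ)
    (γ : E [⋀^Fin r]→L[ℝ] ℝ) :
    wedge h₂ (wedge h₁ α β) γ = wedge h₄ α (wedge h₃ β γ) := by
  ext v
  have e1 : idxL h₂ ∘ idxL h₁ = idxL h₄ := by funext i; simp [idxL]
  have e2 : idxL h₂ ∘ idxR h₁ = idxR h₄ ∘ idxL h₃ := by funext i; simp [idxL, idxR]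
  have e3 : idxR h₂ = idxR h₄ ∘ idxR h₃ := by funext i; simp [idxR]; omega
  simp only [wedge_apply]
  have L := altSum_left h₂ (fun w => α (w ∘ idxL h₁) * β (w ∘ idxR h₁)) (fun w => γ w) v
  have R := altSum_right h₄ (fun w => α w) (fun w => β (w ∘ idxL h₃) * γ (w ∘ idxR h₃)) v
  simp only [mul_assoc, mul_left_comm (α _), altSum_mul_left] at L R ⊢
  simp only [Function.comp_assoc, e1, e2, e3] at L R ⊢
  rw [L, R]
  have := Nat.factorial_ne_zero
  have hp : (p ! : ℝ) ≠ 0 := by exact_mod_cast this p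
  have hq : (q ! : ℝ) ≠ 0 := by exact_mod_cast this q
  have hr : (r ! : ℝ) ≠ 0 := by exact_mod_cast this r
  have hm : (m ! : ℝ) ≠ 0 := by exact_mod_cast this m
  have hl : (l ! : ℝ) ≠ 0 := by exact_mod_cast this l
  field_simp

theorem altSum_alternating {n : ℕ} (α : E [⋀^Fin n]→L[ℝ] ℝ) (v : Fin n → E) :
    altSum (fun w => α w) v = (n ! : ℝ) * α v := by
  have : ∀ σ : Equiv.Perm (Fin n), ((Equiv.Perm.sign σ : ℤ) : ℝ) * α (v ∘ σ) = α v := by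
    intro σ
    have h1 : α (v ∘ σ) = Equiv.Perm.sign σ • α v := α.toAlternatingMap.map_perm v σ
    rw [h1, Units.smul_def, zsmul_eq_mul, ← mul_assoc, ← Int.cast_mul, ← Units.val_mul,
      Int.units_mul_self]
    simp
  simp [altSum, this, Fintype.card_perm]

/-- The constant `0`-form with value `1`. -/
def oneAlt : E [⋀^Fin 0]→L[ℝ] ℝ := ContinuousAlternatingMap.constOfIsEmpty ℝ E (Fin 0) 1

theorem oneAlt_wedge {n : ℕ} (h : 0 + n = n) (α : E [⋀^Fin n]→L[ℝ] ℝ) :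
    wedge h oneAlt α = α := by
  ext v
  have e : idxR h = id := by funext i; simp [idxR]
  simp [wedge_apply, oneAlt, e, altSum_alternating, Nat.factorial_ne_zero]

theorem wedge_oneAlt {n : ℕ} (h : n + 0 = n) (α : E [⋀^Fin n]→L[ℝ] ℝ) :
    wedge h α oneAlt = α := by
  ext v
  have e : idxL h = id := by funext i; simp [idxL]
  simp [wedge_apply, oneAlt, e, altSum_alternating, Nat.factorial_ne_zero]

theorem wedge_add_left {p q n : ℕ} (h : p + q = n) (α α' : E [⋀^Fin p]→L[ℝ] ℝ)
    (β : E [⋀^Fin q]→L[ℝ] ℝ) : wedge h (α + α') β = wedge h α β + wedge h α' β := by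
  ext v
  simp only [wedge_apply, altSum, ContinuousAlternatingMap.add_apply, Finset.mul_sum,
    ← Finset.sum_add_distrib]
  exact Finset.sum_congr rfl fun σ _ => by ring

theorem wedge_add_right {p q n : ℕ} (h : p + q = n) (α : E [⋀^Fin p]→L[ℝ] ℝ)
    (β β' : E [⋀^Fin q]→L[ℝ] ℝ) : wedge h α (β + β') = wedge h α β + wedge h α β' := by
  ext v
  simp only [wedge_apply, altSum, ContinuousAlternatingMap.add_apply, Finset.mul_sum,
    ← Finset.sum_add_distrib]
  exact Finset.sum_congr rfl fun σ _ => by ring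

theorem wedge_smul_left {p q n : ℕ} (h : p + q = n) (c : ℝ) (α : E [⋀^Fin p]→L[ℝ] ℝ)
    (β : E [⋀^Fin q]→L[ℝ] ℝ) : wedge h (c • α) β = c • wedge h α β := by
  ext v
  simp only [wedge_apply, altSum, ContinuousAlternatingMap.smul_apply, Finset.mul_sum,
    smul_eq_mul]
  exact Finset.sum_congr rfl fun σ _ => by ring

theorem wedge_smul_right {p q n : ℕ} (h : p + q = n) (c : ℝ) (α : E [⋀^Fin p]→L[ℝ] ℝ)
    (β : E [⋀^Fin q]→L[ℝ] ℝ) : wedge h α (c • β) = c • wedge h α β := by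
  ext v
  simp only [wedge_apply, altSum, ContinuousAlternatingMap.smul_apply, Finset.mul_sum,
    smul_eq_mul]
  exact Finset.sum_congr rfl fun σ _ => by ring

theorem wedge_comp {F : Type*} [NormedAddCommGroup F] [NormedSpace ℝ F] {p q n : ℕ}
    (h : p + q = n) (α : E [⋀^Fin p]→L[ℝ] ℝ) (β : E [⋀^Fin q]→L[ℝ] ℝ) (L : F →L[ℝ] E) :
    wedge h (α.compContinuousLinearMap L) (β.compContinuousLinearMap L) =
      (wedge h α β).compContinuousLinearMap L := by
  ext v
  simp only [wedge_apply, ContinuousAlternatingMap.compContinuousLinearMap_apply, altSum]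
  rfl

theorem isBoundedBilinearMap_wedge {p q n : ℕ} (h : p + q = n) :
    IsBoundedBilinearMap ℝ (fun x : (E [⋀^Fin p]→L[ℝ] ℝ) × (E [⋀^Fin q]→L[ℝ] ℝ) =>
      wedge h x.1 x.2) where
  add_left := wedge_add_left h
  smul_left := wedge_smul_left h
  add_right := wedge_add_right h
  smul_right := wedge_smul_right h
  bound := by
    refine ⟨(p ! * q ! : ℝ)⁻¹ * n ! + 1, by positivity, fun α β => ?_⟩
    have key : ‖wedge h α β‖ ≤ ((p ! * q ! : ℝ)⁻¹ * n !) * ‖α‖ * ‖β‖ := by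
      refine ContinuousAlternatingMap.opNorm_le_bound _ (by positivity) fun v => ?_
      rw [wedge_apply, norm_mul, Real.norm_of_nonneg (by positivity : (0:ℝ) ≤ (p ! * q ! : ℝ)⁻¹),
        mul_assoc, mul_assoc, mul_assoc]
      refine mul_le_mul_of_nonneg_left ?_ (by positivity)
      have hb : ∀ σ : Equiv.Perm (Fin n), ‖((Equiv.Perm.sign σ : ℤ) : ℝ) *
          (α ((v ∘ σ) ∘ idxL h) * β ((v ∘ σ) ∘ idxR h))‖ ≤ ‖α‖ * (‖β‖ * ∏ i, ‖v i‖) := by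
        intro σ
        have hs : ‖((Equiv.Perm.sign σ : ℤ) : ℝ)‖ = 1 := by
          rcases Int.units_eq_one_or (Equiv.Perm.sign σ) with h | h <;> simp [h]
        have hprod : ∏ i, ‖v i‖ =
            (∏ i, ‖((v ∘ σ) ∘ idxL h) i‖) * ∏ i, ‖((v ∘ σ) ∘ idxR h) i‖ := by
          rw [← Equiv.prod_comp σ, ← Equiv.prod_comp (finSumFinEquiv.trans (finCongr h)),
            Fintype.prod_sum_type]
          rfl
        rw [norm_mul, hs, one_mul, norm_mul, hprod]
        calc _ ≤ (‖α‖ * ∏ i, ‖((v ∘ σ) ∘ idxL h) i‖) * (‖β‖ * ∏ i, ‖((v ∘ σ) ∘ idxR h) i‖) :=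
              mul_le_mul (α.le_opNorm _) (β.le_opNorm _) (norm_nonneg _) (by positivity)
          _ = _ := by ring
      refine (norm_sum_le_of_le _ fun σ _ => hb σ).trans ?_
      simp [Fintype.card_perm]
    refine key.trans ?_
    gcongr
    linarith

theorem alternatizeUncurryFin_eq_altSum {n : ℕ} (L : E →L[ℝ] E [⋀^Fin n]→L[ℝ] ℝ)
    (v : Fin (n + 1) → E) :
    ContinuousAlternatingMap.alternatizeUncurryFin L v =
      (n ! : ℝ)⁻¹ * altSum (fun w => L (w 0) (w ∘ Fin.succ)) v := by
  have h1 := altSum_alternating (ContinuousAlternatingMap.alternatizeUncurryFin L) v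
  have h2 : ∀ w : Fin (n + 1) → E, ContinuousAlternatingMap.alternatizeUncurryFin L w =
      ∑ i : Fin (n + 1), (-1 : ℝ) ^ (i : ℕ) *
        (fun w => L (w 0) (w ∘ Fin.succ)) (w ∘ (Fin.cycleRange i).symm) := by
    intro w
    rw [ContinuousAlternatingMap.alternatizeUncurryFin_apply]
    refine Finset.sum_congr rfl fun i _ => ?_
    have e : (w ∘ (Fin.cycleRange i).symm) ∘ Fin.succ = i.removeNth w := by
      funext j
      simp [Fin.removeNth]
    simp only [e]
    simp
  simp only [h2] at h1
  rw [← h2, altSum_sum] at h1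
  have h3 : ∀ i : Fin (n + 1), altSum (fun w : Fin (n + 1) → E => (-1 : ℝ) ^ (i : ℕ) *
        (fun w => L (w 0) (w ∘ Fin.succ)) (w ∘ (Fin.cycleRange i).symm)) v =
        altSum (fun w => L (w 0) (w ∘ Fin.succ)) v := by
    intro i
    rw [altSum_mul_left, altSum_perm (fun w : Fin (n + 1) → E => L (w 0) (w ∘ Fin.succ)),
      Equiv.Perm.sign_symm, Fin.sign_cycleRange, ← mul_assoc]
    have : (-1 : ℝ) ^ (i : ℕ) * ((((-1) ^ (i : ℕ) : ℤˣ) : ℤ) : ℝ) = 1 := by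
      push_cast
      rw [← mul_pow]
      norm_num
    rw [this, one_mul]
  rw [Finset.sum_congr rfl fun i _ => h3 i, Finset.sum_const, Finset.card_univ, Fintype.card_fin,
    nsmul_eq_mul, Nat.factorial_succ, Nat.cast_mul, mul_assoc] at h1
  have h4 := mul_left_cancel₀ (by positivity : ((n + 1 : ℕ) : ℝ) ≠ 0) h1
  rw [h4, inv_mul_cancel_left₀ (by positivity)]

theorem alternatizeUncurryFin_wedge_left {p q n : ℕ} (h : p + q = n) (h' : p + 1 + q = n + 1)
    (L : E →L[ℝ] E [⋀^Fin p]→L[ℝ] ℝ) (β : E [⋀^Fin q]→L[ℝ] ℝ)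
    (M : E →L[ℝ] E [⋀^Fin n]→L[ℝ] ℝ) (hM : ∀ v, M v = wedge h (L v) β) :
    ContinuousAlternatingMap.alternatizeUncurryFin M =
      wedge h' (ContinuousAlternatingMap.alternatizeUncurryFin L) β := by
  ext v
  have e1 : idxL h' 0 = 0 := rfl
  have e2 : idxL h' ∘ Fin.succ = Fin.succ ∘ idxL h := by funext i; simp [idxL]
  have e3 : idxR h' = Fin.succ ∘ idxR h := by funext i; simp [idxR, Fin.ext_iff]; omega
  have T := altSum_tail (fun x (u : Fin n → E) => L x (u ∘ idxL h) * β (u ∘ idxR h)) v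
  have S := altSum_left h' (fun u => L (u 0) (u ∘ Fin.succ)) (fun u => β u) v
  simp only [Function.comp_assoc, e2, e3, Function.comp_apply, e1] at S T
  rw [alternatizeUncurryFin_eq_altSum, wedge_apply]
  simp only [hM, wedge_apply, alternatizeUncurryFin_eq_altSum, altSum_mul_left, mul_assoc]
  simp only [e3]
  rw [T, S, Nat.factorial_succ]
  push_cast
  field_simp

theorem alternatizeUncurryFin_wedge_right {p q n : ℕ} (h : p + q = n) (h' : p + (q + 1) = n + 1)
    (α : E [⋀^Fin p]→L[ℝ] ℝ) (L : E →L[ℝ] E [⋀^Fin q]→L[ℝ] ℝ)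
    (M : E →L[ℝ] E [⋀^Fin n]→L[ℝ] ℝ) (hM : ∀ v, M v = wedge h α (L v)) :
    ContinuousAlternatingMap.alternatizeUncurryFin M =
      (-1 : ℝ) ^ p • wedge h' α (ContinuousAlternatingMap.alternatizeUncurryFin L) := by
  ext v
  have hp : p < n + 1 := by omega
  let τ : Equiv.Perm (Fin (n + 1)) := (Fin.cycleRange ⟨p, hp⟩).symm
  have e1 : idxR h' 0 = τ 0 := by
    simp [τ, idxR]
  have e2 : idxL h' = τ ∘ Fin.succ ∘ idxL h := by
    funext i
    simp only [τ, Function.comp_apply, Fin.cycleRange_symm_succ]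
    rw [Fin.succAbove_of_castSucc_lt]
    · rfl
    · simp [idxL, Fin.lt_def]
  have e3 : idxR h' ∘ Fin.succ = τ ∘ Fin.succ ∘ idxR h := by
    funext i
    simp only [τ, Function.comp_apply, Fin.cycleRange_symm_succ]
    rw [Fin.succAbove_of_le_castSucc]
    · simp [idxR, Fin.ext_iff]; omega
    · simp [idxR, Fin.le_def]
  have T := altSum_tail (fun x (u : Fin n → E) => α (u ∘ idxL h) * L x (u ∘ idxR h)) v
  have S := altSum_right h' (fun u => α u) (fun u => L (u 0) (u ∘ Fin.succ)) v
  have P := altSum_perm (fun w : Fin (n + 1) → E =>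
    α (w ∘ Fin.succ ∘ idxL h) * L (w 0) (w ∘ Fin.succ ∘ idxR h)) τ v
  have hs : ((Equiv.Perm.sign τ : ℤ) : ℝ) = (-1) ^ p := by
    simp only [τ, Equiv.Perm.sign_symm, Fin.sign_cycleRange]
    push_cast
    rfl
  rw [hs] at P
  simp only [Function.comp_assoc, e2, e3, Function.comp_apply, e1] at S T P
  rw [P] at S
  rw [alternatizeUncurryFin_eq_altSum, ContinuousAlternatingMap.smul_apply, wedge_apply]
  simp only [hM, wedge_apply, alternatizeUncurryFin_eq_altSum, altSum_mul_left,
    mul_left_comm (α _)]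
  simp only [e2]
  rw [T, S, Nat.factorial_succ, smul_eq_mul]
  push_cast
  have : ((-1 : ℝ) ^ p) * (-1 : ℝ) ^ p = 1 := by rw [← mul_pow]; norm_num
  field_simp
  linear_combination (-(altSum (fun w : Fin (n + 1) → E =>
    α (w ∘ Fin.succ ∘ idxL h) * L (w 0) (w ∘ Fin.succ ∘ idxR h)) v)) * this

/-- The Leibniz rule for the exterior derivative on a normed space. -/
theorem extDeriv_wedge {p q n : ℕ} (h : p + q = n) (h₁ : p + 1 + q = n + 1)
    (h₂ : p + (q + 1) = n + 1) (α : E → E [⋀^Fin p]→L[ℝ] ℝ) (β : E → E [⋀^Fin q]→L[ℝ] ℝ) (x : E)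
    (hα : DifferentiableAt ℝ α x) (hβ : DifferentiableAt ℝ β x) :
    extDeriv (fun y => wedge h (α y) (β y)) x =
      wedge h₁ (extDeriv α x) (β x) + (-1 : ℝ) ^ p • wedge h₂ (α x) (extDeriv β x) := by
  have hb := isBoundedBilinearMap_wedge (E := E) h
  have hd : HasFDerivAt (fun y => wedge h (α y) (β y))
      ((hb.deriv (α x, β x)).comp ((fderiv ℝ α x).prod (fderiv ℝ β x))) x :=
    HasFDerivAt.comp (f := fun y => (α y, β y)) x (hb.hasFDerivAt (α x, β x))
      (hα.hasFDerivAt.prodMk hβ.hasFDerivAt)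
  let M₁ : E →L[ℝ] E [⋀^Fin n]→L[ℝ] ℝ :=
    (hb.deriv (0, β x)).comp ((fderiv ℝ α x).prod 0)
  let M₂ : E →L[ℝ] E [⋀^Fin n]→L[ℝ] ℝ :=
    (hb.deriv (α x, 0)).comp ((0 : E →L[ℝ] E [⋀^Fin p]→L[ℝ] ℝ).prod (fderiv ℝ β x))
  have hz1 : ∀ γ : E [⋀^Fin p]→L[ℝ] ℝ, wedge h γ 0 = 0 := fun γ => by
    simpa using wedge_smul_right h 0 γ 0
  have hz2 : ∀ γ : E [⋀^Fin q]→L[ℝ] ℝ, wedge h 0 γ = 0 := fun γ => by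
    simpa using wedge_smul_left h 0 0 γ
  have hM₁ : ∀ v, M₁ v = wedge h (fderiv ℝ α x v) (β x) := fun v => by
    simp [M₁, hz1]
  have hM₂ : ∀ v, M₂ v = wedge h (α x) (fderiv ℝ β x v) := fun v => by
    simp [M₂, hz2]
  have hM : (hb.deriv (α x, β x)).comp ((fderiv ℝ α x).prod (fderiv ℝ β x)) = M₁ + M₂ := by
    ext1 v
    rw [_root_.add_apply, hM₁, hM₂]
    simp [add_comm]
  rw [extDeriv, hd.fderiv, hM, ContinuousAlternatingMap.alternatizeUncurryFin_add,
    alternatizeUncurryFin_wedge_left h h₁ _ _ _ hM₁,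
    alternatizeUncurryFin_wedge_right h h₂ _ _ _ hM₂]
  rfl

end Wedge

section CochainAlgebra

/-- A cochain algebra (differential graded algebra, concentrated in nonnegative degrees) over `ℝ`.
The product `C p × C q → C n` takes a proof of `p + q = n` as an argument. -/
structure CochainAlgebra where
  C : ℕ → Type u
  [addCommGroup : ∀ n, AddCommGroup (C n)]
  [module : ∀ n, Module ℝ (C n)]
  d : ∀ n, C n →ₗ[ℝ] C (n + 1)
  d_d : ∀ n a, d (n + 1) (d n a) = 0
  mul : ∀ {p q n : ℕ}, p + q = n → (C p →ₗ[ℝ] C q →ₗ[ℝ] C n)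
  one : C 0
  one_mul : ∀ {n : ℕ} (h : 0 + n = n) (a : C n), mul h one a = a
  mul_one : ∀ {n : ℕ} (h : n + 0 = n) (a : C n), mul h a one = a
  mul_assoc : ∀ {p q r m l n : ℕ} (h₁ : p + q = m) (h₂ : m + r = n) (h₃ : q + r = l)
    (h₄ : p + l = n) (a : C p) (b : C q) (c : C r),
    mul h₂ (mul h₁ a b) c = mul h₄ a (mul h₃ b c)
  leibniz : ∀ {p q n : ℕ} (h : p + q = n) (h₁ : p + 1 + q = n + 1) (h₂ : p + (q + 1) = n + 1)
    (a : C p) (b : C q),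
    d n (mul h a b) = mul h₁ (d p a) b + (-1 : ℝ) ^ p • mul h₂ a (d q b)

attribute [instance] CochainAlgebra.addCommGroup CochainAlgebra.module

namespace CochainAlgebra

variable (A B : CochainAlgebra.{u})

/-- Cocycles of degree `n`. -/
def Z (n : ℕ) : Submodule ℝ (A.C n) := LinearMap.ker (A.d n)

/-- Coboundaries of degree `n`. -/
def Bd (n : ℕ) : Submodule ℝ (A.C n) :=
  match n with
  | 0 => ⊥
  | n + 1 => LinearMap.range (A.d n)

/-- The cohomology of a cochain algebra in degree `n`. -/
abbrev H (n : ℕ) : Type u := A.Z n ⧸ (A.Bd n).submoduleOf (A.Z n)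

variable {A B}

theorem mem_Z {n : ℕ} {a : A.C n} : a ∈ A.Z n ↔ A.d n a = 0 := Iff.rfl

/-- The cohomology class of a cocycle. -/
def cls {n : ℕ} (a : A.Z n) : A.H n := Submodule.Quotient.mk a

theorem d_one : A.d 0 A.one = 0 := by
  have h := A.leibniz (zero_add 0) (zero_add 1) (zero_add 1) A.one A.one
  rw [A.one_mul, A.mul_one (by omega), A.one_mul] at h
  simpa using h

theorem mul_mem_Z {p q n : ℕ} (h : p + q = n) {a : A.C p} {b : A.C q} (ha : a ∈ A.Z p)
    (hb : b ∈ A.Z q) : A.mul h a b ∈ A.Z n := by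
  rw [mem_Z] at *
  rw [A.leibniz h (by omega) (by omega), ha, hb]
  simp

theorem mul_mem_Bd_left {p q n : ℕ} (h : p + q = n) {a : A.C p} {b : A.C q} (ha : a ∈ A.Bd p)
    (hb : b ∈ A.Z q) : A.mul h a b ∈ A.Bd n := by
  cases p with
  | zero =>
    have h0 : a = 0 := ha
    simp [h0]
  | succ p =>
    obtain ⟨c, rfl⟩ := ha
    obtain ⟨n, rfl⟩ : ∃ m, n = m + 1 := ⟨p + q, by omega⟩
    have h1 := A.leibniz (show p + q = n by omega) h (by omega) c b
    rw [mem_Z.1 hb, map_zero, smul_zero, add_zero] at h1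
    exact ⟨_, h1⟩

theorem mul_mem_Bd_right {p q n : ℕ} (h : p + q = n) {a : A.C p} {b : A.C q} (ha : a ∈ A.Z p)
    (hb : b ∈ A.Bd q) : A.mul h a b ∈ A.Bd n := by
  cases q with
  | zero =>
    have h0 : b = 0 := hb
    simp [h0]
  | succ q =>
    obtain ⟨c, rfl⟩ := hb
    obtain ⟨n, rfl⟩ : ∃ m, n = m + 1 := ⟨p + q, by omega⟩
    have h1 := A.leibniz (show p + q = n by omega) (by omega) h a c
    rw [mem_Z.1 ha, map_zero, LinearMap.zero_apply, zero_add] at h1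
    refine ⟨(-1 : ℝ) ^ p • A.mul (show p + q = n by omega) a c, ?_⟩
    rw [map_smul, h1, smul_smul, ← mul_pow]
    simp

/-- The product of cocycles. -/
def mulZ {p q n : ℕ} (h : p + q = n) : A.Z p →ₗ[ℝ] A.Z q →ₗ[ℝ] A.Z n :=
  LinearMap.mk₂ ℝ (fun a b => ⟨A.mul h a.1 b.1, mul_mem_Z h a.2 b.2⟩)
    (fun a a' b => by ext; simp) (fun c a b => by ext; simp)
    (fun a b b' => by ext; simp) (fun c a b => by ext; simp)

/-- The product on cohomology: `[a] * [b] = [a * b]`. -/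
def mulH {p q n : ℕ} (h : p + q = n) : A.H p →ₗ[ℝ] A.H q →ₗ[ℝ] A.H n :=
  Submodule.liftQ _
    { toFun := fun a => Submodule.liftQ _ ((Submodule.mkQ _).comp (mulZ h a)) (by
        intro b hb
        rw [LinearMap.mem_ker, LinearMap.comp_apply, Submodule.mkQ_apply,
          Submodule.Quotient.mk_eq_zero]
        exact mul_mem_Bd_right h a.2 hb)
      map_add' := fun a a' => Submodule.linearMap_qext _ (by ext b; simp)
      map_smul' := fun c a => Submodule.linearMap_qext _ (by ext b; simp) } (by
    intro a ha
    refine LinearMap.mem_ker.2 (Submodule.linearMap_qext _ ?_)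
    refine LinearMap.ext fun b => ?_
    exact (Submodule.Quotient.mk_eq_zero _).2 (mul_mem_Bd_left h ha b.2))

theorem mulH_cls {p q n : ℕ} (h : p + q = n) (a : A.Z p) (b : A.Z q) :
    mulH h (cls a) (cls b) = cls (mulZ h a b) := rfl

variable (A) in
/-- The unit of the cohomology algebra. -/
def oneH : A.H 0 := cls ⟨A.one, d_one⟩

variable (A B) in
/-- A morphism of the underlying cochain complexes of two cochain algebras. -/
structure CochainMap where
  toFun : ∀ n, A.C n →ₗ[ℝ] B.C n
  comm : ∀ n a, B.d n (toFun n a) = toFun (n + 1) (A.d n a)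

/-- The map induced on cohomology by a cochain map: `[a] ↦ [F a]`. -/
def CochainMap.mapH (F : CochainMap A B) (n : ℕ) : A.H n →ₗ[ℝ] B.H n :=
  Submodule.mapQ _ _
    ((F.toFun n).restrict (p := A.Z n) (q := B.Z n) (fun a ha => by
      rw [mem_Z] at *
      rw [F.comm, ha, map_zero])) (by
    intro a ha
    cases n with
    | zero =>
      have h0 : (a : A.C 0) = 0 := ha
      change F.toFun 0 a = 0
      rw [h0, map_zero]
    | succ n =>
      obtain ⟨c, hc⟩ := ha
      exact ⟨F.toFun n c, by rw [F.comm, hc]; rfl⟩)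

/-- The cochain map `F` induces an isomorphism of (graded) algebras on cohomology: it is bijective
in every degree, and it preserves the products and the unit. -/
structure CochainMap.InducesAlgebraIso (F : CochainMap A B) : Prop where
  bijective : ∀ n, Function.Bijective (F.mapH n)
  map_mul : ∀ {p q n : ℕ} (h : p + q = n) (x : A.H p) (y : A.H q),
    F.mapH n (mulH h x y) = mulH h (F.mapH p x) (F.mapH q y)
  map_one : F.mapH 0 A.oneH = B.oneH

end CochainAlgebra

end CochainAlgebra

section Forms

/-- The sub-diffeology on a subset of a diffeological space. -/
instance subDiffeology {X : Type*} [DiffeologicalSpace X] (s : Set X) : DiffeologicalSpace s where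
  plots _ := {p | IsPlot (Subtype.val ∘ p)}
  constant_plots _ := isPlot_const
  plot_reparam hp hf := isPlot_reparam hp hf
  locality hp := DiffeologicalSpace.locality hp

variable (X : Type u) [DiffeologicalSpace X]

/-- The plots of `X` with domain `ℝᵐ`. -/
def Plot (m : ℕ) : Type u := {p : EuclideanSpace ℝ (Fin m) → X // IsPlot p}

variable {X} in
/-- Reparametrization of a plot by a smooth map. -/
def Plot.comp {m m' : ℕ} (p : Plot X m)
    (f : EuclideanSpace ℝ (Fin m') → EuclideanSpace ℝ (Fin m)) (hf : ContDiff ℝ ∞ f) :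
    Plot X m' :=
  ⟨p.1 ∘ f, isPlot_reparam p.2 hf⟩

/-- Differential `k`-forms on a diffeological space in the sense of Souriau: natural
transformations from plots to smooth `k`-forms on the domains of the plots. As in Mathlib's notion
of a diffeology, the plots are those with domains `ℝᵐ`; forms on open subsets are determined by
these since they are local and every point has arbitrarily small open neighbourhoods that are
diffeomorphic to `ℝᵐ`. -/
def formSubmodule (k : ℕ) : Submodule ℝ (∀ m : ℕ, Plot X m → EuclideanSpace ℝ (Fin m) →
    EuclideanSpace ℝ (Fin m) [⋀^Fin k]→L[ℝ] ℝ) where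
  carrier := {η | (∀ m p, ContDiff ℝ ∞ (η m p)) ∧
    ∀ (m m' : ℕ) (p : Plot X m) (f : EuclideanSpace ℝ (Fin m') → EuclideanSpace ℝ (Fin m))
      (hf : ContDiff ℝ ∞ f) (x : EuclideanSpace ℝ (Fin m')),
      η m' (p.comp f hf) x = (η m p (f x)).compContinuousLinearMap (fderiv ℝ f x)}
  add_mem' := fun {η ζ} hw hz => by
    refine ⟨fun m p => (hw.1 m p).add (hz.1 m p), fun m m' p f hf x => ?_⟩
    simp only [Pi.add_apply, hw.2 m m' p f hf x, hz.2 m m' p f hf x]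
    rfl
  zero_mem' := ⟨fun m p => contDiff_const, fun m m' p f hf x => rfl⟩
  smul_mem' := fun c η hw => by
    refine ⟨fun m p => (hw.1 m p).const_smul c, fun m m' p f hf x => ?_⟩
    simp only [Pi.smul_apply, hw.2 m m' p f hf x]
    rfl

/-- The type of differential `k`-forms on a diffeological space. -/
def Form (k : ℕ) : Type u := formSubmodule X k

instance (k : ℕ) : AddCommGroup (Form X k) := inferInstanceAs (AddCommGroup (formSubmodule X k))

instance (k : ℕ) : Module ℝ (Form X k) := inferInstanceAs (Module ℝ (formSubmodule X k))

variable {X}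

theorem Form.ext {k : ℕ} {η ζ : Form X k} (h : ∀ m p x, η.1 m p x = ζ.1 m p x) : η = ζ :=
  Subtype.ext (funext fun m => funext fun p => funext fun x => h m p x)

theorem Form.contDiff {k : ℕ} (η : Form X k) {m : ℕ} (p : Plot X m) : ContDiff ℝ ∞ (η.1 m p) :=
  η.2.1 m p

theorem Form.differentiableAt {k : ℕ} (η : Form X k) {m : ℕ} (p : Plot X m)
    (x : EuclideanSpace ℝ (Fin m)) : DifferentiableAt ℝ (η.1 m p) x :=
  (Form.contDiff η p).differentiable (by simp) x

theorem minSmoothness_two_le : minSmoothness ℝ 2 ≤ ∞ := by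
  rw [minSmoothness_of_isRCLikeNormedField]
  exact WithTop.coe_le_coe.2 (le_top : (2 : ℕ∞) ≤ ⊤)

theorem contDiff_extDeriv {m k : ℕ} {η : EuclideanSpace ℝ (Fin m) →
    EuclideanSpace ℝ (Fin m) [⋀^Fin k]→L[ℝ] ℝ} (hw : ContDiff ℝ ∞ η) :
    ContDiff ℝ ∞ (extDeriv η) :=
  ContDiff.comp (g := ContinuousAlternatingMap.alternatizeUncurryFinCLM ℝ
      (EuclideanSpace ℝ (Fin m)) ℝ) (ContinuousLinearMap.contDiff _)
    (hw.fderiv_right (m := ∞) (by simp))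

/-- The exterior derivative of forms on a diffeological space. -/
def Form.d (k : ℕ) : Form X k →ₗ[ℝ] Form X (k + 1) where
  toFun η := ⟨fun m p => extDeriv (η.1 m p), fun m p => contDiff_extDeriv (Form.contDiff η p),
    fun m m' p f hf x => by
      have h : η.1 m' (p.comp f hf) =
          fun x => (η.1 m p (f x)).compContinuousLinearMap (fderiv ℝ f x) :=
        funext fun x => η.2.2 m m' p f hf x
      simp only [h]
      exact extDeriv_pullback (Form.differentiableAt η p _) hf.contDiffAt
        minSmoothness_two_le⟩
  map_add' η ζ := by
    refine Form.ext fun m p x => ?_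
    exact extDeriv_add (Form.differentiableAt η p x) (Form.differentiableAt ζ p x)
  map_smul' c η := by
    refine Form.ext fun m p x => ?_
    exact extDeriv_smul c (η.1 m p)

/-- The wedge product of forms on a diffeological space. -/
def Form.wedge {p q n : ℕ} (h : p + q = n) : Form X p →ₗ[ℝ] Form X q →ₗ[ℝ] Form X n :=
  LinearMap.mk₂ ℝ
    (fun α β => ⟨fun m P x => DiffDeRham.wedge h (α.1 m P x) (β.1 m P x),
      fun m P => (isBoundedBilinearMap_wedge (E := EuclideanSpace ℝ (Fin m)) h).contDiff.comp
        (f := fun x => (α.1 m P x, β.1 m P x))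
        ((Form.contDiff α P).prodMk (Form.contDiff β P)),
      fun m m' P f hf x => by
        simp only [α.2.2 m m' P f hf x, β.2.2 m m' P f hf x]
        exact wedge_comp h _ _ _⟩)
    (fun α α' β => by exact Form.ext fun m P x => wedge_add_left h _ _ _)
    (fun c α β => by exact Form.ext fun m P x => wedge_smul_left h _ _ _)
    (fun α β β' => by exact Form.ext fun m P x => wedge_add_right h _ _ _)
    (fun c α β => by exact Form.ext fun m P x => wedge_smul_right h _ _ _)

/-- The constant function `1` as a `0`-form. -/
def Form.one : Form X 0 :=
  ⟨fun _ _ _ => oneAlt, fun _ _ => contDiff_const, fun m m' p f hf x => by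
    ext v
    rfl⟩

variable (X) in
/-- The de Rham complex `Ω^*(X)` of a diffeological space in the sense of Souriau. -/
def Omega : CochainAlgebra.{u} where
  C k := Form X k
  d := Form.d
  d_d k η := by
    exact Form.ext fun m p x =>
      congrFun (extDeriv_extDeriv (Form.contDiff η p) minSmoothness_two_le) x
  mul := Form.wedge
  one := Form.one
  one_mul h η := by exact Form.ext fun m p x => oneAlt_wedge h _
  mul_one h η := by exact Form.ext fun m p x => wedge_oneAlt h _
  mul_assoc h₁ h₂ h₃ h₄ a b c := by exact Form.ext fun m p x => wedge_assoc h₁ h₂ h₃ h₄ _ _ _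
  leibniz h h₁ h₂ a b := by
    refine Form.ext fun m P x => ?_
    exact extDeriv_wedge h h₁ h₂ _ _ x (Form.differentiableAt a P x) (Form.differentiableAt b P x)

/-- The pullback of forms along a smooth map. -/
def Form.pullback {Y : Type*} [DiffeologicalSpace Y] {k : ℕ} (f : X → Y) (hf : DSmooth f) :
    Form Y k →ₗ[ℝ] Form X k where
  toFun η := ⟨fun m p => η.1 m ⟨f ∘ p.1, hf m p.1 p.2⟩, fun m _ => η.2.1 m _,
    fun m m' p g hg x => η.2.2 m m' ⟨f ∘ p.1, hf m p.1 p.2⟩ g hg x⟩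
  map_add' _ _ := rfl
  map_smul' _ _ := rfl

end Forms

section Simplices

/-- The affine space `𝔸ⁿ = {x ∈ ℝⁿ⁺¹ | ∑ xᵢ = 1}`, with the sub-diffeology of `ℝⁿ⁺¹`. -/
def affineSpace (n : ℕ) : Set (EuclideanSpace ℝ (Fin (n + 1))) := {x | ∑ i, x i = 1}

/-- The standard simplex `Δⁿ`, as a subset of `𝔸ⁿ` and with the sub-diffeology of `𝔸ⁿ`. -/
def simplexSub (n : ℕ) : Set (affineSpace n) := {x | ∀ i, 0 ≤ x.1 i}

/-- The affine map `𝔸ᵐ → 𝔸ⁿ` induced by a map `[m] → [n]`: it sends the `i`-th vertex to the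
`τ i`-th vertex. -/
def affineMap {m n : SimplexCategory} (τ : m ⟶ n) (x : affineSpace m.len) : affineSpace n.len :=
  ⟨WithLp.toLp 2 fun j => ∑ i with τ i = j, x.1 i, by
    have h := x.2
    change ∑ j, ∑ i with τ i = j, x.1 i = 1
    exact (Finset.sum_fiberwise _ _ _).trans h⟩

theorem affineMap_dSmooth {m n : SimplexCategory} (τ : m ⟶ n) : DSmooth (affineMap τ) := by
  intro k p hp
  have hp' : ContDiff ℝ ∞ (Subtype.val ∘ p) := IsPlot.contDiff hp
  have : ContDiff ℝ ∞ (Subtype.val ∘ affineMap τ ∘ p) := by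
    rw [contDiff_euclidean] at hp' ⊢
    intro j
    change ContDiff ℝ ∞ (fun y => ∑ i with τ i = j, (p y).1 i)
    exact ContDiff.sum fun i _ => hp' i
  exact this.isPlot

theorem affineMap_id (n : SimplexCategory) (x : affineSpace n.len) : affineMap (𝟙 n) x = x := by
  ext j
  simp [affineMap, Finset.filter_eq']

theorem affineMap_comp {l m n : SimplexCategory} (τ : l ⟶ m) (ρ : m ⟶ n) (x : affineSpace l.len) :
    affineMap (τ ≫ ρ) x = affineMap ρ (affineMap τ x) := by
  ext j
  simp only [affineMap]
  rw [Finset.sum_filter, Finset.sum_filter]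
  have : ∀ k, (if ρ k = j then ∑ i with τ i = k, x.1 i else 0) =
      ∑ i, if τ i = k ∧ ρ k = j then x.1 i else 0 := by
    intro k
    split_ifs with h <;> simp [h, Finset.sum_filter]
  simp only [this]
  rw [Finset.sum_comm]
  refine Finset.sum_congr rfl fun i _ => ?_
  rw [Finset.sum_eq_single (τ i)]
  · simp
  · intro b _ hb
    rw [if_neg]
    exact fun h => hb h.1.symm
  · simp

/-- The restriction `Δᵐ → Δⁿ` of the affine map induced by a map `[m] → [n]`. -/
def simplexMap {m n : SimplexCategory} (τ : m ⟶ n) (x : simplexSub m.len) : simplexSub n.len :=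
  ⟨affineMap τ x.1, fun j => by
    change 0 ≤ ∑ i with τ i = j, x.1.1 i
    exact Finset.sum_nonneg fun i _ => x.2 i⟩

theorem simplexMap_dSmooth {m n : SimplexCategory} (τ : m ⟶ n) : DSmooth (simplexMap τ) :=
  fun k p hp => affineMap_dSmooth τ k (Subtype.val ∘ p) hp

variable (X : Type u) [DiffeologicalSpace X]

/-- The simplicial set `S^D_•(X)` of smooth maps `𝔸ⁿ → X`. -/
def SD : SSet.{u} where
  obj n := {σ : affineSpace n.unop.len → X // DSmooth σ}
  map τ := ↾fun σ => ⟨σ.1 ∘ affineMap τ.unop, σ.2.comp (affineMap_dSmooth _)⟩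
  map_id n := by
    refine ConcreteCategory.hom_ext _ _ fun σ => ?_
    exact Subtype.ext (funext fun x => congrArg σ.1 (affineMap_id _ x))
  map_comp τ ρ := by
    refine ConcreteCategory.hom_ext _ _ fun σ => ?_
    exact Subtype.ext (funext fun x => congrArg σ.1 (affineMap_comp _ _ x))

/-- The simplicial set `S^D_•(X)_sub` of smooth maps `Δⁿ → X`. -/
def SDsub : SSet.{u} where
  obj n := {σ : simplexSub n.unop.len → X // DSmooth σ}
  map τ := ↾fun σ => ⟨σ.1 ∘ simplexMap τ.unop, σ.2.comp (simplexMap_dSmooth _)⟩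
  map_id n := by
    refine ConcreteCategory.hom_ext _ _ fun σ => ?_
    exact Subtype.ext (funext fun x => congrArg σ.1 (Subtype.ext (affineMap_id _ x.1)))
  map_comp τ ρ := by
    refine ConcreteCategory.hom_ext _ _ fun σ => ?_
    exact Subtype.ext (funext fun x => congrArg σ.1 (Subtype.ext (affineMap_comp _ _ x.1)))

theorem dSmooth_val {Y : Type*} [DiffeologicalSpace Y] (s : Set Y) :
    DSmooth (Subtype.val : s → Y) := fun _ _ hp => hp

/-- The restriction map `S^D_•(X) → S^D_•(X)_sub`, `σ ↦ σ|_Δⁿ`. -/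
def restriction : SD X ⟶ SDsub X where
  app _ := ↾fun σ => ⟨σ.1 ∘ Subtype.val, σ.2.comp (dSmooth_val _)⟩
  naturality _ _ _ := rfl

end Simplices

section SimplicialCochains

variable (K : SSet.{u})

/-- The simplicial chain complex `ℤK`: in degree `n` the free abelian group on `Kₙ`, with
differential `∑ (-1)ⁱ dᵢ`. -/
def chains : SSet.{u} ⥤ ChainComplex AddCommGrpCat.{u} ℕ :=
  (SimplicialObject.whiskering _ _).obj AddCommGrpCat.free ⋙
    AlgebraicTopology.alternatingFaceMapComplex AddCommGrpCat

variable {K}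

/-- The differential of simplicial cochains: `(df)(σ) = ∑ (-1)ⁱ f(dᵢ σ)`. -/
def cochainD (n : ℕ) : (K _⦋n⦌ → ℝ) →ₗ[ℝ] (K _⦋n + 1⦌ → ℝ) where
  toFun f σ := ∑ i : Fin (n + 2), (-1 : ℝ) ^ (i : ℕ) * f (K.map (SimplexCategory.δ i).op σ)
  map_add' f g := by
    funext σ
    simp [mul_add, Finset.sum_add_distrib]
  map_smul' c f := by
    funext σ
    simp [Finset.mul_sum, mul_left_comm]

/-- The cup product of simplicial cochains:
`(f ∪ g)(σ) = f(σ|[0,…,p]) * g(σ|[p,…,p+q])`. -/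
def cup {p q n : ℕ} (h : p + q = n) : (K _⦋p⦌ → ℝ) →ₗ[ℝ] (K _⦋q⦌ → ℝ) →ₗ[ℝ] (K _⦋n⦌ → ℝ) :=
  LinearMap.mk₂ ℝ
    (fun f g σ => f (K.map (SimplexCategory.subinterval (n := n) 0 p (by omega)).op σ) *
      g (K.map (SimplexCategory.subinterval (n := n) p q (by omega)).op σ))
    (fun f f' g => by funext σ; simp [add_mul])
    (fun c f g => by funext σ; simp [mul_assoc])
    (fun f g g' => by funext σ; simp [mul_add])
    (fun c f g => by funext σ; simp [mul_left_comm])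

theorem map_op_map_op {l m n : SimplexCategory} (f : l ⟶ m) (g : m ⟶ n) (σ : K.obj (op n)) :
    K.map f.op (K.map g.op σ) = K.map (f ≫ g).op σ := by
  simp

theorem subinterval_val {n j l : ℕ} (h : j + l ≤ n) (i : Fin (l + 1)) :
    ((SimplexCategory.subinterval j l h i : Fin (n + 1)) : ℕ) = i + j := rfl

theorem δ_val {n : ℕ} (i : Fin (n + 2)) (j : Fin (n + 1)) :
    ((SimplexCategory.δ i j : Fin (n + 2)) : ℕ) = if (j : ℕ) < i then (j : ℕ) else j + 1 := by
  change ((i.succAbove j : Fin (n + 2)) : ℕ) = _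
  simp only [Fin.succAbove, Fin.lt_def, Fin.val_castSucc]
  split_ifs <;> simp

theorem hom_ext_val {m n : ℕ} {f g : ⦋m⦌ ⟶ ⦋n⦌}
    (h : ∀ i : Fin (m + 1), ((f i : Fin (n + 1)) : ℕ) = (g i : Fin (n + 1))) : f = g := by
  ext i
  exact h i

theorem comp_val {l m n : ℕ} (f : ⦋l⦌ ⟶ ⦋m⦌) (g : ⦋m⦌ ⟶ ⦋n⦌) (i : Fin (l + 1)) :
    (((f ≫ g) i : Fin (n + 1)) : ℕ) = (g (f i : Fin (m + 1)) : Fin (n + 1)) := rfl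

theorem subinterval_comp_δ_val {n j l : ℕ} (h : j + l ≤ n) (i : Fin (n + 2)) (a : Fin (l + 1)) :
    (((SimplexCategory.subinterval j l h ≫ SimplexCategory.δ i) a : Fin (n + 2)) : ℕ) =
      if (a : ℕ) + j < i then (a : ℕ) + j else a + j + 1 := by
  rw [comp_val]
  exact δ_val i ⟨a + j, by omega⟩

theorem δ_comp_subinterval_val {n j l : ℕ} (h : j + (l + 1) ≤ n) (i : Fin (l + 2))
    (a : Fin (l + 1)) :
    (((SimplexCategory.δ i ≫ SimplexCategory.subinterval j (l + 1) h) a : Fin (n + 1)) : ℕ) =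
      (if (a : ℕ) < i then (a : ℕ) else a + 1) + j := by
  rw [comp_val, ← δ_val]
  rfl

theorem cup_apply {p q n : ℕ} (h : p + q = n) (f : K _⦋p⦌ → ℝ) (g : K _⦋q⦌ → ℝ) (σ : K _⦋n⦌) :
    cup h f g σ = f (K.map (SimplexCategory.subinterval (n := n) 0 p (by omega)).op σ) *
      g (K.map (SimplexCategory.subinterval (n := n) p q (by omega)).op σ) := rfl

theorem cochainD_apply {n : ℕ} (f : K _⦋n⦌ → ℝ) (σ : K _⦋n + 1⦌) :
    cochainD n f σ =
      ∑ i : Fin (n + 2), (-1 : ℝ) ^ (i : ℕ) * f (K.map (SimplexCategory.δ i).op σ) := rfl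

theorem cochainD_cochainD (n : ℕ) (f : K _⦋n⦌ → ℝ) : cochainD (n + 1) (cochainD n f) = 0 := by
  let Y := ((SimplicialObject.whiskering _ _).obj AddCommGrpCat.free).obj K
  let D : ∀ m : ℕ, FreeAbelianGroup (K _⦋m + 1⦌) →+ FreeAbelianGroup (K _⦋m⦌) := fun m =>
    (AlgebraicTopology.AlternatingFaceMapComplex.objD Y m).hom
  have hD : ∀ (m : ℕ) (σ : K _⦋m + 1⦌), D m (FreeAbelianGroup.of σ) =
      ∑ i : Fin (m + 2), (-1 : ℤ) ^ (i : ℕ) •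
        FreeAbelianGroup.of (K.map (SimplexCategory.δ i).op σ) := by
    intro m σ
    have h1 : D m = ∑ i : Fin (m + 2), (-1 : ℤ) ^ (i : ℕ) •
        FreeAbelianGroup.map (K.map (SimplexCategory.δ i).op) := by
      change (∑ i : Fin (m + 2), (-1 : ℤ) ^ (i : ℕ) • Y.δ i).hom = _
      rw [show (∑ i : Fin (m + 2), (-1 : ℤ) ^ (i : ℕ) • Y.δ i).hom =
        AddCommGrpCat.homAddEquiv (∑ i : Fin (m + 2), (-1 : ℤ) ^ (i : ℕ) • Y.δ i) from rfl, map_sum]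
      rfl
    rw [h1, AddMonoidHom.finsetSum_apply]
    rfl
  have hDD : ∀ x, D n (D (n + 1) x) = 0 := fun x =>
    DFunLike.congr_fun (congrArg AddCommGrpCat.Hom.hom
      (AlgebraicTopology.AlternatingFaceMapComplex.d_squared Y n)) x
  have key : ∀ (m : ℕ) (g : K _⦋m⦌ → ℝ),
      (FreeAbelianGroup.lift g).comp (D m) = FreeAbelianGroup.lift (cochainD m g) := by
    intro m g
    refine FreeAbelianGroup.lift_ext _ _ fun σ => ?_
    rw [AddMonoidHom.comp_apply, hD, map_sum, FreeAbelianGroup.lift_apply_of, cochainD_apply]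
    refine Finset.sum_congr rfl fun i _ => ?_
    rw [map_zsmul, FreeAbelianGroup.lift_apply_of, zsmul_eq_mul]
    push_cast
    rfl
  funext σ
  have h1 := DFunLike.congr_fun (key (n + 1) (cochainD n f)) (FreeAbelianGroup.of σ)
  rw [AddMonoidHom.comp_apply, FreeAbelianGroup.lift_apply_of, ← key n f,
    AddMonoidHom.comp_apply, hDD, map_zero] at h1
  exact h1.symm

set_option linter.unusedSimpArgs false in
theorem cochain_leibniz {p q n : ℕ} (h : p + q = n) (h₁ : p + 1 + q = n + 1)
    (h₂ : p + (q + 1) = n + 1) (f : K _⦋p⦌ → ℝ) (g : K _⦋q⦌ → ℝ) :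
    cochainD n (cup h f g) =
      cup h₁ (cochainD p f) g + (-1 : ℝ) ^ p • cup h₂ f (cochainD q g) := by
  subst h
  funext σ
  let s : Fin (p + 1) → ℝ := fun i => (-1 : ℝ) ^ (i : ℕ) *
    (f (K.map (SimplexCategory.δ i.castSucc ≫
      SimplexCategory.subinterval (n := p + q + 1) 0 (p + 1) (by omega)).op σ) *
      g (K.map (SimplexCategory.subinterval (n := p + q + 1) (p + 1) q (by omega)).op σ))
  let t : Fin (q + 1) → ℝ := fun j => (-1 : ℝ) ^ (p + 1 + j : ℕ) *
    (f (K.map (SimplexCategory.subinterval (n := p + q + 1) 0 p (by omega)).op σ) *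
      g (K.map (SimplexCategory.δ j.succ ≫
        SimplexCategory.subinterval (n := p + q + 1) p (q + 1) (by omega)).op σ))
  let c : ℝ := f (K.map (SimplexCategory.subinterval (n := p + q + 1) 0 p (by omega)).op σ) *
      g (K.map (SimplexCategory.subinterval (n := p + q + 1) (p + 1) q (by omega)).op σ)
  have hL : cochainD (p + q) (cup rfl f g) σ = ∑ i, s i + ∑ j, t j := by
    rw [cochainD_apply, ← Fin.sum_congr' _ (show (p + 1) + (q + 1) = p + q + 2 by omega),
      Fin.sum_univ_add]
    congr 1
    · refine Finset.sum_congr rfl fun i _ => ?_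
      have e1 : SimplexCategory.subinterval (n := p + q) 0 p (by omega) ≫
          SimplexCategory.δ (Fin.cast (by omega) (Fin.castAdd (q + 1) i)) =
          SimplexCategory.δ i.castSucc ≫
            SimplexCategory.subinterval (n := p + q + 1) 0 (p + 1) (by omega) := by
        refine hom_ext_val fun j => ?_
        simp only [subinterval_comp_δ_val, δ_comp_subinterval_val, subinterval_val, Fin.val_cast,
          Fin.val_castAdd, Fin.val_natAdd, Fin.val_succ, Fin.val_castSucc, Fin.val_last]
        split_ifs <;> omega
      have e2 : SimplexCategory.subinterval (n := p + q) p q (by omega) ≫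
          SimplexCategory.δ (Fin.cast (by omega) (Fin.castAdd (q + 1) i)) =
            SimplexCategory.subinterval (n := p + q + 1) (p + 1) q (by omega) := by
        refine hom_ext_val fun j => ?_
        simp only [subinterval_comp_δ_val, δ_comp_subinterval_val, subinterval_val, Fin.val_cast,
          Fin.val_castAdd, Fin.val_natAdd, Fin.val_succ, Fin.val_castSucc, Fin.val_last]
        split_ifs <;> omega
      simp only [cup_apply, map_op_map_op, s, e1, e2]
      simp
    · refine Finset.sum_congr rfl fun j _ => ?_
      have e1 : SimplexCategory.subinterval (n := p + q) 0 p (by omega) ≫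
          SimplexCategory.δ (Fin.cast (by omega) (Fin.natAdd (p + 1) j)) =
            SimplexCategory.subinterval (n := p + q + 1) 0 p (by omega) := by
        refine hom_ext_val fun i => ?_
        simp only [subinterval_comp_δ_val, δ_comp_subinterval_val, subinterval_val, Fin.val_cast,
          Fin.val_castAdd, Fin.val_natAdd, Fin.val_succ, Fin.val_castSucc, Fin.val_last]
        split_ifs <;> omega
      have e2 : SimplexCategory.subinterval (n := p + q) p q (by omega) ≫
          SimplexCategory.δ (Fin.cast (by omega) (Fin.natAdd (p + 1) j)) =
          SimplexCategory.δ j.succ ≫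
            SimplexCategory.subinterval (n := p + q + 1) p (q + 1) (by omega) := by
        refine hom_ext_val fun i => ?_
        simp only [subinterval_comp_δ_val, δ_comp_subinterval_val, subinterval_val, Fin.val_cast,
          Fin.val_castAdd, Fin.val_natAdd, Fin.val_succ, Fin.val_castSucc, Fin.val_last]
        split_ifs <;> omega
      simp only [cup_apply, map_op_map_op, t, e1, e2]
      simp
  have h1 : cup h₁ (cochainD p f) g σ = ∑ i, s i + (-1) ^ (p + 1) * c := by
    rw [cup_apply, cochainD_apply, Fin.sum_univ_castSucc, add_mul, Finset.sum_mul]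
    have e : SimplexCategory.δ (Fin.last (p + 1)) ≫
        SimplexCategory.subinterval (n := p + q + 1) 0 (p + 1) (by omega) =
        SimplexCategory.subinterval (n := p + q + 1) 0 p (by omega) := by
      refine hom_ext_val fun i => ?_
      simp only [subinterval_comp_δ_val, δ_comp_subinterval_val, subinterval_val, Fin.val_cast,
          Fin.val_castAdd, Fin.val_natAdd, Fin.val_succ, Fin.val_castSucc, Fin.val_last]
      split_ifs <;> omega
    simp only [map_op_map_op, e, mul_assoc, s, c, Fin.val_castSucc, Fin.val_last]
  have h2 : cup h₂ f (cochainD q g) σ = c + (-1) ^ (p + 1) * -∑ j, t j := by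
    rw [cup_apply, cochainD_apply, Fin.sum_univ_succ, mul_add, Finset.mul_sum,
      ← Finset.sum_neg_distrib, Finset.mul_sum]
    have e : SimplexCategory.δ 0 ≫
        SimplexCategory.subinterval (n := p + q + 1) p (q + 1) (by omega) =
        SimplexCategory.subinterval (n := p + q + 1) (p + 1) q (by omega) := by
      refine hom_ext_val fun i => ?_
      rw [δ_comp_subinterval_val, subinterval_val,
        if_neg (show ¬((i : ℕ) < ((0 : Fin (q + 2)) : ℕ)) from Nat.not_lt_zero _)]
      omega
    congr 1
    · simp only [map_op_map_op, e, c, Fin.val_zero, pow_zero, one_mul]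
    · refine Finset.sum_congr rfl fun j _ => ?_
      have hs : ((-1 : ℝ) ^ p) * (-1 : ℝ) ^ p = 1 := by rw [← mul_pow]; norm_num
      simp only [map_op_map_op, t, Fin.val_succ, pow_add, pow_one]
      linear_combination ((-1 : ℝ) ^ (j : ℕ) *
        f (K.map (SimplexCategory.subinterval (n := p + q + 1) 0 p (by omega)).op σ) *
        g (K.map (SimplexCategory.δ j.succ ≫
          SimplexCategory.subinterval (n := p + q + 1) p (q + 1) (by omega)).op σ)) * hs
  rw [hL, Pi.add_apply, Pi.smul_apply, h1, h2, smul_eq_mul, pow_succ]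
  have hs : ((-1 : ℝ) ^ p) * (-1 : ℝ) ^ p = 1 := by rw [← mul_pow]; norm_num
  linear_combination (-(∑ j, t j)) * hs

/-- The whole interval as a subinterval. -/
theorem subinterval_full {n : ℕ} (h : 0 + n ≤ n) :
    SimplexCategory.subinterval (n := n) 0 n h = 𝟙 ⦋n⦌ :=
  hom_ext_val fun _ => rfl

theorem subinterval_comp {n m j l j' l' : ℕ} (h : j + l ≤ m) (h' : j' + m ≤ n)
    (h'' : l' + l ≤ n) (e : l' = j + j') :
    SimplexCategory.subinterval (n := m) j l h ≫ SimplexCategory.subinterval (n := n) j' m h' =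
      SimplexCategory.subinterval (n := n) l' l h'' := by
  subst e
  refine hom_ext_val fun i => ?_
  rw [comp_val, subinterval_val, subinterval_val, subinterval_val]
  omega

variable (K) in
/-- The cochain algebra `C^*(K)` of real valued simplicial cochains on a simplicial set. -/
def Cochains : CochainAlgebra.{u} where
  C n := K _⦋n⦌ → ℝ
  d := cochainD
  d_d := cochainD_cochainD
  mul := cup
  one := fun _ => 1
  one_mul h a := by
    funext σ
    rw [cup_apply, subinterval_full]
    simp
  mul_one h a := by
    funext σ
    rw [cup_apply, subinterval_full]
    simp
  mul_assoc {p q r m l n} h₁ h₂ h₃ h₄ a b c := by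
    funext σ
    simp only [cup_apply, map_op_map_op]
    rw [subinterval_comp _ _ (show 0 + p ≤ n by omega) (by omega),
      subinterval_comp _ _ (show p + q ≤ n by omega) (by omega),
      subinterval_comp _ _ (show p + q ≤ n by omega) (by omega),
      subinterval_comp _ _ (show m + r ≤ n by omega) (by omega), mul_assoc]
  leibniz := cochain_leibniz

end SimplicialCochains
section DeRham

variable (K : SSet.{u})

/-- The elements of degree `k` in `A_DR(K)`: morphisms of simplicial sets from `K` to the
simplicial set `n ↦ Ω^k(𝔸ⁿ)`. -/
def adrSubmodule (k : ℕ) :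
    Submodule ℝ (∀ n : SimplexCategoryᵒᵖ, K.obj n → Form (affineSpace n.unop.len) k) where
  carrier := {Φ | ∀ (n m : SimplexCategoryᵒᵖ) (τ : n ⟶ m) (σ : K.obj n),
    Φ m (K.map τ σ) = Form.pullback (affineMap τ.unop) (affineMap_dSmooth τ.unop) (Φ n σ)}
  add_mem' := fun {Φ Ψ} hΦ hΨ n m τ σ => by
    simp only [Pi.add_apply, hΦ n m τ σ, hΨ n m τ σ, map_add]
  zero_mem' := fun n m τ σ => by simp
  smul_mem' := fun c Φ hΦ n m τ σ => by
    simp only [Pi.smul_apply, hΦ n m τ σ, map_smul]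

/-- The type of elements of degree `k` in `A_DR(K)`. -/
def ADRForm (k : ℕ) : Type u := adrSubmodule K k

instance (k : ℕ) : AddCommGroup (ADRForm K k) := inferInstanceAs (AddCommGroup (adrSubmodule K k))

instance (k : ℕ) : Module ℝ (ADRForm K k) := inferInstanceAs (Module ℝ (adrSubmodule K k))

variable {K} in
theorem ADRForm.ext {k : ℕ} {Φ Ψ : ADRForm K k} (h : ∀ n σ, Φ.1 n σ = Ψ.1 n σ) : Φ = Ψ :=
  Subtype.ext (funext fun n => funext fun σ => h n σ)

/-- The cochain algebra `A_DR(K)` of a simplicial set `K`: simplicial maps from `K` to the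
simplicial cochain algebra `n ↦ Ω^*(𝔸ⁿ)`, with pointwise operations. -/
def ADR : CochainAlgebra.{u} where
  C k := ADRForm K k
  d k :=
    { toFun := fun Φ => ⟨fun n σ => (Omega _).d k (Φ.1 n σ), fun n m τ σ => by
        simp only [Φ.2 n m τ σ]
        rfl⟩
      map_add' := fun Φ Ψ => by
        exact ADRForm.ext fun n σ => map_add ((Omega _).d k) _ _
      map_smul' := fun c Φ => by
        exact ADRForm.ext fun n σ => map_smul ((Omega _).d k) _ _ }
  d_d k Φ := by
    exact ADRForm.ext fun n σ => (Omega _).d_d k _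
  mul h := LinearMap.mk₂ ℝ
    (fun Φ Ψ => ⟨fun n σ => (Omega _).mul h (Φ.1 n σ) (Ψ.1 n σ), fun n m τ σ => by
      simp only [Φ.2 n m τ σ, Ψ.2 n m τ σ]
      rfl⟩)
    (fun Φ Φ' Ψ => by exact ADRForm.ext fun n σ => LinearMap.map_add₂ ((Omega _).mul h) _ _ _)
    (fun c Φ Ψ => by exact ADRForm.ext fun n σ => LinearMap.map_smul₂ ((Omega _).mul h) _ _ _)
    (fun Φ Ψ Ψ' => by exact ADRForm.ext fun n σ => map_add ((Omega _).mul h _) _ _)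
    (fun c Φ Ψ => by exact ADRForm.ext fun n σ => map_smul ((Omega _).mul h _) _ _)
  one := ⟨fun n σ => (Omega _).one, fun n m τ σ => rfl⟩
  one_mul h Φ := by exact ADRForm.ext fun n σ => (Omega _).one_mul h _
  mul_one h Φ := by exact ADRForm.ext fun n σ => (Omega _).mul_one h _
  mul_assoc h₁ h₂ h₃ h₄ a b c := by
    exact ADRForm.ext fun n σ => (Omega _).mul_assoc h₁ h₂ h₃ h₄ _ _ _
  leibniz h h₁ h₂ a b := by exact ADRForm.ext fun n σ => (Omega _).leibniz h h₁ h₂ _ _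

/-- The inverse `(x₁, …, xₚ) ↦ (1 - ∑ xᵢ, x₁, …, xₚ)` of the diffeomorphism `𝔸ᵖ → ℝᵖ` that forgets
the coordinate with index `0`. -/
def chart (p : ℕ) (x : EuclideanSpace ℝ (Fin p)) : affineSpace p :=
  ⟨WithLp.toLp 2 (Fin.cons (1 - ∑ i, x i) (fun i => x i)), by
    change ∑ i : Fin (p + 1), (Fin.cons (1 - ∑ i, x i) (fun i => x i) : Fin (p + 1) → ℝ) i = 1
    rw [Fin.sum_univ_succ]
    simp⟩

theorem chart_isPlot (p : ℕ) : IsPlot (chart p) := by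
  have : ContDiff ℝ ∞ (Subtype.val ∘ chart p) := by
    rw [contDiff_euclidean]
    intro j
    refine Fin.cases ?_ (fun i => ?_) j
    · change ContDiff ℝ ∞ (fun x : EuclideanSpace ℝ (Fin p) => 1 - ∑ i, x i)
      fun_prop
    · change ContDiff ℝ ∞ (fun x : EuclideanSpace ℝ (Fin p) => x i)
      fun_prop
  exact this.isPlot

/-- The integral `∫_{Δᵖ} η` of a `p`-form `η` on `𝔸ᵖ`: in the coordinates `x₁, …, xₚ` of `𝔸ᵖ`, write
`η = f dx₁ ∧ ⋯ ∧ dxₚ` and integrate `f` over the simplex. -/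
def simplexIntegral (p : ℕ) (η : Form (affineSpace p) p) : ℝ :=
  ∫ x in chart p ⁻¹' simplexSub p,
    η.1 p ⟨chart p, chart_isPlot p⟩ x (fun i => EuclideanSpace.single i (1 : ℝ))

/-- The integration `A_DR^p(K) → C^p(K)`: `(∫ Φ)(σ) = ∫_{Δᵖ} Φ(σ)`. -/
def integration (p : ℕ) (Φ : (ADR K).C p) : (Cochains K).C p :=
  fun σ => simplexIntegral p (Φ.1 (op ⦋p⦌) σ)

end DeRham

section Target

/-- The map `C^p(L) → C^p(K)` of simplicial cochains induced by a morphism `k : ℤK → ℤL` of chain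
complexes: `(k^* f)(σ) = f(k(σ))`, where `f` is extended additively to chains. -/
def pullCochain {K L : SSet.{u}} (k : chains.obj K ⟶ chains.obj L) (p : ℕ)
    (f : (Cochains L).C p) : (Cochains K).C p :=
  fun σ =>
    let c : FreeAbelianGroup (L _⦋p⦌) := (k.f p).hom (FreeAbelianGroup.of σ : FreeAbelianGroup _)
    FreeAbelianGroup.lift (f : L _⦋p⦌ → ℝ) c

variable (X : Type u) [DiffeologicalSpace X]

/-- A chain homotopy equivalence `ℤS^D_•(X) ≃ ℤS^D_•(X)_sub` whose underlying map is the
restriction map; its inverse part is a homotopy inverse of the restriction map. -/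
structure RestrictionEquiv where
  equiv : HomotopyEquiv (chains.obj (SD X)) (chains.obj (SDsub X))
  hom_eq : equiv.hom = chains.map (restriction X)

variable {X}

/-- The integration map `A_DR^p(S^D_•(X)) → C^p(S^D_•(X)_sub)`: the integration map
`A_DR^p(S^D_•(X)) → C^p(S^D_•(X))`, followed by the map `k^*` of cochains induced by a homotopy
inverse `k : ℤS^D_•(X)_sub → ℤS^D_•(X)` of the restriction map. -/
def integrationSub (e : RestrictionEquiv X) (p : ℕ) (Φ : (ADR (SD X)).C p) :
    (Cochains (SDsub X)).C p :=
  pullCochain e.equiv.inv p (integration (SD X) p Φ)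

end Target

end DiffDeRham

end

noncomputable section

namespace DiffDeRham

open CategoryTheory Simplicial Diffeology Opposite MeasureTheory
open scoped ContDiff Nat

universe u

/-! ### Smooth dependence of integrals over `[0, 1]` on parameters -/

section ParametricIntegral

variable {E G : Type} [NormedAddCommGroup E] [NormedSpace ℝ E] [FiniteDimensional ℝ E]
  [NormedAddCommGroup G] [NormedSpace ℝ G]

/-! Two independent facts are combined. For every simplicial set `K`, integration `A_DR(K) → C^*(K)`
is an isomorphism of algebras on cohomology. The restriction of singular simplices is a chain
homotopy equivalence, and every homotopy inverse of it induces an isomorphism of algebras on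
cohomology.

De Rham's theorem for `K`. Let `cone i` be the homotopy operator of the straight contraction of `𝔸ⁿ`
to its `i`-th vertex. It satisfies `d ∘ cone + cone ∘ d = id` in positive degrees and is natural for
all maps of vertices, monotone or not (`vpull_cone`). Starting from a closed form `a`, put `U₀ = a`
and `U_{j+1}(i₀, …, i_j) = cone i_j (U_j(i₀, …, i_{j-1}))`. Then `d U_{j+1}` is, up to sign, the
Čech differential of `U_j`, and after the last cone this Čech differential consists of constants,
namely up to sign the integrals of `a` over the simplices spanned by tuples of vertices. So in the
double complex of natural families of forms indexed by tuples, `a` and its integrals are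
cohomologous; `IsConeClosed.sub_mem_Bd` transports this to any cochain algebra that receives a map
compatible with the total differential.

Two such maps are used. The Whitney map `V ↦ ∑ x_{i₀} dx_{i₁} ∧ ⋯ ∧ dx_{i_j} ∧ V_i` (`d_whitney`)
shows that `a` is cohomologous to the Whitney form of its integrals. The map that multiplies by a
closed form `b`, evaluates at the front vertices and integrates over the back face (`d_frontBack`)
shows that `∫ a ∧ b` and `∫ a ∪ ∫ b` are cohomologous.

For bijectivity, a cochain is first replaced by a normalized one by means of the Dold–Kan
projections and then extended to an alternating function of tuples. The Whitney form of such an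
extension integrates back to the cochain (`simplexInt_whitney`), and its differential is the Whitney
form of the Čech differential. Integrals over simplices are iterated cones (`simplexIntegral_succ`),
which makes Stokes' theorem (`simplexInt_d`) a formal consequence of the homotopy formula.

The restriction. Normalizing the coordinates `expNegInvGlue xᵢ` gives smooth maps `𝔸ⁿ → Δⁿ`. They
commute with faces because `expNegInvGlue 0 = 0`; they need not commute with degeneracies, but chain
complexes only see faces. Straight segments from `x` to its image give the chain homotopies on both
sides. Pullback of cochains along the restriction preserves cup products on the nose, so its inverse
on cohomology is multiplicative as well. -/

/-- Dominated differentiation under the integral: the derivative of `F` is bounded by a constant on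
the compact set `[0, 1] × closedBall y 1`. -/
theorem hasFDerivAt_intervalIntegral_of_contDiff {F : ℝ × E → G} (hF : ContDiff ℝ 1 F) (y : E) :
    HasFDerivAt (fun y => ∫ t in (0:ℝ)..1, F (t, y))
      (∫ t in (0:ℝ)..1, (fderiv ℝ F (t, y)).comp (ContinuousLinearMap.inr ℝ ℝ E)) y := by
  have : ProperSpace E := FiniteDimensional.proper_rclike ℝ E
  have hF' : Continuous fun z : ℝ × E => (fderiv ℝ F z).comp (ContinuousLinearMap.inr ℝ ℝ E) :=
    (hF.continuous_fderiv one_ne_zero).clm_comp continuous_const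
  obtain ⟨M, hM⟩ := ((isCompact_Icc (a := (0:ℝ)) (b := 1)).prod
    (isCompact_closedBall y 1)).exists_bound_of_continuousOn hF'.continuousOn
  refine intervalIntegral.hasFDerivAt_integral_of_dominated_of_fderiv_le
    (F' := fun y t => (fderiv ℝ F (t, y)).comp (ContinuousLinearMap.inr ℝ ℝ E))
    (bound := fun _ => M) (Metric.closedBall_mem_nhds y one_pos) ?_ ?_ ?_ ?_ ?_ ?_
  · exact Filter.Eventually.of_forall fun x =>
      (hF.continuous.comp (Continuous.prodMk_left x)).aestronglyMeasurable
  · exact (hF.continuous.comp (Continuous.prodMk_left y)).intervalIntegrable _ _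
  · exact (hF'.comp (Continuous.prodMk_left y)).aestronglyMeasurable
  · refine Filter.Eventually.of_forall fun t ht x hx => hM (t, x) ⟨?_, hx⟩
    rw [Set.uIoc_of_le zero_le_one] at ht
    exact ⟨ht.1.le, ht.2⟩
  · exact intervalIntegrable_const
  · refine Filter.Eventually.of_forall fun t _ x _ => ?_
    exact ((hF.differentiable one_ne_zero (t, x)).hasFDerivAt).comp x (hasFDerivAt_prodMk_right t x)

/-- The derivative of the integral is again an integral of a smooth function, now with values in `E
→L[ℝ] G`; hence the induction runs over all targets at once. -/
theorem contDiff_nat_intervalIntegral (n : ℕ) {G : Type} [NormedAddCommGroup G] [NormedSpace ℝ G]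
    {F : ℝ × E → G} (hF : ContDiff ℝ ∞ F) :
    ContDiff ℝ n (fun y => ∫ t in (0:ℝ)..1, F (t, y)) := by
  induction n generalizing G with
  | zero =>
    refine contDiff_zero.2 (continuous_iff_continuousAt.2 fun y => ?_)
    exact (hasFDerivAt_intervalIntegral_of_contDiff (hF.of_le (by simp)) y).continuousAt
  | succ n ih =>
    rw [Nat.cast_succ, contDiff_succ_iff_fderiv]
    refine ⟨fun y => (hasFDerivAt_intervalIntegral_of_contDiff
      (hF.of_le (by simp)) y).differentiableAt, by simp, ?_⟩
    have : fderiv ℝ (fun y => ∫ t in (0:ℝ)..1, F (t, y)) = fun y =>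
        ∫ t in (0:ℝ)..1, (fderiv ℝ F (t, y)).comp (ContinuousLinearMap.inr ℝ ℝ E) :=
      funext fun y => (hasFDerivAt_intervalIntegral_of_contDiff (hF.of_le (by simp)) y).fderiv
    rw [this]
    exact ih (F := fun z => (fderiv ℝ F z).comp (ContinuousLinearMap.inr ℝ ℝ E))
      ((hF.fderiv_right (m := ∞) (by simp)).clm_comp contDiff_const)

theorem contDiff_intervalIntegral {F : ℝ × E → G} (hF : ContDiff ℝ ∞ F) :
    ContDiff ℝ ∞ (fun y => ∫ t in (0:ℝ)..1, F (t, y)) :=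
  contDiff_infty.2 fun n => contDiff_nat_intervalIntegral n hF

end ParametricIntegral

/-! ### Contraction with the parameter direction on `ℝᵐ⁺¹ = ℝ × ℝᵐ` -/

section Slant

/-- The vector `e₀` of `ℝᵐ⁺¹`. -/
def headVec (m : ℕ) : EuclideanSpace ℝ (Fin (m + 1)) := EuclideanSpace.single 0 1

/-- The inclusion `y ↦ (0, y)` of `ℝᵐ` into `ℝᵐ⁺¹`. -/
def tailIncl (m : ℕ) : EuclideanSpace ℝ (Fin m) →L[ℝ] EuclideanSpace ℝ (Fin (m + 1)) :=
  LinearMap.toContinuousLinearMap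
    { toFun := fun y => WithLp.toLp 2 (Fin.cons 0 (fun i => y i))
      map_add' := fun x y => by
        ext i
        refine Fin.cases ?_ (fun i => ?_) i <;> simp
      map_smul' := fun c y => by
        ext i
        refine Fin.cases ?_ (fun i => ?_) i <;> simp }

/-- The projection `(t, y) ↦ y` of `ℝᵐ⁺¹` onto `ℝᵐ`. -/
def tailProj (m : ℕ) : EuclideanSpace ℝ (Fin (m + 1)) →L[ℝ] EuclideanSpace ℝ (Fin m) :=
  LinearMap.toContinuousLinearMap
    { toFun := fun z => WithLp.toLp 2 (fun i => z i.succ)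
      map_add' := fun x y => by ext i; simp
      map_smul' := fun c y => by ext i; simp }

variable {m : ℕ}

@[simp] theorem headVec_zero : headVec m 0 = 1 := by simp [headVec]
@[simp] theorem headVec_succ (i : Fin m) : headVec m i.succ = 0 := by simp [headVec]
@[simp] theorem tailIncl_zero (y : EuclideanSpace ℝ (Fin m)) : tailIncl m y 0 = 0 := rfl
@[simp] theorem tailIncl_succ (y : EuclideanSpace ℝ (Fin m)) (i : Fin m) :
    tailIncl m y i.succ = y i := rfl
@[simp] theorem tailProj_apply (z : EuclideanSpace ℝ (Fin (m + 1))) (i : Fin m) :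
    tailProj m z i = z i.succ := rfl
@[simp] theorem tailProj_headVec : tailProj m (headVec m) = 0 := by ext i; simp
@[simp] theorem tailProj_tailIncl (y : EuclideanSpace ℝ (Fin m)) :
    tailProj m (tailIncl m y) = y := by ext i; simp

/-- The contraction of a form on `ℝᵐ⁺¹` with `e₀`, restricted to `ℝᵐ`. -/
def slant (m k : ℕ) : (EuclideanSpace ℝ (Fin (m + 1)) [⋀^Fin (k + 1)]→L[ℝ] ℝ) →L[ℝ]
    (EuclideanSpace ℝ (Fin m) [⋀^Fin k]→L[ℝ] ℝ) :=
  (ContinuousAlternatingMap.compContinuousLinearMapCLM (tailIncl m)).comp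
    ((ContinuousLinearMap.apply ℝ _ (headVec m)).comp
      (ContinuousAlternatingMap.curryLeftLI (𝕜 := ℝ) (E := EuclideanSpace ℝ (Fin (m + 1))) (F := ℝ)
        (n := k)).toContinuousLinearMap)

theorem slant_apply {k : ℕ} (β : EuclideanSpace ℝ (Fin (m + 1)) [⋀^Fin (k + 1)]→L[ℝ] ℝ)
    (v : Fin k → EuclideanSpace ℝ (Fin m)) :
    slant m k β v = β (Matrix.vecCons (headVec m) (tailIncl m ∘ v)) := rfl

/-- Pointwise Cartan formula `d ι + ι d = ∂ₜ`, where `L` stands for the derivative of a form. In the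
second summand the terms that differentiate along `ℝᵐ` cancel the first summand, because the
contracted vector shifts every index by one; only the derivative along `headVec` remains. -/
theorem slant_alternatizeUncurryFin {k : ℕ} (L : EuclideanSpace ℝ (Fin (m + 1)) →L[ℝ]
      EuclideanSpace ℝ (Fin (m + 1)) [⋀^Fin (k + 1)]→L[ℝ] ℝ) :
    ContinuousAlternatingMap.alternatizeUncurryFin
        (((slant m k).comp L).comp (tailIncl m)) +
      slant m (k + 1) (ContinuousAlternatingMap.alternatizeUncurryFin L) =
      (L (headVec m)).compContinuousLinearMap (tailIncl m) := by
  ext v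
  rw [ContinuousAlternatingMap.add_apply, slant_apply,
    ContinuousAlternatingMap.alternatizeUncurryFin_apply,
    ContinuousAlternatingMap.alternatizeUncurryFin_apply, Fin.sum_univ_succ (n := k + 1)]
  have h1 : ∀ i : Fin (k + 1), (-1 : ℤ) ^ (i.succ : ℕ) •
      (L (Matrix.vecCons (headVec m) (tailIncl m ∘ v) i.succ))
        (i.succ.removeNth (Matrix.vecCons (headVec m) (tailIncl m ∘ v))) =
      -((-1 : ℤ) ^ (i : ℕ) • (((slant m k).comp L).comp (tailIncl m) (v i)) (i.removeNth v)) := by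
    intro i
    have h2 : i.succ.removeNth (Matrix.vecCons (headVec m) (tailIncl m ∘ v)) =
        Matrix.vecCons (headVec m) (tailIncl m ∘ i.removeNth v) := by
      funext j
      refine Fin.cases ?_ (fun j => ?_) j <;> simp [Fin.removeNth]
    rw [h2, Fin.val_succ, pow_succ]
    simp [slant_apply]
  rw [Finset.sum_congr rfl fun i _ => h1 i, Finset.sum_neg_distrib]
  simp only [Fin.val_zero, pow_zero, one_smul, Matrix.cons_val_zero]
  rw [add_comm (L (headVec m) _), ← add_assoc, add_neg_cancel, zero_add]
  rfl


/-- The point `(t, y)` of `ℝᵐ⁺¹`. -/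
def consPt (t : ℝ) (y : EuclideanSpace ℝ (Fin m)) : EuclideanSpace ℝ (Fin (m + 1)) :=
  t • headVec m + tailIncl m y

@[simp] theorem consPt_zero (t : ℝ) (y : EuclideanSpace ℝ (Fin m)) : consPt t y 0 = t := by
  simp [consPt]

@[simp] theorem consPt_succ (t : ℝ) (y : EuclideanSpace ℝ (Fin m)) (i : Fin m) :
    consPt t y i.succ = y i := by
  simp [consPt]

@[simp] theorem tailProj_consPt (t : ℝ) (y : EuclideanSpace ℝ (Fin m)) :
    tailProj m (consPt t y) = y := by
  ext i; simp

theorem hasFDerivAt_consPt (t : ℝ) (y : EuclideanSpace ℝ (Fin m)) :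
    HasFDerivAt (fun y => consPt t y) (tailIncl m) y :=
  (tailIncl m).hasFDerivAt.const_add _

theorem contDiff_consPt : ContDiff ℝ ∞ (fun z : ℝ × EuclideanSpace ℝ (Fin m) =>
    consPt z.1 z.2) := by
  unfold consPt
  exact (contDiff_fst.smul contDiff_const).add ((tailIncl m).contDiff.comp contDiff_snd)

end Slant

/-! ### The homotopy operator of a smooth deformation -/

section HomotopyOperator

variable {X : Type u} [DiffeologicalSpace X]

variable (X) in
/-- A smooth deformation of a diffeological space, ending at the identity. -/
structure Deformation where
  toFun : ℝ → X → X
  isPlot : ∀ {m : ℕ} (P : EuclideanSpace ℝ (Fin m) → X), IsPlot P →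
    IsPlot fun z : EuclideanSpace ℝ (Fin (m + 1)) => toFun (z 0) (P (tailProj m z))
  one : ∀ x, toFun 1 x = x

variable (H : Deformation X)

/-- The plot `(t, y) ↦ H t (P y)`. -/
def Deformation.plot {m : ℕ} (P : Plot X m) : Plot X (m + 1) :=
  ⟨fun z => H.toFun (z 0) (P.1 (tailProj m z)), H.isPlot P.1 P.2⟩

theorem contDiff_slant {k m : ℕ} (η : Form X (k + 1)) (P : Plot X (m + 1)) :
    ContDiff ℝ ∞ fun z : ℝ × EuclideanSpace ℝ (Fin m) =>
      slant m k (η.1 (m + 1) P (consPt z.1 z.2)) :=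
  (slant m k).contDiff.comp ((Form.contDiff η P).comp contDiff_consPt)

/-- The map in question is `(t, y) ↦ (t, f y)`. Its derivative is what makes the homotopy operator
natural in the plot. -/
theorem hasFDerivAt_prolong {m m' : ℕ} {f : EuclideanSpace ℝ (Fin m') → EuclideanSpace ℝ (Fin m)}
    (hf : ContDiff ℝ ∞ f) (t : ℝ) (y : EuclideanSpace ℝ (Fin m')) :
    HasFDerivAt (fun z => consPt (z 0) (f (tailProj m' z)))
      ((ContinuousLinearMap.smulRight (EuclideanSpace.proj 0 : _ →L[ℝ] ℝ) (headVec m)) +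
        (tailIncl m).comp ((fderiv ℝ f y).comp (tailProj m'))) (consPt t y) := by
  unfold consPt
  refine HasFDerivAt.add ?_ ?_
  · exact (ContinuousLinearMap.smulRight
      (EuclideanSpace.proj 0 : EuclideanSpace ℝ (Fin (m' + 1)) →L[ℝ] ℝ) (headVec m)).hasFDerivAt
  · refine (tailIncl m).hasFDerivAt.comp _ (HasFDerivAt.comp _ ?_ (tailProj m').hasFDerivAt)
    have : tailProj m' (t • headVec m' + tailIncl m' y) = y := tailProj_consPt t y
    rw [this]
    exact (hf.differentiable (by simp) y).hasFDerivAt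

/-- The homotopy operator `η ↦ ∫₀¹ ι_{∂t} H^*η dt` of a deformation. -/
def Deformation.op (k : ℕ) : Form X (k + 1) →ₗ[ℝ] Form X k where
  toFun η := ⟨fun m P y => ∫ t in (0:ℝ)..1, slant m k (η.1 (m + 1) (H.plot P) (consPt t y)),
    fun m P => contDiff_intervalIntegral (contDiff_slant η (H.plot P)), fun m m' P f hf y => by
      have hF : ContDiff ℝ ∞ fun z : EuclideanSpace ℝ (Fin (m' + 1)) =>
          consPt (z 0) (f (tailProj m' z)) :=
        contDiff_consPt.comp (f := fun z : EuclideanSpace ℝ (Fin (m' + 1)) =>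
            (z 0, f (tailProj m' z)))
          ((EuclideanSpace.proj (0 : Fin (m' + 1)) :
            EuclideanSpace ℝ (Fin (m' + 1)) →L[ℝ] ℝ).contDiff.prodMk
              (hf.comp (tailProj m').contDiff))
      -- Deforming `P ∘ f` is the same as reparametrizing the deformation of `P` by `(t, y) ↦ (t, f
      -- y)`, so naturality of `η` applies. The derivative of this map fixes the parameter direction
      -- and hence commutes with `slant`.
      have hP : H.plot (P.comp f hf) = (H.plot P).comp _ hF := by
        refine Subtype.ext (funext fun z => ?_)
        simp [Deformation.plot, Plot.comp]
      have key : ∀ t : ℝ, slant m' k (η.1 (m' + 1) (H.plot (P.comp f hf)) (consPt t y)) =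
          ContinuousAlternatingMap.compContinuousLinearMapCLM (fderiv ℝ f y)
            (slant m k (η.1 (m + 1) (H.plot P) (consPt t (f y)))) := by
        intro t
        rw [hP, η.2.2 _ _ _ _ hF, (hasFDerivAt_prolong hf t y).fderiv]
        ext v
        simp only [slant_apply, ContinuousAlternatingMap.compContinuousLinearMap_apply,
          ContinuousAlternatingMap.compContinuousLinearMapCLM_apply, consPt_zero, tailProj_consPt]
        congr 1
        funext i
        refine Fin.cases ?_ (fun i => ?_) i
        · simp
        · simp
      simp only [key]
      rw [ContinuousLinearMap.intervalIntegral_comp_comm]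
      · rfl
      · exact ((contDiff_slant η (H.plot P)).continuous.comp
          (Continuous.prodMk_left (f y))).intervalIntegrable _ _⟩
  map_add' η ζ := by
    refine Form.ext fun m P y => ?_
    change ∫ t in (0:ℝ)..1, slant m k (η.1 (m + 1) (H.plot P) (consPt t y) +
      ζ.1 (m + 1) (H.plot P) (consPt t y)) = _
    simp only [map_add]
    exact intervalIntegral.integral_add
      (((contDiff_slant η (H.plot P)).continuous.comp
          (Continuous.prodMk_left y)).intervalIntegrable _ _)
      (((contDiff_slant ζ (H.plot P)).continuous.comp
          (Continuous.prodMk_left y)).intervalIntegrable _ _)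
  map_smul' c η := by
    refine Form.ext fun m P y => ?_
    change ∫ t in (0:ℝ)..1, slant m k (c • η.1 (m + 1) (H.plot P) (consPt t y)) = _
    simp only [map_smul]
    exact intervalIntegral.integral_smul _ _

theorem Deformation.op_apply {k m : ℕ} (η : Form X (k + 1)) (P : Plot X m)
    (y : EuclideanSpace ℝ (Fin m)) : (H.op k η).1 m P y =
      ∫ t in (0:ℝ)..1, slant m k (η.1 (m + 1) (H.plot P) (consPt t y)) := rfl

/-- The integral of the derivative in the direction of the deformation parameter. -/
theorem Deformation.integral_fderiv {k m : ℕ} (η : Form X k) (P : Plot X m)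
    (y : EuclideanSpace ℝ (Fin m)) (P₀ : Plot X m) (hP₀ : ∀ y, P₀.1 y = H.toFun 0 (P.1 y)) :
    ∫ t in (0:ℝ)..1, ((fderiv ℝ (η.1 (m + 1) (H.plot P)) (consPt t y)
        (headVec m)).compContinuousLinearMap (tailIncl m)) = η.1 m P y - η.1 m P₀ y := by
  have hc : ∀ t : ℝ, ContDiff ℝ ∞ (fun y : EuclideanSpace ℝ (Fin m) => consPt t y) :=
    fun t => contDiff_consPt.comp (contDiff_const.prodMk contDiff_id)
  -- `P` and `P₀` are the slices `t = 1` and `t = 0` of `H.plot P`; the claim is then the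
  -- fundamental theorem of calculus along `t ↦ consPt t y`.
  have h1 : P = (H.plot P).comp _ (hc 1) := by
    refine Subtype.ext (funext fun z => ?_)
    simp [Deformation.plot, Plot.comp, H.one]
  have h0 : P₀ = (H.plot P).comp _ (hc 0) := by
    refine Subtype.ext (funext fun z => ?_)
    simp [Deformation.plot, Plot.comp, hP₀]
  have e1 : η.1 m P y = (η.1 (m + 1) (H.plot P) (consPt 1 y)).compContinuousLinearMap
      (tailIncl m) := by
    conv_lhs => rw [h1]
    rw [η.2.2 _ _ _ _ (hc 1), (hasFDerivAt_consPt 1 y).fderiv]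
  have e0 : η.1 m P₀ y = (η.1 (m + 1) (H.plot P) (consPt 0 y)).compContinuousLinearMap
      (tailIncl m) := by
    conv_lhs => rw [h0]
    rw [η.2.2 _ _ _ _ (hc 0), (hasFDerivAt_consPt 0 y).fderiv]
  rw [e1, e0]
  have hsm := Form.contDiff η (H.plot P)
  have hcons : ∀ t : ℝ, HasDerivAt (fun t => consPt t y) (headVec m) t := fun t => by
    unfold consPt
    simpa using ((hasDerivAt_id t).smul_const (headVec m)).add_const (tailIncl m y)
  refine intervalIntegral.integral_eq_sub_of_hasDerivAt
    (f := fun t => ContinuousAlternatingMap.compContinuousLinearMapCLM (tailIncl m)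
      (η.1 (m + 1) (H.plot P) (consPt t y)))
    (f' := fun t => ContinuousAlternatingMap.compContinuousLinearMapCLM (tailIncl m)
      (fderiv ℝ (η.1 (m + 1) (H.plot P)) (consPt t y) (headVec m))) (fun t _ => ?_) ?_
  · refine (ContinuousLinearMap.hasFDerivAt _).comp_hasDerivAt t ?_
    exact (hsm.differentiable (by simp) _).hasFDerivAt.comp_hasDerivAt t (hcons t)
  · refine Continuous.intervalIntegrable ?_ _ _
    refine (ContinuousLinearMap.continuous _).comp (Continuous.clm_apply ?_ continuous_const)
    exact (hsm.continuous_fderiv (by simp)).comp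
      (contDiff_consPt.continuous.comp (Continuous.prodMk_left y))

theorem continuous_fderiv_consPt {k m : ℕ} (η : Form X k) (P : Plot X (m + 1))
    (y : EuclideanSpace ℝ (Fin m)) :
    Continuous fun t : ℝ => fderiv ℝ (η.1 (m + 1) P) (consPt t y) :=
  ((Form.contDiff η P).continuous_fderiv (by simp)).comp
    (contDiff_consPt.continuous.comp (Continuous.prodMk_left y))

/-- The homotopy formula in positive degrees. -/
theorem Deformation.d_op_add_op_d {k m : ℕ} (η : Form X (k + 1)) (P : Plot X m)
    (y : EuclideanSpace ℝ (Fin m)) (P₀ : Plot X m) (hP₀ : ∀ y, P₀.1 y = H.toFun 0 (P.1 y)) :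
    (Form.d k (H.op k η)).1 m P y + (H.op (k + 1) (Form.d (k + 1) η)).1 m P y =
      η.1 m P y - η.1 m P₀ y := by
  have hd : HasFDerivAt ((H.op k η).1 m P) (∫ t in (0:ℝ)..1, ((slant m k).comp
      (fderiv ℝ (η.1 (m + 1) (H.plot P)) (consPt t y))).comp (tailIncl m)) y := by
    have := hasFDerivAt_intervalIntegral_of_contDiff
      ((contDiff_slant η (H.plot P)).of_le (by simp)) y
    refine this.congr_fderiv (intervalIntegral.integral_congr fun t _ => ?_)
    have h1 : HasFDerivAt (fun z : ℝ × EuclideanSpace ℝ (Fin m) =>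
        slant m k (η.1 (m + 1) (H.plot P) (consPt z.1 z.2))) _ (t, y) :=
      ((contDiff_slant η (H.plot P)).differentiable (by simp) (t, y)).hasFDerivAt
    have h2 := h1.comp y (hasFDerivAt_prodMk_right t y)
    have h3 : HasFDerivAt (fun y => slant m k (η.1 (m + 1) (H.plot P) (consPt t y)))
        (((slant m k).comp (fderiv ℝ (η.1 (m + 1) (H.plot P)) (consPt t y))).comp
          (tailIncl m)) y :=
      ((slant m k).hasFDerivAt.comp _
        (Form.differentiableAt η (H.plot P) _).hasFDerivAt).comp y (hasFDerivAt_consPt t y)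
    exact h2.unique h3
  have e1 : (Form.d k (H.op k η)).1 m P y = ∫ t in (0:ℝ)..1,
      ContinuousAlternatingMap.alternatizeUncurryFin (((slant m k).comp
        (fderiv ℝ (η.1 (m + 1) (H.plot P)) (consPt t y))).comp (tailIncl m)) := by
    change extDeriv ((H.op k η).1 m P) y = _
    rw [extDeriv, hd.fderiv]
    refine (ContinuousLinearMap.intervalIntegral_comp_comm (𝕜 := ℝ)
      (E := EuclideanSpace ℝ (Fin m) →L[ℝ] EuclideanSpace ℝ (Fin m) [⋀^Fin k]→L[ℝ] ℝ)
      (F := EuclideanSpace ℝ (Fin m) [⋀^Fin (k + 1)]→L[ℝ] ℝ)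
      (ContinuousAlternatingMap.alternatizeUncurryFinCLM (n := k) ℝ
        (EuclideanSpace ℝ (Fin m)) ℝ) ?_).symm
    refine Continuous.intervalIntegrable ?_ _ _
    exact (continuous_const.clm_comp (continuous_fderiv_consPt η _ y)).clm_comp continuous_const
  rw [e1, H.op_apply, ← intervalIntegral.integral_add, ← H.integral_fderiv η P y P₀ hP₀]
  -- Under the integral sign the homotopy formula is the pointwise Cartan formula.
  · refine intervalIntegral.integral_congr fun t _ => ?_
    exact slant_alternatizeUncurryFin _
  · refine Continuous.intervalIntegrable ?_ _ _
    exact (ContinuousAlternatingMap.alternatizeUncurryFinCLM ℝ _ ℝ).continuous.comp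
      ((continuous_const.clm_comp (continuous_fderiv_consPt η _ y)).clm_comp continuous_const)
  · exact ((contDiff_slant (Form.d (k + 1) η) (H.plot P)).continuous.comp
          (Continuous.prodMk_left y)).intervalIntegrable _ _

/-- The homotopy formula in degree zero. -/
theorem Deformation.op_d_zero {m : ℕ} (η : Form X 0) (P : Plot X m)
    (y : EuclideanSpace ℝ (Fin m)) (P₀ : Plot X m) (hP₀ : ∀ y, P₀.1 y = H.toFun 0 (P.1 y)) :
    (H.op 0 (Form.d 0 η)).1 m P y = η.1 m P y - η.1 m P₀ y := by
  rw [H.op_apply, ← H.integral_fderiv η P y P₀ hP₀]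
  refine intervalIntegral.integral_congr fun t _ => ?_
  ext v
  change ContinuousAlternatingMap.alternatizeUncurryFin
    (fderiv ℝ (η.1 (m + 1) (H.plot P)) (consPt t y)) (Matrix.vecCons (headVec m) _) = _
  rw [ContinuousAlternatingMap.alternatizeUncurryFin_apply]
  simp
  rfl

end HomotopyOperator

/-- Because `f` intertwines the deformations, deforming the plot `f ∘ P` in `Y` gives the same plot
as deforming `P` in `X` and applying `f`; both operators then integrate the same form. -/
theorem Deformation.pullback_op {X Y : Type*} [DiffeologicalSpace X] [DiffeologicalSpace Y]
    (H : Deformation X) (H' : Deformation Y) (f : X → Y) (hf : DSmooth f)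
    (hH : ∀ t x, f (H.toFun t x) = H'.toFun t (f x)) {k : ℕ} (η : Form Y (k + 1)) :
    Form.pullback f hf (H'.op k η) = H.op k (Form.pullback f hf η) := by
  refine Form.ext fun m P y => ?_
  have hP : H'.plot ⟨f ∘ P.1, hf m P.1 P.2⟩ = ⟨f ∘ (H.plot P).1, hf _ _ (H.plot P).2⟩ :=
    Subtype.ext (funext fun z => (hH _ _).symm)
  change ∫ t in (0:ℝ)..1, slant m k (η.1 (m + 1) (H'.plot ⟨f ∘ P.1, hf m P.1 P.2⟩) (consPt t y)) = _
  rw [hP]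
  rfl

theorem Form.pullback_comp {X Y Z : Type*} [DiffeologicalSpace X] [DiffeologicalSpace Y]
    [DiffeologicalSpace Z] {f : X → Y} (hf : DSmooth f) {g : Y → Z} (hg : DSmooth g) {h : X → Z}
    (hh : DSmooth h) (e : ∀ x, h x = g (f x)) {k : ℕ} (η : Form Z k) :
    Form.pullback f hf (Form.pullback g hg η) = Form.pullback h hh η := by
  obtain rfl : h = g ∘ f := funext e
  rfl

/-! ### Affine maps given by arbitrary, not only monotone, maps of vertices -/

section Vertices

/-- The `i`-th vertex of `𝔸ⁿ`. -/
def vertex {n : ℕ} (i : Fin (n + 1)) : affineSpace n :=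
  ⟨EuclideanSpace.single i 1, by simp [affineSpace]⟩

theorem vertex_apply {n : ℕ} (i j : Fin (n + 1)) :
    (vertex i).1 j = if j = i then (1 : ℝ) else 0 := by
  simp [vertex]

/-- The affine map `𝔸ᵐ → 𝔸ⁿ` that sends the `i`-th vertex to the `τ i`-th vertex. -/
def vertexMap {m n : ℕ} (τ : Fin (m + 1) → Fin (n + 1)) (x : affineSpace m) : affineSpace n :=
  ⟨WithLp.toLp 2 fun j => ∑ i with τ i = j, x.1 i, by
    have h := x.2
    change ∑ j, ∑ i with τ i = j, x.1 i = 1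
    exact (Finset.sum_fiberwise _ _ _).trans h⟩

theorem vertexMap_apply {m n : ℕ} (τ : Fin (m + 1) → Fin (n + 1)) (x : affineSpace m)
    (j : Fin (n + 1)) : (vertexMap τ x).1 j = ∑ i, if τ i = j then x.1 i else 0 := by
  change ∑ i with τ i = j, x.1 i = _
  rw [Finset.sum_filter]

theorem vertexMap_dSmooth {m n : ℕ} (τ : Fin (m + 1) → Fin (n + 1)) : DSmooth (vertexMap τ) := by
  intro k p hp
  have hp' : ContDiff ℝ ∞ (Subtype.val ∘ p) := IsPlot.contDiff hp
  have : ContDiff ℝ ∞ (Subtype.val ∘ vertexMap τ ∘ p) := by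
    rw [contDiff_euclidean] at hp' ⊢
    intro j
    change ContDiff ℝ ∞ (fun y => ∑ i with τ i = j, (p y).1 i)
    exact ContDiff.sum fun i _ => hp' i
  exact this.isPlot

theorem vertexMap_vertex {m n : ℕ} (τ : Fin (m + 1) → Fin (n + 1)) (i : Fin (m + 1)) :
    vertexMap τ (vertex i) = vertex (τ i) := by
  ext j
  rw [vertexMap_apply, Finset.sum_eq_single i]
  · simp [vertex_apply, eq_comm]
  · intro b _ hb
    simp [vertex_apply, hb]
  · simp

theorem vertexMap_id {n : ℕ} (x : affineSpace n) : vertexMap id x = x := by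
  ext j
  simp [vertexMap_apply]

theorem vertexMap_comp {l m n : ℕ} (τ : Fin (l + 1) → Fin (m + 1)) (ρ : Fin (m + 1) → Fin (n + 1))
    (x : affineSpace l) : vertexMap (ρ ∘ τ) x = vertexMap ρ (vertexMap τ x) := by
  ext j
  simp only [vertexMap_apply, ← Finset.sum_filter]
  rw [Finset.sum_comm' (t' := Finset.univ.filter fun i => ρ (τ i) = j)
    (s' := fun i => {τ i}) (by intro a b; simp; constructor <;> rintro ⟨h1, h2⟩ <;> simp_all)]
  simp

/-- The pullback of forms along the affine map of a map of vertices. -/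
def vpull {m n : ℕ} (τ : Fin (m + 1) → Fin (n + 1)) {k : ℕ} :
    Form (affineSpace n) k →ₗ[ℝ] Form (affineSpace m) k :=
  Form.pullback (vertexMap τ) (vertexMap_dSmooth τ)

theorem vpull_comp {l m n : ℕ} (τ : Fin (l + 1) → Fin (m + 1)) (ρ : Fin (m + 1) → Fin (n + 1))
    {k : ℕ} (η : Form (affineSpace n) k) : vpull τ (vpull ρ η) = vpull (ρ ∘ τ) η :=
  Form.pullback_comp _ _ _ (vertexMap_comp τ ρ) η

theorem vpull_id {n k : ℕ} (η : Form (affineSpace n) k) : vpull id η = η := by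
  refine Form.ext fun m P x => ?_
  have : vertexMap id ∘ P.1 = P.1 := funext fun x => vertexMap_id _
  change η.1 m ⟨vertexMap id ∘ P.1, _⟩ x = _
  simp only [this]
  rfl

theorem vpull_d {m n k : ℕ} (τ : Fin (m + 1) → Fin (n + 1)) (η : Form (affineSpace n) k) :
    vpull τ (Form.d k η) = Form.d k (vpull τ η) := rfl

theorem vpull_wedge {m n p q k : ℕ} (h : p + q = k) (τ : Fin (m + 1) → Fin (n + 1))
    (η : Form (affineSpace n) p) (ζ : Form (affineSpace n) q) :
    vpull τ (Form.wedge h η ζ) = Form.wedge h (vpull τ η) (vpull τ ζ) := rfl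

end Vertices

/-! ### Cone operators on the forms of `𝔸ⁿ` -/

section Cone

/-- The contraction of `𝔸ⁿ` to its `i`-th vertex. -/
def coneDeformation {n : ℕ} (i : Fin (n + 1)) : Deformation (affineSpace n) where
  toFun t x := ⟨(1 - t) • (vertex i).1 + t • x.1, by
    have h1 : ∑ j, (vertex i).1 j = 1 := (vertex i).2
    have h2 : ∑ j, x.1 j = 1 := x.2
    simp only [affineSpace, Set.mem_ofPred_eq, PiLp.add_apply, PiLp.smul_apply, smul_eq_mul,
      Finset.sum_add_distrib, ← Finset.mul_sum, h1, h2]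
    ring⟩
  isPlot {m} P hP := by
    have hP' : ContDiff ℝ ∞ (Subtype.val ∘ P) := IsPlot.contDiff hP
    have h0 : ContDiff ℝ ∞ fun z : EuclideanSpace ℝ (Fin (m + 1)) => z 0 := by fun_prop
    have : ContDiff ℝ ∞ fun z : EuclideanSpace ℝ (Fin (m + 1)) =>
        (1 - z 0) • (vertex i).1 + z 0 • (Subtype.val ∘ P) (tailProj m z) :=
      ((contDiff_const.sub h0).smul contDiff_const).add
        (h0.smul (hP'.comp (tailProj m).contDiff))
    exact this.isPlot
  one x := by simp

theorem coneDeformation_apply {n : ℕ} (i j : Fin (n + 1)) (t : ℝ) (x : affineSpace n) :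
    ((coneDeformation i).toFun t x).1 j = (1 - t) * (vertex i).1 j + t * x.1 j := rfl

theorem coneDeformation_zero {n : ℕ} (i : Fin (n + 1)) (x : affineSpace n) :
    (coneDeformation i).toFun 0 x = vertex i := by
  ext j
  simp [coneDeformation_apply]

/-- Affine maps preserve straight lines. This is the source of the naturality of `cone`. -/
theorem vertexMap_coneDeformation {m n : ℕ} (τ : Fin (m + 1) → Fin (n + 1)) (i : Fin (m + 1))
    (t : ℝ) (x : affineSpace m) : vertexMap τ ((coneDeformation i).toFun t x) =
      (coneDeformation (τ i)).toFun t (vertexMap τ x) := by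
  ext j
  rw [coneDeformation_apply, ← vertexMap_vertex]
  simp only [vertexMap_apply, coneDeformation_apply, Finset.mul_sum, ← Finset.sum_add_distrib]
  refine Finset.sum_congr rfl fun l _ => ?_
  split_ifs <;> simp

/-- The homotopy operator of the contraction of `𝔸ⁿ` to its `i`-th vertex. -/
def cone {n : ℕ} (i : Fin (n + 1)) {k : ℕ} :
    Form (affineSpace n) (k + 1) →ₗ[ℝ] Form (affineSpace n) k :=
  (coneDeformation i).op k

theorem vpull_cone {m n k : ℕ} (τ : Fin (m + 1) → Fin (n + 1)) (i : Fin (m + 1))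
    (η : Form (affineSpace n) (k + 1)) : vpull τ (cone (τ i) η) = cone i (vpull τ η) :=
  Deformation.pullback_op _ _ _ _ (vertexMap_coneDeformation τ i) η

/-- A constant plot factors through `ℝ⁰`, and the factoring map has derivative `0`. In positive
degrees this kills the end `t = 0` of a contraction to a point. -/
theorem Form.const_plot {X : Type*} [DiffeologicalSpace X] {k m : ℕ} (η : Form X k) (x : X)
    (y : EuclideanSpace ℝ (Fin m)) :
    η.1 m ⟨fun _ => x, isPlot_const⟩ y =
      (η.1 0 ⟨fun _ => x, isPlot_const⟩ 0).compContinuousLinearMap 0 := by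
  have := η.2.2 0 m ⟨fun _ => x, isPlot_const⟩ (fun _ => 0) contDiff_const y
  rw [fderiv_fun_const] at this
  exact this

theorem d_cone_add_cone_d {n k : ℕ} (i : Fin (n + 1)) (η : Form (affineSpace n) (k + 1)) :
    Form.d k (cone i η) + cone i (Form.d (k + 1) η) = η := by
  refine Form.ext fun m P y => ?_
  have h := (coneDeformation i).d_op_add_op_d η P y ⟨fun _ => vertex i, isPlot_const⟩
    (fun y => (coneDeformation_zero i _).symm)
  rw [Form.const_plot η (vertex i) y] at h
  refine h.trans ?_
  have : (η.1 0 ⟨fun _ => vertex i, isPlot_const⟩ 0).compContinuousLinearMap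
      (0 : EuclideanSpace ℝ (Fin m) →L[ℝ] EuclideanSpace ℝ (Fin 0)) = 0 := by
    ext v
    rw [ContinuousAlternatingMap.compContinuousLinearMap_apply]
    exact (η.1 0 ⟨fun _ => vertex i, isPlot_const⟩ 0).map_coord_zero 0 rfl
  rw [this, sub_zero]

/-- The value of a `0`-form at a point. -/
def Form.eval {X : Type*} [DiffeologicalSpace X] (x : X) : Form X 0 →ₗ[ℝ] ℝ where
  toFun η := η.1 0 ⟨fun _ => x, isPlot_const⟩ 0 0
  map_add' _ _ := rfl
  map_smul' _ _ := rfl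

theorem Form.eval_pullback {X Y : Type*} [DiffeologicalSpace X] [DiffeologicalSpace Y]
    (f : X → Y) (hf : DSmooth f) (x : X) (η : Form Y 0) :
    Form.eval x (Form.pullback f hf η) = Form.eval (f x) η := rfl

/-- A `0`-form is determined by its values. -/
theorem Form.apply_eq_eval {X : Type*} [DiffeologicalSpace X] {m : ℕ} (η : Form X 0) (P : Plot X m)
    (y : EuclideanSpace ℝ (Fin m)) (v : Fin 0 → EuclideanSpace ℝ (Fin m)) :
    η.1 m P y v = Form.eval (P.1 y) η := by
  have := η.2.2 m 0 P (fun _ => y) contDiff_const 0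
  change _ = η.1 0 (P.comp (fun _ => y) contDiff_const) 0 0
  rw [this]
  rw [ContinuousAlternatingMap.compContinuousLinearMap_apply]
  congr 1
  exact Subsingleton.elim _ _

theorem Form.ext_eval {X : Type*} [DiffeologicalSpace X] {η ζ : Form X 0}
    (h : ∀ x, Form.eval x η = Form.eval x ζ) : η = ζ := by
  refine Form.ext fun m P y => ?_
  ext v
  rw [Form.apply_eq_eval, Form.apply_eq_eval, h]

theorem Form.eval_one {X : Type*} [DiffeologicalSpace X] (x : X) :
    Form.eval x (Form.one : Form X 0) = 1 := rfl

/-- In degree `0` the end `t = 0` of the contraction does not vanish: it contributes the value at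
the vertex. This constant is where the integrals enter at the last stage of the iterated cones. -/
theorem cone_d_zero {n : ℕ} (i : Fin (n + 1)) (η : Form (affineSpace n) 0) :
    cone i (Form.d 0 η) = η - Form.eval (vertex i) η • Form.one := by
  refine Form.ext_eval fun x => ?_
  rw [map_sub, map_smul, Form.eval_one, smul_eq_mul, mul_one]
  have h := (coneDeformation i).op_d_zero (m := 0) η ⟨fun _ => x, isPlot_const⟩ 0
    ⟨fun _ => vertex i, isPlot_const⟩ (fun y => (coneDeformation_zero i _).symm)
  exact congrArg (fun α : EuclideanSpace ℝ (Fin 0) [⋀^Fin 0]→L[ℝ] ℝ => α 0) h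

end Cone

/-! ### Integration over the simplex in conical coordinates -/

section SolidSimplex

/-- The standard simplex in the coordinates `x₁, …, xₚ`. -/
def solidSimplex (p : ℕ) : Set (EuclideanSpace ℝ (Fin p)) := chart p ⁻¹' simplexSub p

theorem chart_val (p : ℕ) (y : EuclideanSpace ℝ (Fin p)) :
    (chart p y).1 = consPt (1 - ∑ i, y i) y := by
  ext j
  refine Fin.cases ?_ (fun i => ?_) j
  · rw [consPt_zero]; rfl
  · rw [consPt_succ]; rfl

theorem mem_solidSimplex {p : ℕ} {x : EuclideanSpace ℝ (Fin p)} :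
    x ∈ solidSimplex p ↔ ∑ i, x i ≤ 1 ∧ ∀ i, 0 ≤ x i := by
  change (∀ j, 0 ≤ (chart p x).1 j) ↔ _
  rw [chart_val, Fin.forall_fin_succ]
  simp

theorem isCompact_solidSimplex (p : ℕ) : IsCompact (solidSimplex p) := by
  have h1 : IsCompact ((WithLp.toLp 2 : (Fin p → ℝ) → EuclideanSpace ℝ (Fin p)) ''
      Set.Icc 0 1) :=
    isCompact_Icc.image (PiLp.continuous_toLp 2 _)
  refine h1.of_isClosed_subset ?_ fun x hx => ?_
  · have : solidSimplex p =
        {x | ∑ i, (x : EuclideanSpace ℝ (Fin p)) i ≤ 1} ∩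
          ⋂ i, {x | 0 ≤ (x : EuclideanSpace ℝ (Fin p)) i} := by
      ext x
      simp [mem_solidSimplex]
    rw [this]
    refine (isClosed_le (by fun_prop) continuous_const).inter (isClosed_iInter fun i => ?_)
    exact isClosed_le continuous_const (by fun_prop)
  · rw [mem_solidSimplex] at hx
    refine ⟨fun i => x i, ⟨fun i => hx.2 i, fun i => ?_⟩, rfl⟩
    exact (Finset.single_le_sum (fun j _ => hx.2 j) (Finset.mem_univ i)).trans hx.1

theorem measurePreserving_consPt (p : ℕ) : MeasurePreserving
    (fun z : ℝ × EuclideanSpace ℝ (Fin p) => consPt z.1 z.2) := by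
  have h1 := (volume_preserving_piFinSuccAbove (fun _ : Fin (p + 1) => ℝ) 0).symm
  have h2 := (PiLp.volume_preserving_toLp (Fin (p + 1))).comp
    (h1.comp ((MeasurePreserving.id (volume : Measure ℝ)).prod
      (PiLp.volume_preserving_ofLp (Fin p))))
  refine (congrArg (fun f => MeasurePreserving f (volume.prod volume) volume) ?_).mp h2
  symm
  funext z
  ext j
  refine Fin.cases ?_ (fun i => ?_) j
  · rw [consPt_zero]; rfl
  · rw [consPt_succ]; rfl

/-- A unimodular change of coordinates on `ℝᵖ⁺¹` in which the last parameter is the sum of all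
coordinates; it slices the solid simplex parallel to the face opposite the origin. -/
theorem measurePreserving_shear (p : ℕ) : MeasurePreserving
    (fun z : EuclideanSpace ℝ (Fin p) × ℝ => consPt (z.2 - ∑ i, z.1 i) z.1) := by
  have h1 : MeasurePreserving (fun z : EuclideanSpace ℝ (Fin p) × ℝ =>
      (z.1, z.2 - ∑ i, z.1 i)) (volume.prod volume) (volume.prod volume) := by
    refine (MeasurePreserving.id _).skew_product 
      (g := fun (z : EuclideanSpace ℝ (Fin p)) (s : ℝ) => s - ∑ i, z i) ?_ ?_
    · fun_prop
    · exact Filter.Eventually.of_forall fun z => (measurePreserving_sub_right volume _).map_eq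
  exact (measurePreserving_consPt p).comp (Measure.measurePreserving_swap.comp h1)

/-- The coordinates of `chart p y` sum to `1`, so `s • (chart p y).1` lies in the slice at height
`s`, and for positive `s` the signs of its coordinates are those of `chart p y`. -/
theorem smul_chart_mem_iff {p : ℕ} {s : ℝ} (hs : 0 < s) (y : EuclideanSpace ℝ (Fin p)) :
    s • (chart p y).1 ∈ solidSimplex (p + 1) ↔ y ∈ solidSimplex p ∧ s ≤ 1 := by
  have h : ∑ j, (chart p y).1 j = 1 := (chart p y).2
  rw [mem_solidSimplex]
  simp only [PiLp.smul_apply, smul_eq_mul, ← Finset.mul_sum, h, mul_one,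
    mul_nonneg_iff_of_pos_left hs]
  exact and_comm

theorem continuous_smul_chart (p : ℕ) :
    Continuous fun z : EuclideanSpace ℝ (Fin p) × ℝ => z.2 • (chart p z.1).1 := by
  simp only [chart_val, consPt]
  fun_prop

/-- The solid simplex is the cone from the origin over the face parametrized by `chart p`. Fubini
along the slices of constant coordinate sum `s`, followed by the substitution `z = s y` in each
slice, produces the Jacobian `s ^ p`. -/
theorem setIntegral_solidSimplex_succ (p : ℕ) {f : EuclideanSpace ℝ (Fin (p + 1)) → ℝ}
    (hf : Continuous f) :
    ∫ x in solidSimplex (p + 1), f x =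
      ∫ y in solidSimplex p, ∫ t in (0:ℝ)..1, t ^ p * f (t • (chart p y).1) := by
  set g := (solidSimplex (p + 1)).indicator f with hg
  have hmeas : MeasurableSet (solidSimplex (p + 1)) :=
    (isCompact_solidSimplex _).isClosed.measurableSet
  have hmeas' : MeasurableSet (solidSimplex p) := (isCompact_solidSimplex _).isClosed.measurableSet
  have hgi : Integrable g volume :=
    (integrable_indicator_iff hmeas).2 (hf.continuousOn.integrableOn_compact
      (isCompact_solidSimplex _))
  have hsh := measurePreserving_shear p
  have hgi' : Integrable (fun z : EuclideanSpace ℝ (Fin p) × ℝ =>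
      g (consPt (z.2 - ∑ i, z.1 i) z.1)) (volume.prod volume) :=
    hsh.integrable_comp_of_integrable hgi
  have e1 : ∫ x in solidSimplex (p + 1), f x =
      ∫ s : ℝ, ∫ z : EuclideanSpace ℝ (Fin p), g (consPt (s - ∑ i, z i) z) := by
    rw [← integral_indicator hmeas, ← hg, ← hsh.map_eq,
      integral_map hsh.measurable.aemeasurable (by rw [hsh.map_eq]; exact hgi.1)]
    exact integral_prod_symm _ hgi'
  -- The height `s = 0` is a null set and is left out because `y ↦ s y` is not invertible there. For
  -- `s < 0` or `1 < s` the slice misses the simplex.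
  have e2 : ∀ s : ℝ, s ≠ 0 → ∫ z : EuclideanSpace ℝ (Fin p), g (consPt (s - ∑ i, z i) z) =
      (Set.Ioc (0:ℝ) 1).indicator
        (fun s => ∫ y in solidSimplex p, s ^ p * f (s • (chart p y).1)) s := by
    intro s hs0
    rcases lt_or_gt_of_ne hs0 with hs | hs
    · rw [Set.indicator_of_notMem (fun h => by linarith [h.1])]
      refine integral_eq_zero_of_ae (Filter.Eventually.of_forall fun z => ?_)
      refine Set.indicator_of_notMem (fun h => ?_) _
      rw [mem_solidSimplex] at h
      have h2 : ∑ i, consPt (s - ∑ i, z i) z i = s := by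
        rw [Fin.sum_univ_succ]; simp
      have := Finset.sum_nonneg fun i (_ : i ∈ Finset.univ) => h.2 i
      rw [h2] at this
      linarith
    · have h1 := Measure.integral_comp_smul_of_nonneg (μ := volume)
        (fun z : EuclideanSpace ℝ (Fin p) => g (consPt (s - ∑ i, z i) z)) s (hR := hs.le)
      rw [finrank_euclideanSpace, Fintype.card_fin] at h1
      have h2 : ∀ y : EuclideanSpace ℝ (Fin p), consPt (s - ∑ i, (s • y) i) (s • y) =
          s • (chart p y).1 := by
        intro y
        rw [chart_val]
        ext j
        refine Fin.cases ?_ (fun i => ?_) j <;> simp [Finset.mul_sum, mul_sub]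
      simp only [h2] at h1
      have h3 : ∀ y : EuclideanSpace ℝ (Fin p), g (s • (chart p y).1) =
          (if s ≤ 1 then (solidSimplex p).indicator (fun y => f (s • (chart p y).1)) y else 0) := by
        intro y
        by_cases h : y ∈ solidSimplex p <;> by_cases h' : s ≤ 1 <;>
          simp [hg, Set.indicator, smul_chart_mem_iff hs, h, h']
      simp only [h3] at h1
      rw [eq_comm, inv_smul_eq_iff₀ (pow_ne_zero _ hs.ne')] at h1
      rw [h1]
      by_cases h' : s ≤ 1
      · rw [Set.indicator_of_mem (Set.mem_Ioc.2 ⟨hs, h'⟩)]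
        simp only [h', if_true]
        rw [integral_indicator hmeas', integral_const_mul, smul_eq_mul]
      · rw [Set.indicator_of_notMem (fun h => h' h.2)]
        simp [h']
  have e3 : ∫ s : ℝ, ∫ z : EuclideanSpace ℝ (Fin p), g (consPt (s - ∑ i, z i) z) =
      ∫ s in Set.Ioc (0:ℝ) 1, ∫ y in solidSimplex p, s ^ p * f (s • (chart p y).1) := by
    rw [← integral_indicator measurableSet_Ioc]
    refine integral_congr_ae ?_
    filter_upwards [compl_mem_ae_iff.2 (measure_singleton (0:ℝ))] with s hs
    exact e2 s hs
  rw [e1, e3]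
  simp only [intervalIntegral.integral_of_le zero_le_one]
  refine integral_integral_swap ?_
  rw [Measure.prod_restrict]
  have hc : Continuous (Function.uncurry fun (s : ℝ) (y : EuclideanSpace ℝ (Fin p)) =>
      s ^ p * f (s • (chart p y).1)) :=
    (continuous_fst.pow p).mul (hf.comp ((continuous_smul_chart p).comp continuous_swap))
  exact (hc.continuousOn.integrableOn_compact
    ((isCompact_Icc (a := (0:ℝ)) (b := 1)).prod (isCompact_solidSimplex p))).mono_set
      (Set.prod_mono Set.Ioc_subset_Icc_self subset_rfl)

end SolidSimplex

/-! ### Column operations on alternating forms -/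

section AlternatingTop

variable {E : Type*} [NormedAddCommGroup E] [NormedSpace ℝ E]

/-- The arguments are changed one at a time; each change adds a term with `e` among its arguments,
which vanishes. -/
theorem map_add_smul_eq_of_vanish {p : ℕ} (β : E [⋀^Fin p]→L[ℝ] ℝ) (e : E)
    (hβ : ∀ (v : Fin p → E) (i : Fin p), v i = e → β v = 0) (v : Fin p → E) (c : Fin p → ℝ) :
    β (fun i => v i + c i • e) = β v := by
  have key : ∀ s : Finset (Fin p), β (fun i => if i ∈ s then v i + c i • e else v i) = β v := by
    intro s
    induction s using Finset.induction_on with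
    | empty => simp
    | insert a s ha ih =>
      have h1 : (fun i => if i ∈ insert a s then v i + c i • e else v i) =
          Function.update (fun i => if i ∈ s then v i + c i • e else v i) a (v a + c a • e) := by
        funext i
        by_cases h : i = a
        · subst h; simp
        · simp [h]
      have h2 : Function.update (fun i => if i ∈ s then v i + c i • e else v i) a (v a) =
          fun i => if i ∈ s then v i + c i • e else v i := by
        rw [Function.update_eq_self_iff]
        simp [ha]
      rw [h1, β.map_update_add, β.map_update_smul, h2, ih,
        hβ (Function.update _ a e) a (Function.update_self _ _ _)]
      simp
  simpa using key Finset.univ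

/-- The frame is the image of the standard one under the derivative of `(t, y) ↦ t • chart y`, and
`t ^ p` is the determinant. With `w i = e i.succ - e 0`, the first vector is `e 0 + ∑ y i • w i`;
multiples of the other vectors may be removed from it, and then multiples of `e 0` may be added to
the others. -/
theorem map_cone_frame {p : ℕ} (α : E [⋀^Fin (p + 1)]→L[ℝ] ℝ) (e : Fin (p + 1) → E)
    (y : Fin p → ℝ) (t : ℝ) :
    α (Matrix.vecCons ((1 - ∑ i, y i) • e 0 + ∑ i, y i • e i.succ)
      (fun i => t • (e i.succ - e 0))) = t ^ p * α e := by
  let w : Fin p → E := fun i => e i.succ - e 0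
  have h0 : (1 - ∑ i, y i) • e 0 + ∑ i, y i • e i.succ = e 0 + ∑ i, y i • w i := by
    simp only [w, smul_sub, Finset.sum_sub_distrib, sub_smul, one_smul, Finset.sum_smul]
    abel
  have h1 : α (Matrix.vecCons (e 0 + ∑ i, y i • w i) (fun i => t • w i)) =
      t ^ p * α (Matrix.vecCons (e 0 + ∑ i, y i • w i) w) := by
    generalize e 0 + ∑ i, y i • w i = z
    have := (α.curryLeft z).toMultilinearMap.map_smul_univ (fun _ => t) w
    simp only [Finset.prod_const, Finset.card_univ, Fintype.card_fin, smul_eq_mul] at this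
    exact this
  have h2 : α (Matrix.vecCons (e 0 + ∑ i, y i • w i) w) = α (Matrix.vecCons (e 0) w) := by
    change α.curryLeft _ w = α.curryLeft _ w
    rw [map_add, map_sum, ContinuousAlternatingMap.add_apply, ContinuousAlternatingMap.sum_apply]
    rw [Finset.sum_eq_zero fun i _ => ?_, add_zero]
    rw [map_smul, ContinuousAlternatingMap.smul_apply, ContinuousAlternatingMap.curryLeft_apply_apply,
      α.map_eq_zero_of_eq (Matrix.vecCons (w i) w) (i := 0) (j := i.succ) (by simp)
        (Fin.succ_ne_zero i).symm, smul_zero]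
  have h3 : α (Matrix.vecCons (e 0) w) = α e := by
    have h4 := map_add_smul_eq_of_vanish (α.curryLeft (e 0)) (e 0) (fun v i hi => by
      rw [ContinuousAlternatingMap.curryLeft_apply_apply]
      exact α.map_eq_zero_of_eq _ (i := 0) (j := i.succ) (by simp [hi])
        (Fin.succ_ne_zero i).symm) (fun i => e i.succ) (fun _ => -1)
    have h5 : (fun i : Fin p => e i.succ + (-1 : ℝ) • e 0) = w := by
      funext i; simp [w, sub_eq_add_neg]
    rw [h5] at h4
    refine h4.trans (congrArg α ?_)
    funext j
    refine Fin.cases ?_ (fun i => ?_) j <;> rfl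
  rw [h0]
  exact h1.trans (by rw [h2, h3])

end AlternatingTop

/-! ### Integrals over simplices as iterated cones, and Stokes' theorem -/

section ConeIntegral

/-- The plot of `𝔸ⁿ` given by the standard chart. -/
def chartPlot (p : ℕ) : Plot (affineSpace p) p := ⟨chart p, chart_isPlot p⟩

/-- The standard frame of `ℝᵖ`. -/
def stdFrame (p : ℕ) : Fin p → EuclideanSpace ℝ (Fin p) := fun i => EuclideanSpace.single i (1 : ℝ)

theorem simplexIntegral_eq (p : ℕ) (η : Form (affineSpace p) p) :
    simplexIntegral p η = ∫ x in solidSimplex p, η.1 p (chartPlot p) x (stdFrame p) := rfl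

theorem continuous_form_apply {X : Type*} [DiffeologicalSpace X] {k m : ℕ} (η : Form X k)
    (P : Plot X m) (v : Fin k → EuclideanSpace ℝ (Fin m)) :
    Continuous fun x => η.1 m P x v :=
  (ContinuousAlternatingMap.apply ℝ (EuclideanSpace ℝ (Fin m)) ℝ v).continuous.comp
    (Form.contDiff η P).continuous

/-- In the chart of `𝔸ᵖ⁺¹` the vertex `0` is the origin, so contracting the opposite face to it
becomes scaling. This matches the cone operator with `setIntegral_solidSimplex_succ`. -/
theorem chart_cone (p : ℕ) (z : EuclideanSpace ℝ (Fin (p + 1))) :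
    (coneDeformation (0 : Fin (p + 2))).toFun (z 0) (vertexMap Fin.succ (chart p (tailProj p z))) =
      chart (p + 1) (z 0 • (chart p (tailProj p z)).1) := by
  have h : ∑ j, (chart p (tailProj p z)).1 j = 1 := (chart p (tailProj p z)).2
  ext j
  rw [coneDeformation_apply, vertexMap_apply, chart_val (p + 1)]
  refine Fin.cases ?_ (fun i => ?_) j
  · simp [vertex_apply, ← Finset.mul_sum, h, Fin.succ_ne_zero]
  · simp [vertex_apply, Fin.succ_ne_zero]

theorem hasFDerivAt_smul_chart (p : ℕ) (t : ℝ) (y : EuclideanSpace ℝ (Fin p)) :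
    ∃ L : EuclideanSpace ℝ (Fin (p + 1)) →L[ℝ] EuclideanSpace ℝ (Fin (p + 1)),
      HasFDerivAt (fun z : EuclideanSpace ℝ (Fin (p + 1)) => z 0 • (chart p (tailProj p z)).1) L
        (consPt t y) ∧ L (headVec p) = (chart p y).1 ∧
      ∀ v, L (tailIncl p v) = t • (tailIncl p v - (∑ i, v i) • headVec p) := by
  have h1 : HasFDerivAt (fun z : EuclideanSpace ℝ (Fin (p + 1)) => z 0)
      (EuclideanSpace.proj 0 : EuclideanSpace ℝ (Fin (p + 1)) →L[ℝ] ℝ) (consPt t y) :=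
    (EuclideanSpace.proj 0 : EuclideanSpace ℝ (Fin (p + 1)) →L[ℝ] ℝ).hasFDerivAt
  let M : EuclideanSpace ℝ (Fin p) →L[ℝ] EuclideanSpace ℝ (Fin (p + 1)) :=
    tailIncl p - (∑ i, (EuclideanSpace.proj i : EuclideanSpace ℝ (Fin p) →L[ℝ] ℝ)).smulRight
      (headVec p)
  have hM : ∀ v, M v = tailIncl p v - (∑ i, v i) • headVec p := fun v => by
    simp [M]
  have hc : ∀ v, (chart p v).1 = headVec p + M v := fun v => by
    rw [chart_val, consPt, hM, sub_smul, one_smul]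
    abel
  have h2 : HasFDerivAt (fun z : EuclideanSpace ℝ (Fin (p + 1)) => (chart p (tailProj p z)).1)
      (M.comp (tailProj p)) (consPt t y) := by
    simp only [hc]
    exact ((M.comp (tailProj p)).hasFDerivAt).const_add _
  refine ⟨_, h1.smul h2, ?_, fun v => ?_⟩
  · simp
  · simp [hM]

/-- The integral over a simplex is the integral over the face opposite to the vertex `0` of the
cone operator. -/
theorem simplexIntegral_succ (p : ℕ) (η : Form (affineSpace (p + 1)) (p + 1)) :
    simplexIntegral (p + 1) η = simplexIntegral p (vpull Fin.succ (cone 0 η)) := by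
  rw [simplexIntegral_eq, simplexIntegral_eq, setIntegral_solidSimplex_succ _
    (continuous_form_apply η (chartPlot (p + 1)) _)]
  refine setIntegral_congr_fun (isCompact_solidSimplex p).isClosed.measurableSet fun y _ => ?_
  let Q : Plot (affineSpace (p + 1)) (p + 1) := (coneDeformation (0 : Fin (p + 2))).plot
    ⟨vertexMap Fin.succ ∘ chart p, vertexMap_dSmooth _ _ _ (chart_isPlot p)⟩
  have hsm : ContDiff ℝ ∞ fun z : EuclideanSpace ℝ (Fin (p + 1)) =>
      z 0 • (chart p (tailProj p z)).1 := by
    simp only [chart_val, consPt]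
    fun_prop
  have hQ : Q = (chartPlot (p + 1)).comp _ hsm :=
    Subtype.ext (funext fun z => chart_cone p z)
  -- The integrand of the cone operator is the top coefficient of `η` at the scaled point times the
  -- Jacobian `t ^ p`, exactly as in the conical coordinates.
  have key : ∀ t : ℝ, η.1 (p + 1) Q (consPt t y)
      (Matrix.vecCons (headVec p) (tailIncl p ∘ stdFrame p)) =
      t ^ p * η.1 (p + 1) (chartPlot (p + 1)) (t • (chart p y).1) (stdFrame (p + 1)) := by
    intro t
    obtain ⟨L, hL, hL1, hL2⟩ := hasFDerivAt_smul_chart p t y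
    rw [hQ, η.2.2 _ _ _ _ hsm, hL.fderiv, ContinuousAlternatingMap.compContinuousLinearMap_apply,
      consPt_zero, tailProj_consPt, ← map_cone_frame _ (stdFrame (p + 1)) (fun i => y i) t]
    congr 1
    funext j
    refine Fin.cases ?_ (fun i => ?_) j
    · simp only [Function.comp_apply, Matrix.cons_val_zero, hL1, chart_val]
      ext l
      refine Fin.cases ?_ (fun l => ?_) l
      · simp [stdFrame]
      · simp [stdFrame, Pi.single_apply]
    · simp only [Function.comp_apply, Matrix.cons_val_succ, hL2]
      congr 1
      ext l
      refine Fin.cases ?_ (fun l => ?_) l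
      · simp [stdFrame]
      · simp [stdFrame]
  change _ = (∫ t in (0:ℝ)..1, slant p p (η.1 (p + 1) Q (consPt t y))) (stdFrame p)
  have hint : IntervalIntegrable (fun t : ℝ => slant p p (η.1 (p + 1) Q (consPt t y))) volume 0 1 :=
    ((contDiff_slant η Q).continuous.comp (Continuous.prodMk_left y)).intervalIntegrable _ _
  refine Eq.trans ?_ (ContinuousLinearMap.intervalIntegral_comp_comm
    (ContinuousAlternatingMap.apply ℝ (EuclideanSpace ℝ (Fin p)) ℝ (stdFrame p)) hint)
  exact intervalIntegral.integral_congr fun t _ => (key t).symm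

end ConeIntegral

/-- The integral over the standard simplex as a linear map. -/
def simplexInt (p : ℕ) : Form (affineSpace p) p →ₗ[ℝ] ℝ where
  toFun := simplexIntegral p
  map_add' η ζ := by
    have h : ∀ η : Form (affineSpace p) p, IntegrableOn
        (fun x => η.1 p (chartPlot p) x (stdFrame p)) (solidSimplex p) := fun η =>
      (continuous_form_apply η _ _).continuousOn.integrableOn_compact (isCompact_solidSimplex p)
    exact integral_add (h η) (h ζ)
  map_smul' c η := integral_const_mul c _

theorem simplexInt_succ (p : ℕ) (η : Form (affineSpace (p + 1)) (p + 1)) :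
    simplexInt (p + 1) η = simplexInt p (vpull Fin.succ (cone 0 η)) :=
  simplexIntegral_succ p η

theorem simplexInt_zero (η : Form (affineSpace 0) 0) :
    simplexInt 0 η = Form.eval (vertex 0) η := by
  have hs : solidSimplex 0 = Set.univ := by
    ext x
    simp [mem_solidSimplex]
  have hv : ∀ x : affineSpace 0, x = vertex 0 := fun x => by
    have h : ∑ j, x.1 j = 1 := x.2
    ext j
    have hj : j = 0 := Fin.fin_one_eq_zero j
    subst hj
    simpa [vertex_apply] using h
  have h1 : ∀ x, η.1 0 (chartPlot 0) x (stdFrame 0) = Form.eval (vertex 0) η := fun x => by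
    rw [Form.apply_eq_eval, hv ((chartPlot 0).1 x)]
  change simplexIntegral 0 η = _
  rw [simplexIntegral_eq, hs]
  simp only [h1]
  have hv1 : (volume : Measure (EuclideanSpace ℝ (Fin 0))) Set.univ = 1 := by
    rw [volume_euclideanSpace_eq_dirac]
    simp
  simp [measureReal_def, hv1]

theorem eval_vpull {m n : ℕ} (τ : Fin (m + 1) → Fin (n + 1)) (i : Fin (m + 1))
    (η : Form (affineSpace n) 0) :
    Form.eval (vertex i) (vpull τ η) = Form.eval (vertex (τ i)) η := by
  rw [← vertexMap_vertex]
  exact Form.eval_pullback _ _ _ _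

theorem vpull_one {m n : ℕ} (τ : Fin (m + 1) → Fin (n + 1)) :
    vpull τ (Form.one : Form (affineSpace n) 0) = Form.one := rfl

/-- Stokes' theorem on the standard simplex. -/
theorem simplexInt_d (p : ℕ) (η : Form (affineSpace (p + 1)) p) :
    simplexInt (p + 1) (Form.d p η) =
      ∑ j : Fin (p + 2), (-1 : ℝ) ^ (j : ℕ) * simplexInt p (vpull j.succAbove η) := by
  induction p with
  | zero =>
    rw [simplexInt_succ, cone_d_zero, simplexInt_zero, eval_vpull, Fin.sum_univ_two]
    simp only [simplexInt_zero, eval_vpull, map_sub, map_smul, Form.eval_one]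
    simp
    ring
  | succ p ih =>
    -- The first term gives the integral over the face opposite vertex `0`; the second has lower
    -- degree, and the induction hypothesis applies to it on that face.
    have h1 : cone 0 (Form.d (p + 1) η) = η - Form.d p (cone 0 η) :=
      eq_sub_of_add_eq' (d_cone_add_cone_d 0 η)
    rw [simplexInt_succ, h1, map_sub, map_sub, vpull_d, ih, Fin.sum_univ_succ (n := p + 2), sub_eq_add_neg,
      ← Finset.sum_neg_distrib]
    congr 1
    · simp [Fin.succAbove_zero]
    · refine Finset.sum_congr rfl fun j _ => ?_
      rw [simplexInt_succ, vpull_comp]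
      -- The faces opposite the other vertices contain vertex `0`, so restricting to them commutes
      -- with the cone at it.
      have h2 : (j.succ).succAbove (0 : Fin (p + 2)) = 0 := Fin.succ_succAbove_zero j
      have h3 := vpull_cone (j.succ).succAbove 0 η
      rw [h2] at h3
      rw [← h3, vpull_comp]
      have h4 : (j.succ).succAbove ∘ Fin.succ = Fin.succ ∘ j.succAbove := by
        funext i
        exact Fin.succ_succAbove_succ j i
      rw [h4, Fin.val_succ, pow_succ]
      ring

/-- Every plot of `𝔸ⁿ` factors through the chart `ℝⁿ`, where more than `n` vectors are linearly
dependent. -/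
theorem form_eq_zero_of_lt {n k : ℕ} (h : n < k) (η : Form (affineSpace n) k) : η = 0 := by
  refine Form.ext fun m P x => ?_
  let f : EuclideanSpace ℝ (Fin m) → EuclideanSpace ℝ (Fin n) := fun x => tailProj n (P.1 x).1
  have hf : ContDiff ℝ ∞ f := (tailProj n).contDiff.comp (IsPlot.contDiff P.2)
  have hP : P = (chartPlot n).comp f hf := by
    refine Subtype.ext (funext fun x => ?_)
    have h : ∑ j, (P.1 x).1 j = 1 := (P.1 x).2
    rw [Fin.sum_univ_succ] at h
    refine Subtype.ext ?_
    change (P.1 x).1 = (chart n (f x)).1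
    rw [chart_val]
    ext j
    refine Fin.cases ?_ (fun i => ?_) j
    · rw [consPt_zero, ← h]
      simp [f, tailProj]
    · simp [f, tailProj]
  rw [hP, η.2.2 n m (chartPlot n) f hf x]
  ext v
  rw [ContinuousAlternatingMap.compContinuousLinearMap_apply]
  refine (η.1 n (chartPlot n) (f x)).toAlternatingMap.map_linearDependent _ fun hli => ?_
  have := hli.fintype_card_le_finrank
  simp at this
  omega

/-- If two vertices have the same image, the affine map factors through a simplex of dimension `k -
1`, which carries no nonzero `k`-forms. -/
theorem simplexInt_vpull_of_not_injective {n k : ℕ} (i : Fin (k + 1) → Fin (n + 1))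
    (hi : ¬ Function.Injective i) (η : Form (affineSpace n) k) : simplexInt k (vpull i η) = 0 := by
  cases k with
  | zero => exact absurd (fun a b _ => (Fin.fin_one_eq_zero a).trans (Fin.fin_one_eq_zero b).symm) hi
  | succ k =>
    obtain ⟨a, b, hab, hne⟩ : ∃ a b, i a = i b ∧ a ≠ b := by
      simpa [Function.Injective] using hi
    have h1 : ∀ x : Fin (k + 2), ∃ z, b.succAbove z = if x = b then a else x := by
      intro x
      refine Fin.exists_succAbove_eq ?_
      split_ifs with h
      · exact hne
      · exact h
    choose s hs using h1
    have h2 : i = (i ∘ b.succAbove) ∘ s := by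
      funext x
      simp only [Function.comp_apply, hs]
      split_ifs with h
      · rw [h, hab]
      · rfl
    rw [h2, ← vpull_comp, form_eq_zero_of_lt (Nat.lt_succ_self k) (vpull (i ∘ b.succAbove) η),
      map_zero, map_zero]

/-! ### The Čech differential and alternating functions of tuples -/

section Cech

variable {ι M : Type*} [AddCommGroup M] [Module ℝ M]

/-- The Čech differential of a function of tuples. -/
def cech {j : ℕ} (V : (Fin j → ι) → M) (i : Fin (j + 1) → ι) : M :=
  ∑ l : Fin (j + 1), (-1 : ℝ) ^ (l : ℕ) • V (i ∘ l.succAbove)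

theorem val_succAbove {j : ℕ} (l : Fin (j + 1)) (m : Fin j) :
    ((l.succAbove m : Fin (j + 1)) : ℕ) = if (m : ℕ) < l then (m : ℕ) else m + 1 := by
  simp only [Fin.succAbove, Fin.lt_def, Fin.val_castSucc]
  split_ifs <;> simp

/-- Each pair of deletions occurs in two orders with opposite signs; the involution `(l, m) ↦
(l.succAbove m, m.predAbove l)` exchanges them. -/
theorem cech_cech {j : ℕ} (V : (Fin j → ι) → M) (i : Fin (j + 2) → ι) : cech (cech V) i = 0 := by
  simp only [cech, Finset.smul_sum, smul_smul]
  rw [← Fintype.sum_prod_type' fun (l : Fin (j + 2)) (m : Fin (j + 1)) =>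
    ((-1 : ℝ) ^ (l : ℕ) * (-1) ^ (m : ℕ)) • V ((i ∘ l.succAbove) ∘ m.succAbove)]
  have key : ∀ x : Fin (j + 2) × Fin (j + 1),
      ((-1 : ℝ) ^ ((x.1.succAbove x.2 : Fin (j + 2)) : ℕ) * (-1) ^ (x.2.predAbove x.1 : ℕ)) •
        V ((i ∘ (x.1.succAbove x.2).succAbove) ∘ (x.2.predAbove x.1).succAbove) =
      -(((-1 : ℝ) ^ (x.1 : ℕ) * (-1) ^ (x.2 : ℕ)) • V ((i ∘ x.1.succAbove) ∘ x.2.succAbove)) := by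
    intro x
    rw [← pow_add, Fin.neg_one_pow_succAbove_add_predAbove, pow_add, neg_smul]
    congr 3
    funext k
    simp [Fin.succAbove_succAbove_succAbove_predAbove]
  refine Finset.sum_involution (fun x _ => (x.1.succAbove x.2, x.2.predAbove x.1))
    (fun x _ => ?_) (fun x _ _ h => ?_) (fun x _ => Finset.mem_univ _) (fun x _ => ?_)
  · rw [key, add_neg_cancel]
  · exact Fin.succAbove_ne _ _ (congrArg Prod.fst h)
  · refine Prod.ext (Fin.succAbove_succAbove_predAbove _ _) ?_
    exact Fin.predAbove_predAbove_succAbove _ _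

/-- Alternating functions of tuples. -/
structure IsAlt {j : ℕ} (F : (Fin j → ι) → ℝ) : Prop where
  eq_zero : ∀ i, ¬ Function.Injective i → F i = 0
  perm : ∀ (i : Fin j → ι) (π : Equiv.Perm (Fin j)),
    F (i ∘ π) = ((Equiv.Perm.sign π : ℤ) : ℝ) * F i

theorem IsAlt.comp {κ : Type*} {j : ℕ} {F : (Fin j → ι) → ℝ} (hF : IsAlt F) (τ : κ → ι) :
    IsAlt fun i : Fin j → κ => F (τ ∘ i) where
  eq_zero _ hi := hF.eq_zero _ fun h => hi h.of_comp
  perm i π := hF.perm (τ ∘ i) π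

theorem IsAlt.insertNth {j : ℕ} {F : (Fin (j + 1) → ι) → ℝ} (hF : IsAlt F) (p : Fin (j + 1))
    (x : ι) (v : Fin j → ι) :
    F (p.insertNth x v) = (-1) ^ (p : ℕ) * F (Fin.cons x v) := by
  rw [← Fin.cons_comp_cycleRange, hF.perm, Fin.sign_cycleRange]
  push_cast
  rfl

/-- Deleting one or the other of two equal entries gives tuples that differ by a cyclic permutation,
whose sign makes the two terms of the Čech differential opposite. -/
theorem IsAlt.removeNth {j : ℕ} {F : (Fin j → ι) → ℝ} (hF : IsAlt F) {v : Fin (j + 1) → ι}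
    {a b : Fin (j + 1)} (hv : v a = v b) (hab : a ≠ b) :
    (-1) ^ (a : ℕ) * F (a.removeNth v) + (-1) ^ (b : ℕ) * F (b.removeNth v) = 0 := by
  rcases Fin.exists_succAbove_eq hab with ⟨a, rfl⟩
  obtain ⟨m, rfl⟩ : ∃ m, m + 1 = j := ⟨j - 1, by have := a.pos; omega⟩
  have h1 : (b.succAbove a).removeNth v =
      (a.predAbove b).insertNth (v b) (a.removeNth (b.removeNth v)) := by
    rw [← (a.predAbove b).insertNth_self_removeNth (Fin.removeNth _ _),
      ← Fin.removeNth_removeNth_eq_swap]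
    simp [Fin.removeNth, Fin.succAbove_succAbove_predAbove]
  have h2 : b.removeNth v = a.insertNth (v b) (a.removeNth (b.removeNth v)) := by
    conv_lhs => rw [← a.insertNth_self_removeNth (b.removeNth v)]
    congr 1
  rw [h1]
  conv_lhs => enter [2, 2]; rw [h2]
  rw [hF.insertNth, hF.insertNth, ← mul_assoc, ← mul_assoc, ← pow_add, ← pow_add,
    Fin.neg_one_pow_succAbove_add_predAbove]
  ring

/-- All deletions other than those of the two equal entries leave a repetition, and these two cancel
by `IsAlt.removeNth`. -/
theorem IsAlt.cech_eq_zero {j : ℕ} {F : (Fin j → ι) → ℝ} (hF : IsAlt F) (i : Fin (j + 1) → ι)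
    (hi : ¬ Function.Injective i) : cech F i = 0 := by
  obtain ⟨a, b, hab, hne⟩ : ∃ a b, i a = i b ∧ a ≠ b := by
    simpa [Function.Injective] using hi
  rw [← hF.removeNth hab hne]
  refine Fintype.sum_eq_add _ _ hne fun k ⟨hka, hkb⟩ => ?_
  rcases Fin.exists_succAbove_eq hka.symm with ⟨a, rfl⟩
  rcases Fin.exists_succAbove_eq hkb.symm with ⟨b, rfl⟩
  rw [hF.eq_zero, smul_zero]
  intro h
  exact hne (congrArg _ (h hab))

/-- Antisymmetry under an adjacent transposition is the cocycle relation on a suitable tuple with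
one repetition, and adjacent transpositions generate. This yields the alternation of integrals from
Stokes' theorem, without a change of variables. -/
theorem isAlt_of_cech {j : ℕ} {G : (Fin (j + 1) → ι) → ℝ}
    (h0 : ∀ i, ¬ Function.Injective i → G i = 0) (hG : ∀ i, cech G i = 0) : IsAlt G := by
  refine ⟨h0, ?_⟩
  have hswap : ∀ (l : Fin j) (i : Fin (j + 1) → ι),
      G (i ∘ Equiv.swap l.castSucc l.succ) = - G i := by
    intro l i
    -- The tuple `0, …, l, l + 1, l, l + 2, …`. Deleting the first `l` leaves the transposed tuple,
    -- deleting the second leaves the original one, and the two signs agree; every other deletion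
    -- keeps the repetition.
    let s : Fin (j + 2) → Fin (j + 1) := fun m =>
      if h : (m : ℕ) ≤ l + 1 then ⟨m, by omega⟩ else
        if (m : ℕ) = l + 2 then l.castSucc else ⟨m - 1, by omega⟩
    let a : Fin (j + 2) := l.castSucc.castSucc
    let b : Fin (j + 2) := l.succ.succ
    have hs : ∀ m, (s m : ℕ) =
        if (m : ℕ) ≤ l + 1 then (m : ℕ) else if (m : ℕ) = l + 2 then (l : ℕ) else m - 1 := by
      intro m
      simp only [s]
      split_ifs <;> rfl
    have hsa : s ∘ a.succAbove = Equiv.swap l.castSucc l.succ := by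
      funext m
      refine Fin.ext ?_
      rw [Function.comp_apply, Equiv.swap_apply_def, hs, val_succAbove, apply_ite Fin.val,
        apply_ite Fin.val]
      simp only [a, Fin.ext_iff, Fin.val_castSucc, Fin.val_succ]
      split_ifs <;> omega
    have hsb : s ∘ b.succAbove = id := by
      funext m
      refine Fin.ext ?_
      rw [Function.comp_apply, hs, val_succAbove]
      simp only [b, Fin.val_succ, id]
      split_ifs <;> omega
    have h1 := hG (i ∘ s)
    have hne : a ≠ b := by simp only [a, b, ne_eq, Fin.ext_iff, Fin.val_castSucc, Fin.val_succ]; omega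
    have h2 : cech G (i ∘ s) = (-1 : ℝ) ^ (a : ℕ) • G ((i ∘ s) ∘ a.succAbove) +
        (-1 : ℝ) ^ (b : ℕ) • G ((i ∘ s) ∘ b.succAbove) := by
      refine Fintype.sum_eq_add _ _ hne fun k ⟨hka, hkb⟩ => ?_
      rcases Fin.exists_succAbove_eq hka.symm with ⟨a', ha'⟩
      rcases Fin.exists_succAbove_eq hkb.symm with ⟨b', hb'⟩
      rw [h0, smul_zero]
      intro h
      have hs : s a = s b := Fin.ext (by simp [hs, a, b])
      refine hne ?_
      rw [← ha', ← hb']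
      refine congrArg _ (h ?_)
      simp only [Function.comp_apply, ha', hb', hs]
    rw [h2, Function.comp_assoc, Function.comp_assoc, hsa, hsb] at h1
    have h3 : (-1 : ℝ) ^ (b : ℕ) = (-1) ^ (a : ℕ) := by
      simp [a, b, pow_succ]
    rw [h3, ← smul_add, smul_eq_zero] at h1
    have h4 := h1.resolve_left (by simp)
    simp only [Function.comp_id] at h4
    linarith
  intro i π
  have hπ : π ∈ Submonoid.closure (Set.range fun l : Fin j => Equiv.swap l.castSucc l.succ) := by
    rw [Equiv.Perm.mclosure_swap_castSucc_succ]
    trivial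
  induction hπ using Submonoid.closure_induction generalizing i with
  | mem x hx =>
    obtain ⟨l, rfl⟩ := hx
    rw [hswap, Equiv.Perm.sign_swap (Fin.castSucc_lt_succ).ne]
    simp
  | one => simp
  | mul x y _ _ hx hy =>
    rw [Equiv.Perm.coe_mul, ← Function.comp_assoc, hy, hx, Equiv.Perm.sign_mul]
    push_cast
    ring

/-- The Čech differential is itself a cocycle, so `isAlt_of_cech` applies once it vanishes on tuples
with repetitions. -/
theorem IsAlt.cech {j : ℕ} {F : (Fin j → ι) → ℝ} (hF : IsAlt F) : IsAlt (cech F) :=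
  isAlt_of_cech hF.cech_eq_zero (cech_cech F)

theorem IsAlt.ext [LinearOrder ι] {j : ℕ} {F G : (Fin j → ι) → ℝ} (hF : IsAlt F) (hG : IsAlt G)
    (h : ∀ i, Monotone i → F i = G i) : F = G := by
  funext i
  have h1 := h _ (Tuple.monotone_sort i)
  rw [hF.perm, hG.perm] at h1
  exact mul_left_cancel₀ (by
    rcases Int.units_eq_one_or (Equiv.Perm.sign (Tuple.sort i)) with h | h <;> simp [h]) h1

end Cech

/-! ### Whitney forms with coefficients in a family of forms -/

section Whitney

variable {X Y : Type*} [DiffeologicalSpace X] [DiffeologicalSpace Y]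

/-- The form `df₁ ∧ ⋯ ∧ dfⱼ`. -/
def dprod (j : ℕ) : MultilinearMap ℝ (fun _ : Fin j => Form X 0) (Form X j) :=
  match j with
  | 0 => MultilinearMap.constOfIsEmpty ℝ _ Form.one
  | j + 1 => LinearMap.uncurryLeft
    { toFun := fun f => (Form.wedge (show 1 + j = j + 1 by omega)
        (Form.d 0 f)).compMultilinearMap (dprod j)
      map_add' := fun f g => by ext1 v; simp
      map_smul' := fun c f => by ext1 v; simp }

theorem dprod_zero (f : Fin 0 → Form X 0) : dprod 0 f = Form.one := rfl

theorem dprod_succ {j : ℕ} (f : Fin (j + 1) → Form X 0) :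
    dprod (j + 1) f = Form.wedge (show 1 + j = j + 1 by omega) (Form.d 0 (f 0))
      (dprod j (Fin.tail f)) := rfl

theorem Form.d_d {k : ℕ} (η : Form X k) : Form.d (k + 1) (Form.d k η) = 0 := (Omega X).d_d k η

theorem Form.d_wedge {p q n : ℕ} (h : p + q = n) (h₁ : p + 1 + q = n + 1)
    (h₂ : p + (q + 1) = n + 1) (η : Form X p) (ζ : Form X q) :
    Form.d n (Form.wedge h η ζ) =
      Form.wedge h₁ (Form.d p η) ζ + (-1 : ℝ) ^ p • Form.wedge h₂ η (Form.d q ζ) :=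
  (Omega X).leibniz h h₁ h₂ η ζ

theorem Form.one_wedge {n : ℕ} (h : 0 + n = n) (η : Form X n) : Form.wedge h Form.one η = η :=
  (Omega X).one_mul h η

theorem Form.d_one : Form.d 0 (Form.one : Form X 0) = 0 := CochainAlgebra.d_one (A := Omega X)

theorem d_dprod {j : ℕ} (f : Fin j → Form X 0) : Form.d j (dprod j f) = 0 := by
  induction j with
  | zero => exact Form.d_one
  | succ j ih =>
    rw [dprod_succ]
    rw [Form.d_wedge _ (by omega) (by omega), ih, Form.d_d]
    simp

theorem dprod_eq_zero {j : ℕ} (f : Fin j → Form X 0) (t : Fin j) (ht : Form.d 0 (f t) = 0) :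
    dprod j f = 0 := by
  induction j with
  | zero => exact t.elim0
  | succ j ih =>
    rw [dprod_succ]
    refine Fin.cases (fun ht => ?_) (fun t ht => ?_) t ht
    · rw [ht]; simp
    · rw [ih (Fin.tail f) t ht, map_zero]

theorem pullback_dprod (g : X → Y) (hg : DSmooth g) {j : ℕ} (f : Fin j → Form Y 0) :
    Form.pullback g hg (dprod j f) = dprod j (fun t => Form.pullback g hg (f t)) := by
  induction j with
  | zero => rfl
  | succ j ih =>
    rw [dprod_succ, dprod_succ]
    change Form.wedge _ (Form.pullback g hg (Form.d 0 (f 0))) (Form.pullback g hg (dprod j _)) = _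
    rw [ih]
    rfl

/-- The form `f₀ df₁ ∧ ⋯ ∧ dfⱼ`. -/
def theta (j : ℕ) : MultilinearMap ℝ (fun _ : Fin (j + 1) => Form X 0) (Form X j) :=
  LinearMap.uncurryLeft
    { toFun := fun f => (Form.wedge (zero_add j) f).compMultilinearMap (dprod j)
      map_add' := fun f g => by ext1 v; simp
      map_smul' := fun c f => by ext1 v; simp }

theorem theta_apply {j : ℕ} (f : Fin (j + 1) → Form X 0) :
    theta j f = Form.wedge (zero_add j) (f 0) (dprod j (Fin.tail f)) := rfl

theorem d_theta {j : ℕ} (f : Fin (j + 1) → Form X 0) : Form.d j (theta j f) = dprod (j + 1) f := by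
  rw [theta_apply, dprod_succ]
  rw [Form.d_wedge _ (by omega) (by omega), d_dprod, map_zero, smul_zero, add_zero]

theorem pullback_theta (g : X → Y) (hg : DSmooth g) {j : ℕ} (f : Fin (j + 1) → Form Y 0) :
    Form.pullback g hg (theta j f) = theta j (fun t => Form.pullback g hg (f t)) := by
  rw [theta_apply, theta_apply]
  change Form.wedge _ (Form.pullback g hg (f 0)) (Form.pullback g hg (dprod j _)) = _
  rw [pullback_dprod]
  rfl

/-- The barycentric coordinate `xᵢ` of `𝔸ⁿ`. -/
def coord {n : ℕ} (i : Fin (n + 1)) : Form (affineSpace n) 0 :=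
  ⟨fun _ P x => ((P.1 x).1 i) • oneAlt,
    fun _ P => ContDiff.smul ((contDiff_euclidean.1 (IsPlot.contDiff P.2)) i) contDiff_const,
    fun _ _ _ _ _ _ => by ext v; rfl⟩

theorem eval_coord {n : ℕ} (i : Fin (n + 1)) (x : affineSpace n) :
    Form.eval x (coord i) = x.1 i := by
  change (x.1 i) • (1 : ℝ) = _
  simp

theorem sum_coord (n : ℕ) : ∑ i : Fin (n + 1), coord i = Form.one := by
  refine Form.ext_eval fun x => ?_
  rw [map_sum, Form.eval_one]
  simp only [eval_coord]
  exact x.2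

theorem vpull_coord {m n : ℕ} (τ : Fin (m + 1) → Fin (n + 1)) (b : Fin (n + 1)) :
    vpull τ (coord b) = ∑ a, (if τ a = b then (1 : ℝ) else 0) • coord a := by
  refine Form.ext_eval fun x => ?_
  rw [map_sum]
  simp only [map_smul, eval_coord]
  refine (Form.eval_pullback _ _ _ _).trans ?_
  rw [eval_coord, vertexMap_apply]
  simp

/-- A barycentric coordinate pulls back to the sum of the coordinates in its fibre; expanding
multilinearly gives the sum over all lifts of the tuple `i`. -/
theorem vpull_theta_coord {m n j : ℕ} (τ : Fin (m + 1) → Fin (n + 1))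
    (i : Fin (j + 1) → Fin (n + 1)) :
    vpull τ (theta j (coord ∘ i)) =
      ∑ i' : Fin (j + 1) → Fin (m + 1),
        (if τ ∘ i' = i then (1 : ℝ) else 0) • theta j (coord ∘ i') := by
  refine (pullback_theta _ _ _).trans ?_
  have h1 : (fun t => Form.pullback (vertexMap τ) (vertexMap_dSmooth τ) ((coord ∘ i) t)) =
      fun t => ∑ a, (if τ a = i t then (1 : ℝ) else 0) • coord a :=
    funext fun t => vpull_coord τ (i t)
  rw [h1, MultilinearMap.map_sum]
  refine Finset.sum_congr rfl fun i' _ => ?_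
  rw [MultilinearMap.map_smul_univ]
  congr 1
  rw [Finset.prod_ite_zero]
  simp [funext_iff]

/-- The form `∑ᵢ x_{i₀} dx_{i₁} ∧ ⋯ ∧ dx_{iⱼ} ∧ Vᵢ` associated with a family of forms that is
indexed by tuples of vertices. -/
def whitney {n j r N : ℕ} (h : j + r = N) (V : (Fin (j + 1) → Fin (n + 1)) → Form (affineSpace n) r) :
    Form (affineSpace n) N :=
  ∑ i, Form.wedge h (theta j (coord ∘ i)) (V i)

/-- Every tuple `i'` of the source lifts exactly one tuple `τ ∘ i'` of the target. Summing over all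
tuples, with repetitions and in any order, is what makes this hold for degeneracies too. -/
theorem vpull_whitney {m n j r N : ℕ} (h : j + r = N) (τ : Fin (m + 1) → Fin (n + 1))
    (V : (Fin (j + 1) → Fin (n + 1)) → Form (affineSpace n) r) :
    vpull τ (whitney h V) = whitney h fun i => vpull τ (V (τ ∘ i)) := by
  simp only [whitney, map_sum, vpull_wedge, vpull_theta_coord, LinearMap.sum_apply, map_smul,
    LinearMap.smul_apply]
  rw [Finset.sum_comm]
  refine Finset.sum_congr rfl fun i' _ => ?_
  simp [ite_smul]

/-- By linearity the slot `l` receives `∑ x_a = 1`. In slot `0` this is a factor `1`; in every other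
slot it is differentiated and gives `0`. -/
theorem sum_theta_insertNth {n j : ℕ} (l : Fin (j + 2)) (i : Fin (j + 1) → Fin (n + 1)) :
    ∑ a, theta (j + 1) (coord ∘ l.insertNth a i) =
      if l = 0 then dprod (j + 1) (coord ∘ i) else 0 := by
  have h1 : ∀ a : Fin (n + 1), (coord ∘ l.insertNth a i : Fin (j + 2) → Form (affineSpace n) 0) =
      l.insertNth (coord a) (coord ∘ i) := by
    intro a
    funext t
    refine l.succAboveCases ?_ (fun s => ?_) t <;> simp
  have h2 : ∑ a : Fin (n + 1), theta (j + 1) (coord ∘ l.insertNth a i) =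
      theta (j + 1) (l.insertNth (Form.one : Form (affineSpace n) 0) (coord ∘ i)) := by
    rw [← sum_coord n]
    simp only [h1, ← MultilinearMap.curryMid_apply_apply]
    rw [map_sum, sum_apply]
  rw [h2]
  split_ifs with hl
  · subst hl
    rw [theta_apply]
    simp only [Fin.insertNth_zero', Fin.cons_zero, Fin.tail_cons]
    exact Form.one_wedge _ _
  · rw [theta_apply]
    obtain ⟨t, rfl⟩ := Fin.exists_succ_eq.2 hl
    rw [dprod_eq_zero _ t, map_zero]
    change Form.d 0 ((t.succ.insertNth Form.one (coord ∘ i) :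
      Fin (j + 2) → Form (affineSpace n) 0) t.succ) = 0
    rw [Fin.insertNth_apply_same, Form.d_one]

/-- The Leibniz rule turns `x_{i₀} dx_{i₁} ⋯` into `dx_{i₀} dx_{i₁} ⋯`. In the Whitney form of the
Čech differential, the sum over the deleted index is evaluated by `sum_theta_insertNth`, and only
the deletion of the first index survives, giving the same expression. -/
theorem d_whitney {n j r N : ℕ} (h : j + r = N) (h₁ : j + 1 + r = N + 1) (h₂ : j + (r + 1) = N + 1)
    (V : (Fin (j + 1) → Fin (n + 1)) → Form (affineSpace n) r) :
    Form.d N (whitney h V) =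
      whitney h₁ (cech V) + (-1 : ℝ) ^ j • whitney h₂ fun i => Form.d r (V i) := by
  have h3 : Form.d N (whitney h V) = (∑ i, Form.wedge h₁ (dprod (j + 1) (coord ∘ i)) (V i)) +
      (-1 : ℝ) ^ j • whitney h₂ fun i => Form.d r (V i) := by
    rw [whitney, whitney, map_sum, Finset.smul_sum, ← Finset.sum_add_distrib]
    refine Finset.sum_congr rfl fun i _ => ?_
    rw [← d_theta]
    exact Form.d_wedge h h₁ h₂ _ _
  rw [h3]
  congr 1
  have h4 : ∀ l : Fin (j + 2), ∑ i : Fin (j + 2) → Fin (n + 1),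
      Form.wedge h₁ (theta (j + 1) (coord ∘ i)) (V (i ∘ l.succAbove)) =
      ∑ i, Form.wedge h₁ (if l = 0 then dprod (j + 1) (coord ∘ i) else 0) (V i) := by
    intro l
    rw [← (Fin.insertNthEquiv (fun _ => Fin (n + 1)) l).sum_comp, Fintype.sum_prod_type_right]
    refine Finset.sum_congr rfl fun i _ => ?_
    rw [← sum_theta_insertNth, map_sum, LinearMap.sum_apply]
    refine Finset.sum_congr rfl fun a _ => ?_
    have h5 : (l.insertNth a i : Fin (j + 2) → Fin (n + 1)) ∘ l.succAbove = i := by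
      funext t; simp
    change Form.wedge h₁ (theta (j + 1) (coord ∘ l.insertNth a i))
      (V ((l.insertNth a i : Fin (j + 2) → Fin (n + 1)) ∘ l.succAbove)) = _
    rw [h5]
  simp only [whitney, cech, map_sum, map_smul]
  rw [Finset.sum_comm]
  simp only [← Finset.smul_sum, h4]
  symm
  rw [Finset.sum_eq_single 0]
  · simp
  · intro l _ hl
    simp [hl]
  · simp

end Whitney

/-! ### Integrals of Whitney forms -/

section WhitneyIntegral

theorem IsAlt.cons {ι : Type*} {j : ℕ} {F : (Fin (j + 1) → ι) → ℝ} (hF : IsAlt F) (x : ι) :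
    IsAlt fun i : Fin j → ι => F (Fin.cons x i) where
  eq_zero i hi := hF.eq_zero _ fun h => hi (Fin.cons_injective_iff.1 h).2
  perm i π := by
    have h : (Fin.cons x (i ∘ π) : Fin (j + 1) → ι) =
        (Fin.cons x i : Fin (j + 1) → ι) ∘ Equiv.Perm.decomposeFin.symm (0, π) := by
      funext t
      refine Fin.cases ?_ (fun t => ?_) t <;> simp
    rw [h, hF.perm, Equiv.Perm.decomposeFin.symm_sign]
    simp

/-- The tuple `(0, i)` is longer than the set of vertices, hence has a repetition, and the Čech
differential of `F` vanishes on it. This is the cone contraction of the full simplex. -/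
theorem IsAlt.eq_cech_cons {k : ℕ} {F : (Fin (k + 2) → Fin (k + 2)) → ℝ} (hF : IsAlt F)
    (i : Fin (k + 2) → Fin (k + 2)) :
    F i = DiffDeRham.cech (fun i : Fin (k + 1) → Fin (k + 2) => F (Fin.cons 0 i)) i := by
  have h1 := hF.cech_eq_zero (Fin.cons 0 i) fun h => by
    have := Fintype.card_le_of_injective _ h
    simp at this
  rw [DiffDeRham.cech, Fin.sum_univ_succ] at h1
  have h2 : (Fin.cons 0 i : Fin (k + 3) → Fin (k + 2)) ∘ Fin.succAbove 0 = i := by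
    funext t; simp
  have h3 : ∀ l : Fin (k + 2), (Fin.cons 0 i : Fin (k + 3) → Fin (k + 2)) ∘ l.succ.succAbove =
      (Fin.cons 0 (i ∘ l.succAbove) : Fin (k + 2) → Fin (k + 2)) := by
    intro l
    funext t
    refine Fin.cases ?_ (fun t => ?_) t <;> simp
  simp only [h2, h3, Fin.val_zero, pow_zero, one_smul, Fin.val_succ, pow_succ, mul_neg, mul_one,
    neg_smul, Finset.sum_neg_distrib] at h1
  exact eq_of_sub_eq_zero ((sub_eq_add_neg _ _).trans h1)

theorem cech_smul_one {X ι : Type*} [DiffeologicalSpace X] {j : ℕ} (F : (Fin j → ι) → ℝ)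
    (i : Fin (j + 1) → ι) :
    cech (fun i => F i • (Form.one : Form X 0)) i = cech F i • Form.one := by
  simp [cech, Finset.sum_smul, smul_smul]

theorem vpull_whitney_smul_one {m n j : ℕ} (τ : Fin (m + 1) → Fin (n + 1))
    (F : (Fin (j + 1) → Fin (n + 1)) → ℝ) :
    vpull τ (whitney (add_zero j) fun i => F i • Form.one) =
      whitney (add_zero j) fun i => F (τ ∘ i) • Form.one := by
  rw [vpull_whitney]
  simp only [map_smul, vpull_one]

theorem d_whitney_smul_one {n j : ℕ} (F : (Fin (j + 1) → Fin (n + 1)) → ℝ) :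
    Form.d j (whitney (add_zero j) fun i => F i • Form.one) =
      whitney (add_zero (j + 1)) fun i => cech F i • Form.one := by
  rw [d_whitney _ (add_zero (j + 1)) (by omega)]
  simp only [map_smul, Form.d_one, smul_zero]
  have h : whitney (n := n) (show j + (0 + 1) = j + 1 by omega)
      (fun _ => (0 : Form (affineSpace n) 1)) = 0 := by
    simp [whitney]
  rw [h, smul_zero, add_zero]
  congr 1
  funext i
  exact cech_smul_one F i

theorem wedge_one_right {X : Type*} [DiffeologicalSpace X] {n : ℕ} (h : n + 0 = n) (η : Form X n) :
    Form.wedge h η Form.one = η := (Omega X).mul_one h η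

/-- The integral of the Whitney form of an alternating function of tuples. -/
theorem simplexInt_whitney {k : ℕ} (F : (Fin (k + 1) → Fin (k + 1)) → ℝ) (hF : IsAlt F) :
    simplexInt k (whitney (add_zero k) fun i => F i • Form.one) = F id := by
  induction k with
  | zero =>
    have h1 : ∀ i : Fin 1 → Fin 1, i = id := fun i => funext fun t => Subsingleton.elim _ _
    rw [simplexInt_zero, whitney, Fintype.sum_eq_single id (fun i hi => absurd (h1 i) hi),
      map_smul, map_smul, wedge_one_right, theta_apply, dprod_zero, wedge_one_right]
    simp [eval_coord, vertex_apply]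
  | succ k ih =>
    -- Writing `F` as a Čech coboundary makes its Whitney form exact; Stokes' theorem then gives an
    -- alternating sum over faces, where the induction hypothesis applies.
    have h1 : F = cech fun i : Fin (k + 1) → Fin (k + 2) => F (Fin.cons 0 i) :=
      funext hF.eq_cech_cons
    conv_lhs => rw [h1]
    rw [← d_whitney_smul_one, simplexInt_d]
    simp only [vpull_whitney_smul_one]
    conv_rhs => rw [h1]
    refine Finset.sum_congr rfl fun l _ => ?_
    rw [ih _ ((hF.cons 0).comp l.succAbove)]
    rfl

end WhitneyIntegral

/-! ### Iterated cones in the Čech–de Rham double complex -/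

section Families

variable (K : SSet.{u})

/-- Families of `r`-forms on the simplices of `K` that are indexed by `j`-tuples of vertices and
natural with respect to the simplicial structure. -/
def Fam (j r : ℕ) : Submodule ℝ (∀ n : SimplexCategory, K.obj (op n) →
    (Fin j → Fin (n.len + 1)) → Form (affineSpace n.len) r) where
  carrier := {U | ∀ (m n : SimplexCategory) (τ : m ⟶ n) (σ : K.obj (op n))
    (i : Fin j → Fin (m.len + 1)),
    U m (K.map τ.op σ) i = vpull (fun t => τ t) (U n σ (fun t => τ (i t)))}
  add_mem' := fun {U V} hU hV m n τ σ i => by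
    simp only [Pi.add_apply, hU m n τ σ, hV m n τ σ, map_add]
  zero_mem' := fun m n τ σ i => by simp
  smul_mem' := fun c U hU m n τ σ i => by
    simp only [Pi.smul_apply, hU m n τ σ, map_smul]

variable {K}

/-- The Čech differential of a family of forms. -/
def famCech {j r : ℕ} (U : Fam K j r) : Fam K (j + 1) r :=
  ⟨fun n σ => cech (U.1 n σ), fun m n τ σ i => by
    simp only [cech, map_sum, map_smul, U.2 m n τ σ]
    rfl⟩

/-- The exterior derivative of a family of forms. -/
def famD {j r : ℕ} (U : Fam K j r) : Fam K j (r + 1) :=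
  ⟨fun n σ i => Form.d r (U.1 n σ i), fun m n τ σ i => by
    exact (congrArg (Form.d r) (U.2 m n τ σ i)).trans (vpull_d _ _).symm⟩

/-- The family obtained by applying the cone operator at an additional last vertex. -/
def famCone {j r : ℕ} (U : Fam K j (r + 1)) : Fam K (j + 1) r :=
  ⟨fun n σ i => cone (i (Fin.last j)) (U.1 n σ (Fin.init i)), fun m n τ σ i => by
    exact (congrArg (cone (i (Fin.last j))) (U.2 m n τ σ (Fin.init i))).trans
      (vpull_cone (fun t => τ t) (i (Fin.last j)) _).symm⟩

/-- Natural real valued functions of tuples, as families of constant functions. -/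
def famConst {j : ℕ} (G : ∀ n : SimplexCategory, K.obj (op n) → (Fin j → Fin (n.len + 1)) → ℝ)
    (hG : ∀ (m n : SimplexCategory) (τ : m ⟶ n) (σ : K.obj (op n)) (i : Fin j → Fin (m.len + 1)),
      G m (K.map τ.op σ) i = G n σ (fun t => τ (i t))) : Fam K j 0 :=
  ⟨fun n σ i => G n σ i • Form.one, fun m n τ σ i => by
    simp only [hG, map_smul, vpull_one]⟩

/-- The relation between `d` and the Čech differential that holds for the iterated cones of a closed
form. -/
def IsConeClosed {j r : ℕ} (U : Fam K j r) : Prop :=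
  ∀ (n : SimplexCategory) (σ : K.obj (op n)) (i : Fin (j + 1) → Fin (n.len + 1)),
    cone (i (Fin.last j)) (Form.d r (U.1 n σ (Fin.init i))) =
      U.1 n σ (Fin.init i) - (-1 : ℝ) ^ j • cech (U.1 n σ) i

/-- Deleting the last index removes the cone vertex and gives the extra term; all other deletions
leave it in place and pass through the cone operator. -/
theorem cech_famCone {j r : ℕ} (U : Fam K j (r + 1)) (n : SimplexCategory) (σ : K.obj (op n))
    (i : Fin (j + 2) → Fin (n.len + 1)) :
    cech ((famCone U).1 n σ) i = cone (i (Fin.last (j + 1))) (cech (U.1 n σ) (Fin.init i)) +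
      (-1 : ℝ) ^ (j + 1) • (famCone U).1 n σ (Fin.init i) := by
  rw [cech, Fin.sum_univ_castSucc, cech, map_sum]
  congr 1
  · refine Finset.sum_congr rfl fun l _ => ?_
    rw [map_smul]
    congr 1
    simp only [famCone, Function.comp_apply]
    congr 2
    · rw [Fin.succAbove_of_lt_succ]
      · rfl
      · simp
    · refine congrArg _ (funext fun t => ?_)
      simp [Fin.init, Fin.castSucc_succAbove_castSucc]
  · rw [Fin.val_last]
    congr 1
    refine congrArg _ (funext fun t => ?_)
    simp [Fin.init]

/-- The homotopy formula expresses `d (cone U)` as `U - cone (d U)`, and the hypothesis says that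
this difference is the signed Čech differential. -/
theorem IsConeClosed.d_famCone {j r : ℕ} {U : Fam K j (r + 1)} (hU : IsConeClosed U) :
    famD (famCone U) = (-1 : ℝ) ^ j • famCech U := by
  refine Subtype.ext (funext fun n => funext fun σ => funext fun i => ?_)
  have h1 := d_cone_add_cone_d (i (Fin.last j)) (U.1 n σ (Fin.init i))
  rw [hU n σ i] at h1
  change Form.d r (cone (i (Fin.last j)) (U.1 n σ (Fin.init i))) = (-1 : ℝ) ^ j • cech (U.1 n σ) i
  rw [eq_sub_of_add_eq h1]
  abel

/-- The relation reproduces itself: `d_famCone` computes the differential of the new family, and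
`cech_famCone` computes the cone of a Čech differential. -/
theorem IsConeClosed.famCone {j r : ℕ} {U : Fam K j (r + 1)} (hU : IsConeClosed U) :
    IsConeClosed (famCone U) := by
  intro n σ i
  have h1 : Form.d r ((DiffDeRham.famCone U).1 n σ (Fin.init i)) =
      (-1 : ℝ) ^ j • cech (U.1 n σ) (Fin.init i) :=
    congrFun (congrFun (congrFun (congrArg Subtype.val hU.d_famCone) n) σ) (Fin.init i)
  have h2 : (-1 : ℝ) ^ (j + 1) * (-1 : ℝ) ^ (j + 1) = 1 := by rw [← mul_pow]; norm_num
  rw [h1, cech_famCone, smul_add, smul_smul, h2, one_smul, map_smul, pow_succ]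
  simp

/-- The first indices of a tuple. -/
def frontIdx (j k : ℕ) (h : j ≤ k) (t : Fin j) : Fin k := ⟨t, by omega⟩

/-- The last indices of a tuple. -/
def backIdx (j r k : ℕ) (h : j + r ≤ k) (t : Fin r) : Fin k := ⟨j + t, by omega⟩

/-- The integral of the forms of a family over the simplices spanned by the remaining vertices. -/
def famInt {j r k : ℕ} (h : j + r = k) (U : Fam K j r) (n : SimplexCategory) (σ : K.obj (op n))
    (i : Fin (k + 1) → Fin (n.len + 1)) : ℝ :=
  simplexInt r (vpull (i ∘ backIdx j (r + 1) (k + 1) (by omega))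
    (U.1 n σ (i ∘ frontIdx j (k + 1) (by omega))))

theorem famInt_natural {j r k : ℕ} (h : j + r = k) (U : Fam K j r) (m n : SimplexCategory)
    (τ : m ⟶ n) (σ : K.obj (op n)) (i : Fin (k + 1) → Fin (m.len + 1)) :
    famInt h U m (K.map τ.op σ) i = famInt h U n σ (fun t => τ (i t)) := by
  rw [famInt, U.2 m n τ σ, vpull_comp]
  rfl

/-- By `simplexInt_succ`, coning at a vertex and integrating over the simplex of the following
vertices is integrating over the simplex with that vertex put in front. So the integrals do not
change along the iteration. -/
theorem famInt_famCone {j r k : ℕ} (h : j + (r + 1) = k) (h' : j + 1 + r = k) (U : Fam K j (r + 1)) :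
    famInt h' (famCone U) = famInt h U := by
  funext n σ i
  rw [famInt, famInt, simplexInt_succ, ← vpull_cone, vpull_comp]
  have e1 : (i ∘ backIdx j (r + 1 + 1) (k + 1) (by omega)) ∘ Fin.succ =
      i ∘ backIdx (j + 1) (r + 1) (k + 1) (by omega) := by
    funext t
    simp only [Function.comp_apply, backIdx, Fin.val_succ]
    congr 2
    omega
  rw [e1]
  rfl

/-- On functions, `cone ∘ d` subtracts the value at the cone vertex, so the relation forces the Čech
differential to equal this constant up to sign. -/
theorem IsConeClosed.famCech_eq {k : ℕ} {U : Fam K k 0} (hU : IsConeClosed U) :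
    famCech U = (-1 : ℝ) ^ k • famConst (famInt (add_zero k) U) (famInt_natural _ U) := by
  refine Subtype.ext (funext fun n => funext fun σ => funext fun i => ?_)
  have h1 := hU n σ i
  rw [cone_d_zero, sub_right_inj] at h1
  have h2 : famInt (add_zero k) U n σ i = Form.eval (vertex (i (Fin.last k))) (U.1 n σ (Fin.init i)) := by
    rw [famInt, simplexInt_zero, eval_vpull]
    rfl
  change cech (U.1 n σ) i = (-1 : ℝ) ^ k • (famInt (add_zero k) U n σ i • Form.one)
  rw [h2, h1, smul_smul, ← mul_pow]
  simp

/-- The comparison of a closed form with the family of its integrals, for every map from families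
of forms to a cochain algebra that is compatible with the differentials. -/
theorem IsConeClosed.sub_mem_Bd {A : CochainAlgebra.{u}} (s : ℕ)
    (g : ∀ {j r N : ℕ}, j + r + s = N → Fam K (j + 1) r → A.C N)
    (hsmul : ∀ {j r N : ℕ} (h : j + r + s = N) (c : ℝ) (U : Fam K (j + 1) r),
      g h (c • U) = c • g h U)
    (hd : ∀ {j r N : ℕ} (h : j + r + s = N) (h₁ : j + 1 + r + s = N + 1)
      (h₂ : j + (r + 1) + s = N + 1) (U : Fam K (j + 1) r),
      A.d N (g h U) = g h₁ (famCech U) + (-1 : ℝ) ^ j • g h₂ (famD U))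
    {j r k N : ℕ} (hk : j + r = k) (h : j + r + s = N) (h' : k + 0 + s = N) {U : Fam K j r}
    (hU : IsConeClosed U) :
    g h (famCech U) - (-1 : ℝ) ^ j • g h' (famConst (famInt hk U) (famInt_natural hk U)) ∈
      A.Bd N := by
  induction r generalizing j with
  | zero =>
    obtain rfl : j = k := hk
    rw [hU.famCech_eq, hsmul, sub_self]
    exact Submodule.zero_mem _
  | succ r ih =>
    have h1 := ih (show j + 1 + r = k by omega) (by omega) hU.famCone
    obtain ⟨N, rfl⟩ : ∃ M, N = M + 1 := ⟨j + r + s, by omega⟩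
    -- Applied to `famCone U`, the compatibility of `g` with differentials shows that the images of
    -- `famCech U` and `famCech (famCone U)` add up to a coboundary; the induction hypothesis treats
    -- the latter. This is the source of the alternating sign.
    have h2 := hd (show j + r + s = N by omega) (by omega) h (DiffDeRham.famCone U)
    rw [hU.d_famCone, hsmul, smul_smul, ← mul_pow, neg_one_mul, neg_neg, one_pow, one_smul] at h2
    have h3 : A.d N (g (show j + r + s = N by omega) (DiffDeRham.famCone U)) ∈ A.Bd (N + 1) :=
      ⟨_, rfl⟩
    simp only [famInt_famCone hk] at h1
    have h4 := Submodule.sub_mem _ h3 h1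
    rw [h2] at h4
    convert h4 using 1
    rw [pow_succ]
    simp only [mul_neg, mul_one, neg_smul]
    abel

end Families

/-! ### Comparison of forms with their integrals and of the two products -/

section Comparison

variable {K : SSet.{u}}

/-- A form on `K` as a family of forms that is indexed by empty tuples. -/
def famOfForm {k : ℕ} (a : (ADR K).C k) : Fam K 0 k :=
  ⟨fun n σ _ => a.1 (op n) σ, fun m n τ σ _ => a.2 (op n) (op m) τ.op σ⟩

/-- For empty tuples the Čech differential is the inclusion of `a` into families indexed by one
vertex, so the relation reads `cone (d a) = a - a`. -/
theorem isConeClosed_famOfForm {k : ℕ} (a : (ADR K).C k) (ha : (ADR K).d k a = 0) :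
    IsConeClosed (famOfForm a) := by
  intro n σ i
  have h1 : Form.d k (a.1 (op n) σ) = 0 :=
    congrFun (congrFun (congrArg Subtype.val ha) (op n)) σ
  change cone _ (Form.d k (a.1 (op n) σ)) = a.1 (op n) σ - _
  rw [h1, map_zero]
  simp [cech, famOfForm]

/-- The integrals of a form over all simplices spanned by tuples of vertices. -/
def vertexInt {k : ℕ} (a : (ADR K).C k) (n : SimplexCategory) (σ : K.obj (op n))
    (i : Fin (k + 1) → Fin (n.len + 1)) : ℝ :=
  simplexInt k (vpull i (a.1 (op n) σ))

theorem famInt_famOfForm {k : ℕ} (a : (ADR K).C k) :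
    famInt (zero_add k) (famOfForm a) = vertexInt a := by
  funext n σ i
  have e : i ∘ backIdx 0 (k + 1) (k + 1) (by omega) = i := by
    funext t
    simp [backIdx]
  rw [famInt, e]
  rfl

theorem vertexInt_natural {k : ℕ} (a : (ADR K).C k) (m n : SimplexCategory)
    (τ : m ⟶ n) (σ : K.obj (op n)) (i : Fin (k + 1) → Fin (m.len + 1)) :
    vertexInt a m (K.map τ.op σ) i = vertexInt a n σ (fun t => τ (i t)) := by
  rw [← famInt_famOfForm]
  exact famInt_natural _ _ m n τ σ i

/-- The Whitney form of a family of forms. -/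
def whitneyFam {j r N : ℕ} (h : j + r = N) (U : Fam K (j + 1) r) : (ADR K).C N :=
  ⟨fun n σ => whitney h (U.1 n.unop σ), fun n m τ σ => by
    have h1 : U.1 m.unop (K.map τ σ) = fun i => vpull (fun t => τ.unop t)
        (U.1 n.unop σ (fun t => τ.unop (i t))) := funext fun i => U.2 m.unop n.unop τ.unop σ i
    exact (congrArg (whitney h) h1).trans
      (vpull_whitney h (fun t => τ.unop t) (U.1 n.unop σ)).symm⟩

theorem whitneyFam_smul {j r N : ℕ} (h : j + r = N) (c : ℝ) (U : Fam K (j + 1) r) :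
    whitneyFam h (c • U) = c • whitneyFam h U := by
  refine ADRForm.ext fun n σ => ?_
  change whitney h (c • U.1 n.unop σ) = c • whitney h (U.1 n.unop σ)
  simp [whitney, Finset.smul_sum]

theorem d_whitneyFam {j r N : ℕ} (h : j + r = N) (h₁ : j + 1 + r = N + 1)
    (h₂ : j + (r + 1) = N + 1) (U : Fam K (j + 1) r) :
    (ADR K).d N (whitneyFam h U) =
      whitneyFam h₁ (famCech U) + (-1 : ℝ) ^ j • whitneyFam h₂ (famD U) :=
  ADRForm.ext fun n σ => d_whitney h h₁ h₂ (U.1 n.unop σ)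

theorem sum_theta_zero (n : ℕ) :
    ∑ i : Fin 1 → Fin (n + 1), theta 0 (coord ∘ i) = (Form.one : Form (affineSpace n) 0) := by
  rw [← sum_coord n]
  refine Fintype.sum_equiv (Equiv.funUnique (Fin 1) (Fin (n + 1))) _ _ fun i => ?_
  rw [theta_apply, dprod_zero, wedge_one_right]
  rfl

/-- The coordinates form a partition of unity, so the Whitney map sends the constant family `a` back
to `a`. -/
theorem whitneyFam_famOfForm {k : ℕ} (h : 0 + k = k) (a : (ADR K).C k) :
    whitneyFam h (famCech (famOfForm a)) = a := by
  refine ADRForm.ext fun n σ => ?_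
  change whitney h (cech fun _ => a.1 n σ) = a.1 n σ
  have h1 : (cech fun _ : Fin 0 → Fin (n.unop.len + 1) => a.1 n σ) = fun _ => a.1 n σ := by
    funext i
    simp [cech]
  rw [h1, whitney, ← LinearMap.sum_apply, ← map_sum, sum_theta_zero, Form.one_wedge]

/-- A closed form is cohomologous to the Whitney form of its integrals. -/
theorem sub_whitneyFam_mem_Bd {k : ℕ} (a : (ADR K).C k) (ha : (ADR K).d k a = 0) :
    a - whitneyFam (add_zero k) (famConst (vertexInt a) (vertexInt_natural a)) ∈ (ADR K).Bd k := by
  have h1 := (isConeClosed_famOfForm a ha).sub_mem_Bd (A := ADR K) 0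
    (fun {j r N} h U => whitneyFam (show j + r = N from h) U)
    (fun {j r N} h c U => whitneyFam_smul (show j + r = N from h) c U)
    (fun {j r N} h h₁ h₂ U => d_whitneyFam (show j + r = N from h) (show j + 1 + r = N + 1 from h₁)
      (show j + (r + 1) = N + 1 from h₂) U) (N := k) (zero_add k) (zero_add k) (add_zero k)
  simp only [famInt_famOfForm, whitneyFam_famOfForm, pow_zero, one_smul] at h1
  exact h1

/-- The cochain that evaluates a family at the front vertices of a simplex and integrates over its
back face. -/
def frontBack {j r N : ℕ} (h : j + r = N) (U : Fam K (j + 1) r) : (Cochains K).C N := fun σ =>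
  simplexInt r (vpull (m := r) (n := N) (backIdx j (r + 1) (N + 1) (by omega))
    (U.1 ⦋N⦌ σ (frontIdx (j + 1) (N + 1) (by omega))))

/-- Faces opposite front vertices account for the Čech differential without its last term, the
remaining faces for the boundary in Stokes' theorem without its first term. These two missing terms
coincide and have opposite signs. -/
theorem d_frontBack {j r N : ℕ} (h : j + r = N) (h₁ : j + 1 + r = N + 1)
    (h₂ : j + (r + 1) = N + 1) (U : Fam K (j + 1) r) :
    (Cochains K).d N (frontBack h U) =
      frontBack h₁ (famCech U) + (-1 : ℝ) ^ j • frontBack h₂ (famD U) := by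
  subst h
  funext σ
  let V : (Fin (j + 1) → Fin (j + r + 1 + 1)) → Form (affineSpace (j + r + 1)) r :=
    U.1 ⦋j + r + 1⦌ σ
  let T : (Fin (r + 1) → Fin (j + r + 2)) → (Fin (j + 1) → Fin (j + r + 2)) → ℝ := fun β α =>
    simplexInt r (vpull (m := r) (n := j + r + 1) β (V α))
  let A : Fin (j + r + 2) → ℝ := fun l =>
    T (l.succAbove ∘ backIdx j (r + 1) (j + r + 1) (by omega))
      (l.succAbove ∘ frontIdx (j + 1) (j + r + 1) (by omega))
  have hL : (Cochains K).d (j + r) (frontBack rfl U) σ = ∑ l : Fin (j + r + 2), (-1 : ℝ) ^ (l : ℕ) * A l := by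
    refine (cochainD_apply (K := K) (frontBack rfl U) σ).trans (Finset.sum_congr rfl fun l _ => ?_)
    congr 1
    change simplexInt r (vpull (n := j + r) _ (U.1 ⦋j + r⦌ (K.map (SimplexCategory.δ l).op σ) _)) = _
    rw [U.2, vpull_comp]
    rfl
  let B : Fin (j + 2) → ℝ := fun l => T (backIdx (j + 1) (r + 1) (j + r + 2) (by omega))
    (frontIdx (j + 2) (j + r + 2) (by omega) ∘ l.succAbove)
  have h1 : frontBack h₁ (famCech U) σ = ∑ l : Fin (j + 2), (-1 : ℝ) ^ (l : ℕ) * B l := by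
    change simplexInt r (vpull _ (cech V _)) = _
    simp only [cech, map_sum, map_smul, smul_eq_mul]
    rfl
  let D : Fin (r + 2) → ℝ := fun l => T (backIdx j (r + 2) (j + r + 2) (by omega) ∘ l.succAbove)
    (frontIdx (j + 1) (j + r + 2) (by omega))
  have h2 : frontBack h₂ (famD U) σ = ∑ l : Fin (r + 2), (-1 : ℝ) ^ (l : ℕ) * D l := by
    change simplexInt (r + 1) (vpull _ (Form.d r (V _))) = _
    rw [vpull_d, simplexInt_d]
    simp only [vpull_comp]
    rfl
  have hAB : ∀ l : Fin (j + 1), A (Fin.cast (by omega) (Fin.castAdd (r + 1) l)) = B l.castSucc := by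
    intro l
    simp only [A, B]
    refine congrArg₂ T ?_ ?_
    · funext t
      refine Fin.ext ?_
      simp only [Function.comp_apply, val_succAbove, backIdx, Fin.val_cast, Fin.val_castAdd]
      split_ifs <;> omega
    · funext t
      refine Fin.ext ?_
      simp only [Function.comp_apply, val_succAbove, frontIdx, Fin.val_cast, Fin.val_castAdd,
        Fin.val_castSucc]
  have hAD : ∀ l : Fin (r + 1), A (Fin.cast (by omega) (Fin.natAdd (j + 1) l)) = D l.succ := by
    intro l
    simp only [A, D]
    refine congrArg₂ T ?_ ?_
    · funext t
      refine Fin.ext ?_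
      simp only [Function.comp_apply, val_succAbove, backIdx, Fin.val_cast, Fin.val_natAdd,
        Fin.val_succ]
      split_ifs <;> omega
    · funext t
      refine Fin.ext ?_
      simp only [Function.comp_apply, val_succAbove, frontIdx, Fin.val_cast, Fin.val_natAdd]
      split_ifs <;> omega
  -- Both terms omit the vertex `j + 1` from the front and the vertex `j` from the back.
  have hBD : B (Fin.last (j + 1)) = D 0 := by
    simp only [B, D]
    refine congrArg₂ T ?_ ?_
    · funext t
      refine Fin.ext ?_
      simp only [Function.comp_apply, val_succAbove, backIdx, Fin.val_zero, Nat.not_lt_zero, if_false]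
      omega
    · funext t
      refine Fin.ext ?_
      simp only [Function.comp_apply, val_succAbove, frontIdx, Fin.val_last]
      split_ifs <;> omega
  rw [hL]
  change _ = frontBack h₁ (famCech U) σ + (-1 : ℝ) ^ j * frontBack h₂ (famD U) σ
  rw [h1, h2, ← Fin.sum_congr' _ (show (j + 1) + (r + 1) = j + r + 2 by omega),
    Fin.sum_univ_add, Fin.sum_univ_castSucc (n := j + 1), Fin.sum_univ_succ (n := r + 1), mul_add,
    Finset.mul_sum]
  simp only [hAB, hAD, hBD, Fin.val_cast, Fin.val_castAdd, Fin.val_natAdd, Fin.val_castSucc,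
    Fin.val_last, Fin.val_zero, Fin.val_succ, pow_zero, one_mul]
  have h3 : ∀ l : Fin (r + 1), (-1 : ℝ) ^ j * ((-1) ^ ((l : ℕ) + 1) * D l.succ) =
      (-1) ^ (j + 1 + (l : ℕ)) * D l.succ := fun l => by
    ring
  simp only [h3]
  ring

/-- The product of a family of forms and a form. -/
def famMul {j r q s : ℕ} (h : r + q = s) (U : Fam K j r) (b : (ADR K).C q) : Fam K j s :=
  ⟨fun n σ i => Form.wedge h (U.1 n σ i) (b.1 (op n) σ), fun m n τ σ i => by
    have h1 : b.1 (op m) (K.map τ.op σ) = vpull (fun t => τ t) (b.1 (op n) σ) :=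
      b.2 (op n) (op m) τ.op σ
    simp only [U.2 m n τ σ, h1, vpull_wedge]⟩

theorem famCech_famMul {j r q s : ℕ} (h : r + q = s) (U : Fam K j r) (b : (ADR K).C q) :
    famCech (famMul h U b) = famMul h (famCech U) b := by
  refine Subtype.ext (funext fun n => funext fun σ => funext fun i => ?_)
  simp [famCech, famMul, cech]

theorem famD_famMul {j r q s : ℕ} (h : r + q = s) (h' : r + 1 + q = s + 1) (U : Fam K j r)
    (b : (ADR K).C q) (hb : (ADR K).d q b = 0) :
    famD (famMul h U b) = famMul h' (famD U) b := by
  refine Subtype.ext (funext fun n => funext fun σ => funext fun i => ?_)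
  have h1 : Form.d q (b.1 (op n) σ) = 0 :=
    congrFun (congrFun (congrArg Subtype.val hb) (op n)) σ
  change Form.d s (Form.wedge h _ _) = Form.wedge h' (Form.d r _) _
  rw [Form.d_wedge h h' (by omega), h1, map_zero, smul_zero, add_zero]

/-- Bridges expressions such as `r + 1 + q` and `r + q + 1`, which are only propositionally equal
degrees. -/
theorem frontBack_famMul_congr {j r q s s' N : ℕ} (h : r + q = s) (h' : r + q = s')
    (e : j + s = N) (e' : j + s' = N) (U : Fam K (j + 1) r) (b : (ADR K).C q) :
    frontBack e (famMul h U b) = frontBack e' (famMul h' U b) := by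
  subst h
  subst h'
  rfl

theorem frontBack_smul {j r N : ℕ} (h : j + r = N) (c : ℝ) (U : Fam K (j + 1) r) :
    frontBack h (c • U) = c • frontBack h U := by
  funext σ
  change simplexInt r (vpull _ (c • U.1 _ _ _)) = c • simplexInt r _
  rw [map_smul, map_smul]

theorem integration_apply {k : ℕ} (a : (ADR K).C k) (σ : K _⦋k⦌) :
    integration K k a σ = simplexInt k (a.1 (op ⦋k⦌) σ) := rfl

theorem vertexInt_hom {k : ℕ} (a : (ADR K).C k) (n : SimplexCategory) (τ : ⦋k⦌ ⟶ n)
    (σ : K.obj (op n)) :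
    vertexInt a n σ (fun t => τ t) = integration K k a (K.map τ.op σ) := by
  refine (vertexInt_natural a _ _ τ σ id).symm.trans ?_
  rw [vertexInt, integration_apply]
  exact congrArg (simplexInt k) (vpull_id _)

/-- The integration map is multiplicative up to coboundaries on closed forms. -/
theorem integration_mul_sub_mem_Bd {p q n : ℕ} (h : p + q = n) (a : (ADR K).C p) (b : (ADR K).C q)
    (ha : (ADR K).d p a = 0) (hb : (ADR K).d q b = 0) :
    integration K n ((ADR K).mul h a b) -
      (Cochains K).mul h (integration K p a) (integration K q b) ∈ (Cochains K).Bd n := by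
  subst h
  -- Multiplication by `b` shifts degrees by `s = q`, and since `b` is closed it commutes with both
  -- differentials of families.
  have h1 := (isConeClosed_famOfForm a ha).sub_mem_Bd (A := Cochains K) q
    (fun {j r N} h U => frontBack (show j + (r + q) = N by omega) (famMul rfl U b))
    (fun h c U => by
      rw [← frontBack_smul]
      congr 1
      refine Subtype.ext (funext fun n => funext fun σ => funext fun i => ?_)
      exact LinearMap.map_smul₂ (Form.wedge rfl) c _ _)
    (fun {j r N} h h₁ h₂ U => by
      rw [d_frontBack _ (by omega) (by omega), famCech_famMul, famD_famMul _ (by omega) _ _ hb]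
      congr 2
      exact frontBack_famMul_congr _ _ _ _ _ _)
    (zero_add p) (show 0 + p + q = p + q by omega) (show p + 0 + q = p + q by omega)
  simp only [famInt_famOfForm, pow_zero, one_smul] at h1
  rw [frontBack_famMul_congr _ (zero_add q) _ rfl] at h1
  convert h1 using 2
  -- At the start of the iteration the back face is the whole simplex, so the cochain is the
  -- integral of `a ∧ b`.
  · funext σ
    have e : backIdx 0 (p + q + 1) (p + q + 1) (by omega) = id := by
      funext t
      simp [backIdx]
    have e' : (famCech (famOfForm a)).1 ⦋p + q⦌ σ = fun _ => a.1 (op ⦋p + q⦌) σ := by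
      funext i
      simp [cech, famOfForm, famCech]
    change simplexInt (p + q) (Form.wedge rfl (a.1 (op ⦋p + q⦌) σ) (b.1 (op ⦋p + q⦌) σ)) =
      simplexInt (p + q) (vpull (n := p + q) (backIdx 0 (p + q + 1) (p + q + 1) (by omega))
        (Form.wedge rfl ((famCech (famOfForm a)).1 ⦋p + q⦌ σ _) (b.1 (op ⦋p + q⦌) σ)))
    rw [e', e]
    exact congrArg _ (vpull_id _).symm
  -- At its end the integral of `a` over the front face is a constant factor and `b` is integrated
  -- over the back face: the cup product.
  · funext σ
    refine (cup_apply (K := K) rfl (integration K p a) (integration K q b) σ).trans ?_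
    rw [← vertexInt_hom, ← vertexInt_hom]
    change _ = simplexInt q (vpull (n := p + q) (backIdx p (q + 1) (p + q + 1) (by omega))
      (Form.wedge (zero_add q)
        (vertexInt a ⦋p + q⦌ σ (frontIdx (p + 1) (p + q + 1) (by omega)) • Form.one)
        (b.1 (op ⦋p + q⦌) σ)))
    rw [LinearMap.map_smul₂, Form.one_wedge, map_smul, map_smul, smul_eq_mul]
    congr 1
    refine congrArg (vertexInt b ⦋p + q⦌ σ) (funext fun t => Fin.ext ?_)
    exact Nat.add_comm _ _

end Comparison

/-! ### Cochain maps and homotopies induced from chain complexes -/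

section Chains

variable {K L M : SSet.{u}}

/-- The differential of the chain complex `ℤK`. -/
def chainD (K : SSet.{u}) (m : ℕ) : FreeAbelianGroup (K _⦋m + 1⦌) →+ FreeAbelianGroup (K _⦋m⦌) :=
  ((chains.obj K).d (m + 1) m).hom

theorem chainD_of (m : ℕ) (σ : K _⦋m + 1⦌) :
    chainD K m (FreeAbelianGroup.of σ) = ∑ i : Fin (m + 2), (-1 : ℤ) ^ (i : ℕ) •
      FreeAbelianGroup.of (K.map (SimplexCategory.δ i).op σ) := by
  let Y := ((SimplicialObject.whiskering _ _).obj AddCommGrpCat.free).obj K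
  have h0 : (chains.obj K).d (m + 1) m = ∑ i : Fin (m + 2), (-1 : ℤ) ^ (i : ℕ) • Y.δ i :=
    AlgebraicTopology.AlternatingFaceMapComplex.obj_d_eq Y m
  have h1 : chainD K m = ∑ i : Fin (m + 2), (-1 : ℤ) ^ (i : ℕ) •
      FreeAbelianGroup.map (K.map (SimplexCategory.δ i).op) := by
    rw [chainD, h0]
    change AddCommGrpCat.homAddEquiv (∑ i : Fin (m + 2), (-1 : ℤ) ^ (i : ℕ) • Y.δ i) = _
    rw [map_sum]
    rfl
  rw [h1, AddMonoidHom.finsetSum_apply]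
  rfl

theorem lift_chainD (m : ℕ) (g : K _⦋m⦌ → ℝ) (x : FreeAbelianGroup (K _⦋m + 1⦌)) :
    FreeAbelianGroup.lift g (chainD K m x) = FreeAbelianGroup.lift (cochainD m g) x := by
  change ((FreeAbelianGroup.lift g).comp (chainD K m)) x = _
  congr 1
  refine FreeAbelianGroup.lift_ext _ _ fun σ => ?_
  rw [AddMonoidHom.comp_apply, chainD_of, map_sum, FreeAbelianGroup.lift_apply_of, cochainD_apply]
  refine Finset.sum_congr rfl fun i _ => ?_
  rw [map_zsmul, FreeAbelianGroup.lift_apply_of, zsmul_eq_mul]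
  push_cast
  rfl

/-- The additive map in degree `p` that underlies a morphism of chain complexes. -/
def chainF (k : chains.obj K ⟶ chains.obj L) (p : ℕ) :
    FreeAbelianGroup (K _⦋p⦌) →+ FreeAbelianGroup (L _⦋p⦌) := (k.f p).hom

/-- The cochain obtained by pulling back a cochain along an additive map. -/
def pullAdd {p q : ℕ} (h : FreeAbelianGroup (K _⦋p⦌) →+ FreeAbelianGroup (L _⦋q⦌))
    (f : L _⦋q⦌ → ℝ) : K _⦋p⦌ → ℝ := fun σ => FreeAbelianGroup.lift f (h (FreeAbelianGroup.of σ))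

theorem lift_pullAdd {p q : ℕ} (h : FreeAbelianGroup (K _⦋p⦌) →+ FreeAbelianGroup (L _⦋q⦌))
    (f : L _⦋q⦌ → ℝ) (x : FreeAbelianGroup (K _⦋p⦌)) :
    FreeAbelianGroup.lift (pullAdd h f) x = FreeAbelianGroup.lift f (h x) := by
  change _ = ((FreeAbelianGroup.lift f).comp h) x
  congr 1
  exact FreeAbelianGroup.lift_ext _ _ fun σ => FreeAbelianGroup.lift_apply_of _ _

theorem pullAdd_chainD (m : ℕ) (g : K _⦋m⦌ → ℝ) : pullAdd (chainD K m) g = cochainD m g := by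
  funext σ
  rw [pullAdd, lift_chainD, FreeAbelianGroup.lift_apply_of]

theorem pullAdd_comp {p q r : ℕ} (h : FreeAbelianGroup (K _⦋p⦌) →+ FreeAbelianGroup (L _⦋q⦌))
    (h' : FreeAbelianGroup (L _⦋q⦌) →+ FreeAbelianGroup (M _⦋r⦌)) (f : M _⦋r⦌ → ℝ) :
    pullAdd (h'.comp h) f = pullAdd h (pullAdd h' f) := by
  funext σ
  exact (lift_pullAdd h' f (h (FreeAbelianGroup.of σ))).symm

theorem pullAdd_add_left {p q : ℕ} (h h' : FreeAbelianGroup (K _⦋p⦌) →+ FreeAbelianGroup (L _⦋q⦌))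
    (f : L _⦋q⦌ → ℝ) : pullAdd (h + h') f = pullAdd h f + pullAdd h' f := by
  funext σ
  simp [pullAdd]

theorem lift_add_smul {A : Type*} (c : ℝ) (f g : A → ℝ) (x : FreeAbelianGroup A) :
    FreeAbelianGroup.lift (f + c • g) x =
      FreeAbelianGroup.lift f x + c * FreeAbelianGroup.lift g x := by
  have : FreeAbelianGroup.lift (f + c • g) =
      FreeAbelianGroup.lift f + (AddMonoidHom.mulLeft c).comp (FreeAbelianGroup.lift g) :=
    FreeAbelianGroup.lift_ext _ _ fun σ => by simp
  rw [this]
  rfl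

/-- Pulling back cochains along an additive map, as a linear map. -/
def pullAddₗ {p q : ℕ} (h : FreeAbelianGroup (K _⦋p⦌) →+ FreeAbelianGroup (L _⦋q⦌)) :
    (L _⦋q⦌ → ℝ) →ₗ[ℝ] (K _⦋p⦌ → ℝ) where
  toFun := pullAdd h
  map_add' f g := by
    funext σ
    have := lift_add_smul 1 f g (h (FreeAbelianGroup.of σ))
    rwa [one_smul, one_mul] at this
  map_smul' c f := by
    funext σ
    have := lift_add_smul c 0 f (h (FreeAbelianGroup.of σ))
    have h0 : FreeAbelianGroup.lift (0 : L _⦋q⦌ → ℝ) = 0 :=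
      FreeAbelianGroup.lift_ext _ _ fun σ => by simp
    simpa [pullAdd, h0] using this

theorem chainF_chainD (k : chains.obj K ⟶ chains.obj L) (p : ℕ) :
    (chainF k p).comp (chainD K p) = (chainD L p).comp (chainF k (p + 1)) :=
  congrArg AddCommGrpCat.Hom.hom (k.comm (p + 1) p).symm

theorem cochainD_pullAdd (k : chains.obj K ⟶ chains.obj L) (p : ℕ) (f : L _⦋p⦌ → ℝ) :
    cochainD p (pullAdd (chainF k p) f) = pullAdd (chainF k (p + 1)) (cochainD p f) := by
  rw [← pullAdd_chainD, ← pullAdd_chainD, ← pullAdd_comp, ← pullAdd_comp, chainF_chainD]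

/-- The map of cochains induced by a morphism of chain complexes is a cochain map. -/
def pullMap (k : chains.obj K ⟶ chains.obj L) :
    CochainAlgebra.CochainMap (Cochains L) (Cochains K) where
  toFun p := pullAddₗ (chainF k p)
  comm p f := cochainD_pullAdd k p f

theorem pullAdd_id (p : ℕ) (f : K _⦋p⦌ → ℝ) :
    pullAdd (chainF (𝟙 (chains.obj K)) p) f = f := by
  funext σ
  exact FreeAbelianGroup.lift_apply_of _ _

theorem pullAdd_chainF_comp (k : chains.obj K ⟶ chains.obj L) (l : chains.obj L ⟶ chains.obj M)
    (p : ℕ) (f : M _⦋p⦌ → ℝ) :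
    pullAdd (chainF (k ≫ l) p) f = pullAdd (chainF k p) (pullAdd (chainF l p) f) := by
  rw [← pullAdd_comp]
  rfl

/-- The additive maps that underlie a chain homotopy. -/
def homotopyMap {k k' : chains.obj K ⟶ chains.obj L} (h : Homotopy k k') (p : ℕ) :
    FreeAbelianGroup (K _⦋p⦌) →+ FreeAbelianGroup (L _⦋p + 1⦌) := (h.hom p (p + 1)).hom

theorem chainF_zero_of_homotopy {k k' : chains.obj K ⟶ chains.obj L} (h : Homotopy k k') :
    chainF k 0 = (chainD L 0).comp (homotopyMap h 0) + chainF k' 0 := by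
  have h1 := h.comm 0
  rw [Homotopy.dNext_zero_chainComplex, zero_add, Homotopy.prevD_chainComplex] at h1
  rw [chainF, h1]
  rfl

theorem chainF_succ_of_homotopy {k k' : chains.obj K ⟶ chains.obj L} (h : Homotopy k k') (p : ℕ) :
    chainF k (p + 1) = (homotopyMap h p).comp (chainD K p) +
      (chainD L (p + 1)).comp (homotopyMap h (p + 1)) + chainF k' (p + 1) := by
  have h1 := h.comm (p + 1)
  rw [Homotopy.dNext_succ_chainComplex, Homotopy.prevD_chainComplex] at h1
  rw [chainF, h1]
  rfl

/-- Homotopic chain maps induce cohomologous cochains, up to a term that involves the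
differential. -/
theorem pullAdd_sub_mem_Bd {k k' : chains.obj K ⟶ chains.obj L} (h : Homotopy k k') (p : ℕ)
    (f : L _⦋p⦌ → ℝ) (hf : pullAdd (homotopyMap h p) (cochainD p f) = 0) :
    pullAdd (chainF k p) f - pullAdd (chainF k' p) f ∈ (Cochains K).Bd p := by
  cases p with
  | zero =>
    rw [chainF_zero_of_homotopy h, pullAdd_add_left, pullAdd_comp, pullAdd_chainD, hf, zero_add,
      sub_self]
    exact Submodule.zero_mem _
  | succ p =>
    rw [chainF_succ_of_homotopy h, pullAdd_add_left, pullAdd_add_left, pullAdd_comp, pullAdd_comp,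
      pullAdd_chainD, pullAdd_chainD, hf, add_zero, add_sub_cancel_right]
    exact ⟨pullAdd (homotopyMap h p) f, rfl⟩

end Chains

/-! ### Normalization of cochains by the Dold–Kan projections -/

section Normalization

variable {K : SSet.{u}}

/-- Normalized cochains: those that vanish on degenerate simplices. -/
def IsNormalized {p : ℕ} (f : K _⦋p⦌ → ℝ) : Prop :=
  ∀ (n : SimplexCategory) (τ : ⦋p⦌ ⟶ n) (σ : K.obj (op n)),
    ¬ Function.Injective (fun t => τ t) → f (K.map τ.op σ) = 0

/-- The simplicial abelian group `ℤK`. -/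
abbrev freeSimp (K : SSet.{u}) : SimplicialObject AddCommGrpCat.{u} :=
  ((SimplicialObject.whiskering _ _).obj AddCommGrpCat.free).obj K

/-- The null-homotopic maps in the construction of the normalization projection. -/
def normH (K : SSet.{u}) (q : ℕ) : chains.obj K ⟶ chains.obj K :=
  AlgebraicTopology.DoldKan.Hσ (X := freeSimp K) q

/-- The iterated projections towards normalized chains. -/
def normP (K : SSet.{u}) (q : ℕ) : chains.obj K ⟶ chains.obj K :=
  AlgebraicTopology.DoldKan.P (X := freeSimp K) q

theorem normP_succ (q : ℕ) : normP K (q + 1) = normP K q ≫ (𝟙 _ + normH K q) := rfl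

/-- The null-homotopy of `normH`. -/
def normHomotopy (K : SSet.{u}) (q : ℕ) : Homotopy (normH K q) 0 :=
  AlgebraicTopology.DoldKan.homotopyHσToZero (X := freeSimp K) q

/-- On generators the homotopy is zero or a signed degeneracy, and normalized cochains vanish on
degenerate simplices. -/
theorem pullAdd_normHomotopy (q p : ℕ) (f : K _⦋p + 1⦌ → ℝ) (hf : IsNormalized f) :
    pullAdd (homotopyMap (normHomotopy K q) p) f = 0 := by
  have h1 : (normHomotopy K q).hom p (p + 1) =
      AlgebraicTopology.DoldKan.hσ (X := freeSimp K) q p := by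
    exact (dif_pos rfl).trans (Category.comp_id _)
  funext σ
  rw [pullAdd, homotopyMap, h1, AlgebraicTopology.DoldKan.hσ]
  split_ifs
  · exact map_zero _
  · change FreeAbelianGroup.lift f ((-1 : ℤ) ^ (p - q) • FreeAbelianGroup.of
      (K.map (SimplexCategory.σ ⟨p - q, _⟩).op σ)) = 0
    rw [map_zsmul, FreeAbelianGroup.lift_apply_of, hf, smul_zero]
    intro h
    have := Fintype.card_le_of_injective _ h
    simp at this

/-- Successive projections differ by a null-homotopic map, and the part of the homotopy that meets
`d f` vanishes because `d f` is normalized. The cochain `f` need not be closed; injectivity of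
integration on cohomology needs this generality. -/
theorem pullAdd_normP_mem_Bd (q p : ℕ) (f : K _⦋p⦌ → ℝ) (hf : IsNormalized (cochainD p f)) :
    pullAdd (chainF (normP K q) p) f - f ∈ (Cochains K).Bd p := by
  induction q with
  | zero =>
    have : pullAdd (chainF (normP K 0) p) f = f := pullAdd_id p f
    rw [this, sub_self]
    exact Submodule.zero_mem _
  | succ q ih =>
    have h1 := pullAdd_sub_mem_Bd (normHomotopy K q) p f (pullAdd_normHomotopy q p _ hf)
    have h0 : pullAdd (chainF (0 : chains.obj K ⟶ chains.obj K) p) f = 0 := by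
      funext σ
      exact map_zero (FreeAbelianGroup.lift f)
    rw [h0, sub_zero] at h1
    have h2 : pullAdd (chainF (normP K q) p) (pullAdd (chainF (normH K q) p) f) ∈
        (Cochains K).Bd p := by
      cases p with
      | zero =>
        have h3 : pullAdd (chainF (normH K q) 0) f = 0 := h1
        rw [h3]
        exact map_zero (pullAddₗ (chainF (normP K q) 0))
      | succ p =>
        obtain ⟨v, hv⟩ := h1
        rw [← hv]
        exact ⟨_, cochainD_pullAdd (normP K q) p v⟩
    have h4 : pullAdd (chainF (normP K (q + 1)) p) f =
        pullAdd (chainF (normP K q) p) f +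
          pullAdd (chainF (normP K q) p) (pullAdd (chainF (normH K q) p) f) := by
      rw [normP_succ, pullAdd_chainF_comp]
      have h5 : chainF (𝟙 _ + normH K q) p =
          chainF (𝟙 (chains.obj K)) p + chainF (normH K q) p := rfl
      rw [h5, pullAdd_add_left, pullAdd_id]
      exact map_add (pullAddₗ (chainF (normP K q) p)) _ _
    rw [h4, add_sub_right_comm]
    exact Submodule.add_mem _ ih h2

/-- In degree `p` the `p`-th projection has already stabilized to `PInfty`, which kills
degeneracies, and every non-injective operator factors through some `σ i`. -/
theorem isNormalized_pullAdd_normP (p : ℕ) (f : K _⦋p⦌ → ℝ) :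
    IsNormalized (pullAdd (chainF (normP K p) p) f) := by
  intro n τ σ hτ
  cases p with
  | zero => exact absurd (fun a b _ => Subsingleton.elim (α := Fin 1) a b) hτ
  | succ p =>
    obtain ⟨i, θ, rfl⟩ := SimplexCategory.eq_σ_comp_of_not_injective τ hτ
    have h1 := AlgebraicTopology.DoldKan.σ_comp_PInfty (freeSimp K) i
    rw [AlgebraicTopology.DoldKan.PInfty_f] at h1
    have h2 := DFunLike.congr_fun (congrArg AddCommGrpCat.Hom.hom h1)
      (FreeAbelianGroup.of (K.map θ.op σ) : FreeAbelianGroup (K _⦋p⦌))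
    rw [← map_op_map_op, pullAdd]
    refine (congrArg (FreeAbelianGroup.lift f) h2).trans (map_zero _)

/-- Every cochain whose differential is normalized is cohomologous to a normalized one. -/
theorem exists_isNormalized (p : ℕ) (f : K _⦋p⦌ → ℝ) (hf : IsNormalized (cochainD p f)) :
    ∃ g : K _⦋p⦌ → ℝ, IsNormalized g ∧ g - f ∈ (Cochains K).Bd p :=
  ⟨_, isNormalized_pullAdd_normP p f, pullAdd_normP_mem_Bd p p f hf⟩

end Normalization

/-! ### Alternating extension of normalized cochains -/

section AlternatingExtension

variable {K : SSet.{u}}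

/-- A monotone tuple of vertices as a morphism of the simplex category. -/
def tupleHom {k : ℕ} (n : SimplexCategory) (i : Fin (k + 1) → Fin (n.len + 1)) (h : Monotone i) :
    ⦋k⦌ ⟶ n :=
  SimplexCategory.Hom.mk (a := ⦋k⦌) (b := n) ⟨i, h⟩

/-- The value of a cochain on the face spanned by a tuple of vertices, if the tuple is monotone. -/
def faceEval {k : ℕ} (f : K _⦋k⦌ → ℝ) (n : SimplexCategory) (σ : K.obj (op n))
    (i : Fin (k + 1) → Fin (n.len + 1)) : ℝ :=
  open Classical in
  if h : Monotone i then f (K.map (tupleHom n i h).op σ) else 0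

theorem faceEval_of_not_monotone {k : ℕ} (f : K _⦋k⦌ → ℝ) (n : SimplexCategory) (σ : K.obj (op n))
    (i : Fin (k + 1) → Fin (n.len + 1)) (h : ¬ Monotone i) : faceEval f n σ i = 0 :=
  dif_neg h

theorem faceEval_monotone {k : ℕ} (f : K _⦋k⦌ → ℝ) (n : SimplexCategory) (σ : K.obj (op n))
    (i : Fin (k + 1) → Fin (n.len + 1)) (h : Monotone i) :
    faceEval f n σ i = f (K.map (tupleHom n i h).op σ) :=
  dif_pos h

theorem faceEval_hom {k : ℕ} (f : K _⦋k⦌ → ℝ) (n : SimplexCategory) (σ : K.obj (op n))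
    (τ : ⦋k⦌ ⟶ n) : faceEval f n σ (fun t => τ t) = f (K.map τ.op σ) := by
  have hm : Monotone fun t => τ t := (SimplexCategory.Hom.toOrderHom τ).monotone
  have h : tupleHom n _ hm = τ := hom_ext_val fun _ => rfl
  rw [faceEval_monotone f n σ _ hm, h]

theorem IsNormalized.faceEval_eq_zero {k : ℕ} {f : K _⦋k⦌ → ℝ} (hf : IsNormalized f)
    (n : SimplexCategory) (σ : K.obj (op n)) (i : Fin (k + 1) → Fin (n.len + 1))
    (hi : ¬ Function.Injective i) : faceEval f n σ i = 0 := by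
  by_cases h : Monotone i
  · rw [faceEval_monotone f n σ i h]
    exact hf _ _ _ hi
  · exact faceEval_of_not_monotone f n σ i h

/-- The alternating extension of a normalized cochain to all tuples of vertices. -/
def extAlt {k : ℕ} (f : K _⦋k⦌ → ℝ) (n : SimplexCategory) (σ : K.obj (op n))
    (i : Fin (k + 1) → Fin (n.len + 1)) : ℝ :=
  ∑ π : Equiv.Perm (Fin (k + 1)), ((Equiv.Perm.sign π : ℤ) : ℝ) * faceEval f n σ (i ∘ π)

theorem not_injective_comp_perm {k : ℕ} {ι : Type*} {i : Fin k → ι} (hi : ¬ Function.Injective i)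
    (π : Equiv.Perm (Fin k)) : ¬ Function.Injective (i ∘ π) :=
  fun h => hi ((Equiv.injective_comp π i).1 h)

theorem IsNormalized.isAlt_extAlt {k : ℕ} {f : K _⦋k⦌ → ℝ} (hf : IsNormalized f)
    (n : SimplexCategory) (σ : K.obj (op n)) : IsAlt (extAlt f n σ) where
  eq_zero i hi := Finset.sum_eq_zero fun π _ => by
    rw [hf.faceEval_eq_zero n σ _ (not_injective_comp_perm hi π), mul_zero]
  perm i ρ := by
    rw [extAlt, extAlt, Finset.mul_sum]
    refine Fintype.sum_equiv (Equiv.mulLeft ρ) _ _ fun π => ?_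
    have h : ((Equiv.Perm.sign ρ : ℤ) : ℝ) * ((Equiv.Perm.sign ρ : ℤ) : ℝ) = 1 := by
      rw [← Int.cast_mul, ← Units.val_mul, Int.units_mul_self]
      simp
    rw [Equiv.coe_mulLeft, Equiv.Perm.sign_mul, Units.val_mul, Int.cast_mul, ← mul_assoc,
      ← mul_assoc, h, one_mul]
    rfl

/-- A strictly increasing tuple stays monotone only under the identity permutation, so a single
summand remains; tuples with repetitions contribute `0` on both sides. -/
theorem IsNormalized.extAlt_monotone {k : ℕ} {f : K _⦋k⦌ → ℝ} (hf : IsNormalized f)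
    (n : SimplexCategory) (σ : K.obj (op n)) (i : Fin (k + 1) → Fin (n.len + 1))
    (hi : Monotone i) : extAlt f n σ i = faceEval f n σ i := by
  by_cases h : Function.Injective i
  · rw [extAlt, Finset.sum_eq_single 1]
    · simp
    · intro π _ hπ
      rw [faceEval_of_not_monotone, mul_zero]
      intro hm
      have hs : StrictMono i := hi.strictMono_of_injective h
      have hπm : Monotone π := fun a b hab => hs.le_iff_le.1 (hm hab)
      have hπs : StrictMono π := hπm.strictMono_of_injective π.injective
      refine hπ (Equiv.ext fun t => ?_)
      exact congrFun ((StrictMono.range_inj hπs strictMono_id).1 (by simp)) t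
    · simp
  · rw [(hf.isAlt_extAlt n σ).eq_zero i h, hf.faceEval_eq_zero n σ i h]

/-- The delicate summands are those where `i ∘ π` is not monotone but its image under `τ` is. Since
`τ` reflects strict inequalities, the image then has a repetition and normalization makes the value
`0`. -/
theorem IsNormalized.extAlt_natural {k : ℕ} {f : K _⦋k⦌ → ℝ} (hf : IsNormalized f)
    (m n : SimplexCategory) (τ : m ⟶ n) (σ : K.obj (op n)) (i : Fin (k + 1) → Fin (m.len + 1)) :
    extAlt f m (K.map τ.op σ) i = extAlt f n σ (fun t => τ (i t)) := by
  refine Finset.sum_congr rfl fun π _ => ?_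
  congr 1
  have hτ : Monotone (fun t => τ t) := (SimplexCategory.Hom.toOrderHom τ).monotone
  by_cases h : Monotone (i ∘ π)
  · rw [faceEval_monotone f m _ _ h, map_op_map_op]
    exact (faceEval_monotone f n σ ((fun t => τ (i t)) ∘ π) (hτ.comp h)).symm
  · rw [faceEval_of_not_monotone f m _ _ h]
    symm
    by_cases h' : Function.Injective fun t => τ (i t)
    · refine faceEval_of_not_monotone f n _ _ fun hm => h fun a b hab => ?_
      rcases hab.eq_or_lt with rfl | hab
      · exact le_rfl
      · exact (hτ.reflect_lt ((hm.strictMono_of_injective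
          (h'.comp π.injective)) hab)).le
    · exact hf.faceEval_eq_zero n σ _ (not_injective_comp_perm h' π)

/-- Deleting an entry keeps a tuple monotone, so on monotone tuples the Čech differential is the
simplicial one. -/
theorem IsNormalized.cech_extAlt {k : ℕ} {f : K _⦋k⦌ → ℝ} (hf : IsNormalized f)
    (n : SimplexCategory) (σ : K.obj (op n)) (i : Fin (k + 2) → Fin (n.len + 1))
    (hi : Monotone i) : cech (extAlt f n σ) i = faceEval (cochainD k f) n σ i := by
  rw [faceEval_monotone _ n σ i hi, cochainD_apply]
  refine Finset.sum_congr rfl fun l _ => ?_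
  have h : Monotone (i ∘ l.succAbove) := hi.comp (Fin.strictMono_succAbove l).monotone
  rw [hf.extAlt_monotone n σ _ h, faceEval_monotone f n σ _ h, map_op_map_op, smul_eq_mul]
  rfl

end AlternatingExtension

/-! ### De Rham's theorem for a simplicial set -/

section SimplicialDeRham

variable {K : SSet.{u}}

theorem cech_vertexInt {k : ℕ} (a : (ADR K).C k) (n : SimplexCategory) (σ : K.obj (op n))
    (i : Fin (k + 2) → Fin (n.len + 1)) :
    cech (vertexInt a n σ) i = vertexInt ((ADR K).d k a) n σ i := by
  change _ = simplexInt (k + 1) (vpull i (Form.d k (a.1 (op n) σ)))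
  rw [vpull_d, simplexInt_d]
  simp only [vpull_comp]
  rfl

/-- By Stokes the integrals of a closed form are a Čech cocycle, and they vanish on degenerate
tuples; `isAlt_of_cech` does the rest. -/
theorem isAlt_vertexInt {k : ℕ} (a : (ADR K).C k) (ha : (ADR K).d k a = 0) (n : SimplexCategory)
    (σ : K.obj (op n)) : IsAlt (vertexInt a n σ) := by
  refine isAlt_of_cech (fun i hi => simplexInt_vpull_of_not_injective i hi _) fun i => ?_
  rw [cech_vertexInt, ha]
  change simplexInt (k + 1) (vpull i 0) = 0
  simp

/-- The integrals of a form over the simplices of `K`, as a function. -/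
def intCochain {k : ℕ} (a : (ADR K).C k) : K _⦋k⦌ → ℝ := integration K k a

theorem vertexInt_eq_intCochain {k : ℕ} (a : (ADR K).C k) (n : SimplexCategory) (τ : ⦋k⦌ ⟶ n)
    (σ : K.obj (op n)) : vertexInt a n σ (fun t => τ t) = intCochain a (K.map τ.op σ) :=
  vertexInt_hom a n τ σ

theorem isNormalized_intCochain {k : ℕ} (a : (ADR K).C k) :
    IsNormalized (intCochain a) := by
  intro n τ σ hτ
  rw [← vertexInt_eq_intCochain]
  exact simplexInt_vpull_of_not_injective _ hτ _

theorem vertexInt_monotone {k : ℕ} (a : (ADR K).C k) (n : SimplexCategory) (σ : K.obj (op n))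
    (i : Fin (k + 1) → Fin (n.len + 1)) (hi : Monotone i) :
    vertexInt a n σ i = faceEval (intCochain a) n σ i := by
  rw [faceEval_monotone _ n σ i hi, ← vertexInt_eq_intCochain]
  rfl

theorem cochainD_intCochain {k : ℕ} (a : (ADR K).C k) :
    cochainD k (intCochain a) = intCochain ((ADR K).d k a) := by
  funext σ
  have h1 := cech_vertexInt a ⦋k + 1⦌ σ id
  have h2 := vertexInt_eq_intCochain ((ADR K).d k a) _ (𝟙 ⦋k + 1⦌) σ
  rw [op_id, K.map_id] at h2
  refine Eq.trans ?_ (h1.trans h2)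
  rw [cochainD_apply]
  refine Finset.sum_congr rfl fun l _ => ?_
  rw [← vertexInt_eq_intCochain]
  rfl

variable (K) in
/-- The integration map as a cochain map. -/
def integrationMap : CochainAlgebra.CochainMap (ADR K) (Cochains K) where
  toFun p :=
    { toFun := integration K p
      map_add' := fun _ _ => funext fun _ => map_add (simplexInt p) _ _
      map_smul' := fun _ _ => funext fun _ => map_smul (simplexInt p) _ _ }
  comm _ a := cochainD_intCochain a

/-- The form on `K` that is associated with a normalized cochain. -/
def formOfCochain {k : ℕ} (f : K _⦋k⦌ → ℝ) (hf : IsNormalized f) : (ADR K).C k :=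
  whitneyFam (add_zero k) (famConst (extAlt f) hf.extAlt_natural)

theorem formOfCochain_apply {k : ℕ} (f : K _⦋k⦌ → ℝ) (hf : IsNormalized f)
    (n : SimplexCategoryᵒᵖ) (σ : K.obj n) : (formOfCochain f hf).1 n σ =
      whitney (add_zero k) fun i => extAlt f n.unop σ i • Form.one := rfl

theorem d_formOfCochain_apply {k : ℕ} (f : K _⦋k⦌ → ℝ) (hf : IsNormalized f)
    (n : SimplexCategoryᵒᵖ) (σ : K.obj n) : ((ADR K).d k (formOfCochain f hf)).1 n σ =
      whitney (add_zero (k + 1)) fun i => cech (extAlt f n.unop σ) i • Form.one :=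
  d_whitney_smul_one _

theorem integration_formOfCochain {k : ℕ} (f : K _⦋k⦌ → ℝ) (hf : IsNormalized f) :
    integration K k (formOfCochain f hf) = f := by
  funext σ
  rw [integration_apply, formOfCochain_apply]
  refine (simplexInt_whitney _ (hf.isAlt_extAlt ⦋k⦌ σ)).trans ?_
  rw [hf.extAlt_monotone _ _ _ monotone_id]
  refine (faceEval_hom f ⦋k⦌ σ (𝟙 _)).trans ?_
  rw [op_id, K.map_id]
  rfl

/-- The Čech differential of an alternating function is alternating, so it suffices that it vanishes
on monotone tuples, where it is the simplicial differential. -/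
theorem d_formOfCochain {k : ℕ} (f : K _⦋k⦌ → ℝ) (hf : IsNormalized f)
    (h : cochainD k f = 0) : (ADR K).d k (formOfCochain f hf) = 0 := by
  refine ADRForm.ext fun n σ => ?_
  rw [d_formOfCochain_apply]
  have h1 : cech (extAlt f n.unop σ) = fun _ => 0 := by
    refine (hf.isAlt_extAlt n.unop σ).cech.ext ⟨fun _ _ => rfl, fun _ _ => by simp⟩ fun i hi => ?_
    rw [hf.cech_extAlt _ _ _ hi, h, faceEval_monotone _ _ _ _ hi]
    rfl
  rw [h1]
  simp only [whitney, zero_smul, map_zero, Finset.sum_const_zero]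
  rfl

theorem cochainD_of_mem_Bd {k : ℕ} {f : K _⦋k⦌ → ℝ} (hf : f ∈ (Cochains K).Bd k) :
    cochainD k f = 0 := by
  cases k with
  | zero =>
    have h : f = 0 := hf
    rw [h, map_zero]
  | succ n =>
    obtain ⟨b, rfl⟩ := hf
    exact cochainD_cochainD n b

theorem cochainD_eq_of_sub_mem_Bd {k : ℕ} {f g : K _⦋k⦌ → ℝ} (h : g - f ∈ (Cochains K).Bd k) :
    cochainD k g = cochainD k f := by
  have h1 := cochainD_of_mem_Bd h
  rwa [map_sub, sub_eq_zero] at h1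

theorem integration_surjective {k : ℕ} (f : (Cochains K).C k) (hf : (Cochains K).d k f = 0) :
    ∃ a : (ADR K).C k, (ADR K).d k a = 0 ∧ integration K k a - f ∈ (Cochains K).Bd k := by
  obtain ⟨g, hg, hgf⟩ := exists_isNormalized k f (fun n τ σ _ => congrFun hf _)
  have hg0 : cochainD k g = 0 := (cochainD_eq_of_sub_mem_Bd hgf).trans hf
  refine ⟨formOfCochain g hg, d_formOfCochain g hg hg0, ?_⟩
  rw [integration_formOfCochain]
  exact hgf

/-- Up to a coboundary, `a` is the Whitney form of its integrals. A normalized primitive of the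
integration cochain has a Whitney form whose differential is exactly that form. -/
theorem integration_injective {k : ℕ} (a : (ADR K).C k) (ha : (ADR K).d k a = 0)
    (h : integration K k a ∈ (Cochains K).Bd k) : a ∈ (ADR K).Bd k := by
  have h1 := sub_whitneyFam_mem_Bd a ha
  suffices h2 : whitneyFam (add_zero k) (famConst (vertexInt a) (vertexInt_natural a)) ∈
      (ADR K).Bd k by
    have := Submodule.add_mem _ h1 h2
    rwa [sub_add_cancel] at this
  cases k with
  | zero =>
    have h0 : intCochain a = 0 := h
    refine ADRForm.ext fun n σ => ?_
    change (whitney _ fun i => vertexInt a n.unop σ i • Form.one) = 0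
    have h3 : vertexInt a n.unop σ = fun _ => 0 := by
      refine (isAlt_vertexInt a ha n.unop σ).ext ⟨fun _ _ => rfl, fun _ _ => by simp⟩ fun i hi => ?_
      rw [vertexInt_monotone a _ _ _ hi, h0, faceEval_monotone _ _ _ _ hi]
      rfl
    rw [h3]
    simp only [whitney, zero_smul, map_zero, Finset.sum_const_zero]
  | succ k =>
    obtain ⟨g, hg⟩ := h
    have hg' : cochainD k g = intCochain a := hg
    -- The differential of `g` is an integration cochain, hence normalized, so `g` can be replaced
    -- by a normalized cochain with the same differential.
    obtain ⟨g', hn, hgg'⟩ := exists_isNormalized k g (hg' ▸ isNormalized_intCochain a)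
    have hg0 : cochainD k g' = intCochain a := (cochainD_eq_of_sub_mem_Bd hgg').trans hg
    refine ⟨formOfCochain g' hn, ADRForm.ext fun n σ => ?_⟩
    rw [d_formOfCochain_apply]
    have h3 : cech (extAlt g' n.unop σ) = vertexInt a n.unop σ := by
      refine (hn.isAlt_extAlt n.unop σ).cech.ext (isAlt_vertexInt a ha n.unop σ) fun i hi => ?_
      rw [hn.cech_extAlt _ _ _ hi, hg0, vertexInt_monotone a _ _ _ hi]
    rw [h3]
    rfl

theorem integration_one : integration K 0 (ADR K).one = (Cochains K).one := by
  funext σ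
  rw [integration_apply, simplexInt_zero]
  exact Form.eval_one _

end SimplicialDeRham

/-! ### A criterion on cocycles for algebra isomorphisms -/

section Criterion

variable {A B C : CochainAlgebra.{u}}

theorem cls_eq_iff {n : ℕ} {a b : A.Z n} :
    CochainAlgebra.cls a = CochainAlgebra.cls b ↔ (a : A.C n) - b ∈ A.Bd n :=
  Submodule.Quotient.eq _

theorem inducesAlgebraIso_of (F : CochainAlgebra.CochainMap A B)
    (hinj : ∀ n a, A.d n a = 0 → F.toFun n a ∈ B.Bd n → a ∈ A.Bd n)
    (hsurj : ∀ n b, B.d n b = 0 → ∃ a, A.d n a = 0 ∧ F.toFun n a - b ∈ B.Bd n)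
    (hmul : ∀ {p q n : ℕ} (h : p + q = n) a b, A.d p a = 0 → A.d q b = 0 →
      F.toFun n (A.mul h a b) - B.mul h (F.toFun p a) (F.toFun q b) ∈ B.Bd n)
    (hone : F.toFun 0 A.one = B.one) : F.InducesAlgebraIso where
  bijective n := by
    constructor
    · rw [injective_iff_map_eq_zero]
      intro x hx
      obtain ⟨a, rfl⟩ := Submodule.Quotient.mk_surjective _ x
      refine (Submodule.Quotient.mk_eq_zero _).2 (hinj n a.1 a.2 ?_)
      have h0 : CochainAlgebra.cls (A := B) ⟨F.toFun n a.1, by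
          rw [CochainAlgebra.mem_Z, F.comm, CochainAlgebra.mem_Z.1 a.2, map_zero]⟩ =
          CochainAlgebra.cls 0 := hx
      have h1 := cls_eq_iff.1 h0
      rwa [Submodule.coe_zero, sub_zero] at h1
    · intro y
      obtain ⟨b, rfl⟩ := Submodule.Quotient.mk_surjective _ y
      obtain ⟨a, ha, hab⟩ := hsurj n b.1 b.2
      exact ⟨CochainAlgebra.cls ⟨a, ha⟩, cls_eq_iff.2 hab⟩
  map_mul h x y := by
    obtain ⟨a, rfl⟩ := Submodule.Quotient.mk_surjective _ x
    obtain ⟨b, rfl⟩ := Submodule.Quotient.mk_surjective _ y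
    exact cls_eq_iff.2 (hmul h a.1 b.1 a.2 b.2)
  map_one := congrArg CochainAlgebra.cls (Subtype.ext hone)

end Criterion

/-! ### Chain maps from maps that respect only the faces -/

section PresimplicialMaps

variable {K L M : SSet.{u}}

/-- The morphism of chain complexes induced by a family of maps that commutes with the faces. -/
def faceChainMap (f : ∀ n : ℕ, K _⦋n⦌ → L _⦋n⦌)
    (hf : ∀ (n : ℕ) (i : Fin (n + 2)) (σ : K _⦋n + 1⦌),
      f n (K.map (SimplexCategory.δ i).op σ) = L.map (SimplexCategory.δ i).op (f (n + 1) σ)) :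
    chains.obj K ⟶ chains.obj L where
  f n := AddCommGrpCat.ofHom (FreeAbelianGroup.map (f n))
  comm' m n hmn := by
    obtain rfl : n + 1 = m := hmn
    refine AddCommGrpCat.hom_ext ?_
    change (chainD L n).comp (FreeAbelianGroup.map (f (n + 1))) =
      (FreeAbelianGroup.map (f n)).comp (chainD K n)
    refine FreeAbelianGroup.lift_ext _ _ fun σ => ?_
    rw [AddMonoidHom.comp_apply, AddMonoidHom.comp_apply, FreeAbelianGroup.map_of_apply,
      chainD_of, chainD_of, map_sum]
    refine Finset.sum_congr rfl fun i _ => ?_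
    rw [map_zsmul, FreeAbelianGroup.map_of_apply, hf]

theorem chains_hom_ext {k l : chains.obj K ⟶ chains.obj L}
    (h : ∀ (n : ℕ) (σ : K _⦋n⦌), chainF k n (FreeAbelianGroup.of σ) =
      chainF l n (FreeAbelianGroup.of σ)) : k = l := by
  refine HomologicalComplex.hom_ext _ _ fun n => AddCommGrpCat.hom_ext ?_
  exact FreeAbelianGroup.lift_ext _ _ (h n)

/-- Homotopic maps of simplicial sets induce homotopic maps of chain complexes. -/
def chainsHomotopy {f g : K ⟶ L} (H : SSet.Homotopy f g) :
    Homotopy (chains.map f) (chains.map g) :=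
  (H.toSimplicialObjectHomotopy.whiskerRight AddCommGrpCat.free).toChainHomotopy

end PresimplicialMaps

/-! ### Chain homotopies from smooth homotopies of models -/

section CosimplicialModels

/-- A cosimplicial diffeological space in which every constant map `[n] → [1]` induces a constant
map. -/
structure CosimplicialModel where
  obj : SimplexCategory → Type
  diffeology : ∀ n, DiffeologicalSpace (obj n)
  map {m n : SimplexCategory} : (m ⟶ n) → obj m → obj n
  dSmooth_map {m n : SimplexCategory} (τ : m ⟶ n) : DSmooth (map τ)
  map_id (n : SimplexCategory) (x : obj n) : map (𝟙 n) x = x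
  map_comp {l m n : SimplexCategory} (τ : l ⟶ m) (ρ : m ⟶ n) (x : obj l) :
    map (τ ≫ ρ) x = map ρ (map τ x)
  vertex : Fin 2 → obj ⦋1⦌
  map_eq_vertex {n : SimplexCategory} (τ : n ⟶ ⦋1⦌) (e : Fin 2) (h : ∀ t, τ t = e) (x : obj n) :
    map τ x = vertex e

attribute [instance] CosimplicialModel.diffeology

namespace CosimplicialModel

variable (D : CosimplicialModel) (X : Type u) [DiffeologicalSpace X]

/-- The simplicial set of smooth maps from the objects of a cosimplicial model to `X`. -/
def sing : SSet.{u} where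
  obj n := {σ : D.obj n.unop → X // DSmooth σ}
  map τ := ↾fun σ => ⟨σ.1 ∘ D.map τ.unop, σ.2.comp (D.dSmooth_map _)⟩
  map_id n := by
    refine ConcreteCategory.hom_ext _ _ fun σ => ?_
    exact Subtype.ext (funext fun x => congrArg σ.1 (D.map_id _ x))
  map_comp τ ρ := by
    refine ConcreteCategory.hom_ext _ _ fun σ => ?_
    exact Subtype.ext (funext fun x => congrArg σ.1 (D.map_comp _ _ x))

/-- Smoothness of a map of two variables. -/
def DSmooth₂ {A B Y : Type*} [DiffeologicalSpace A] [DiffeologicalSpace B] [DiffeologicalSpace Y]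
    (f : A → B → Y) : Prop :=
  ∀ (n : ℕ) (p : EuclideanSpace ℝ (Fin n) → A) (q : EuclideanSpace ℝ (Fin n) → B),
    IsPlot p → IsPlot q → IsPlot fun y => f (p y) (q y)

/-- The simplicial set of smooth homotopies between singular simplices. -/
def path : SSet.{u} where
  obj n := {σ : D.obj n.unop → D.obj ⦋1⦌ → X // DSmooth₂ σ}
  map τ := ↾fun σ => ⟨fun x => σ.1 (D.map τ.unop x),
    fun n p q hp hq => σ.2 n _ q (D.dSmooth_map τ.unop n p hp) hq⟩
  map_id n := by
    refine ConcreteCategory.hom_ext _ _ fun σ => ?_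
    exact Subtype.ext (funext fun x => congrArg σ.1 (D.map_id _ x))
  map_comp τ ρ := by
    refine ConcreteCategory.hom_ext _ _ fun σ => ?_
    exact Subtype.ext (funext fun x => congrArg σ.1 (D.map_comp _ _ x))

/-- Evaluation of homotopies at a point. -/
def evalPath (e : Fin 2) : D.path X ⟶ D.sing X where
  app _ := ↾fun σ => ⟨fun x => σ.1 x (D.vertex e), fun k p hp => σ.2 k p _ hp isPlot_const⟩
  naturality _ _ _ := rfl

open MonoidalCategory in
/-- The simplicial homotopy between the two evaluations. -/
def evalHomotopy : SSet.Homotopy (D.evalPath X 0) (D.evalPath X 1) where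
  h :=
    -- An `n`-simplex of the interval is an operator `τ : [n] → [1]`; it sends the homotopy `σ` to
    -- the simplex `x ↦ σ(x, τ_* x)`.
    { app := fun n => ↾fun z => ⟨fun x => z.1.1 x (D.map (SSet.stdSimplex.objEquiv z.2) x),
        fun k p hp => z.1.2 k p _ hp (D.dSmooth_map _ k p hp)⟩
      naturality := fun n m τ => by
        refine ConcreteCategory.hom_ext _ _ fun z => Subtype.ext (funext fun x => ?_)
        exact congrArg (z.1.1 (D.map τ.unop x))
          (D.map_comp τ.unop (SSet.stdSimplex.objEquiv z.2) x) }
  h₀ := by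
    refine NatTrans.ext (funext fun n => ConcreteCategory.hom_ext _ _ fun z =>
      Subtype.ext (funext fun x => ?_))
    exact congrArg (z.1 x) (D.map_eq_vertex _ 0 (fun _ => rfl) x)
  h₁ := by
    refine NatTrans.ext (funext fun n => ConcreteCategory.hom_ext _ _ fun z =>
      Subtype.ext (funext fun x => ?_))
    exact congrArg (z.1 x) (D.map_eq_vertex _ 1 (fun _ => rfl) x)
  rel := by
    refine NatTrans.ext (funext fun n => ConcreteCategory.hom_ext _ _ fun z => ?_)
    exact z.1.2.elim

variable {D}

/-- A family of self-maps, compatible with the faces and smoothly contractible to the identity by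
homotopies compatible with the faces, induces a chain map homotopic to the identity. -/
theorem exists_homotopy_id (H : ∀ n : ℕ, D.obj ⦋n⦌ → D.obj ⦋1⦌ → D.obj ⦋n⦌)
    (hH : ∀ n, DSmooth₂ (H n))
    (hδ : ∀ (n : ℕ) (i : Fin (n + 2)) x t, D.map (SimplexCategory.δ i) (H n x t) =
      H (n + 1) (D.map (SimplexCategory.δ i) x) t)
    (h0 : ∀ n x, H n x (D.vertex 0) = x)
    (k : chains.obj (D.sing X) ⟶ chains.obj (D.sing X))
    (hk : ∀ (n : ℕ) (σ τ : (D.sing X) _⦋n⦌), (∀ x, τ.1 x = σ.1 (H n x (D.vertex 1))) →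
      chainF k n (FreeAbelianGroup.of σ) = FreeAbelianGroup.of τ) :
    Nonempty (Homotopy k (𝟙 (chains.obj (D.sing X)))) := by
  -- The homotopies respect only faces, so `c` exists only on chains. Composing it with the
  -- simplicial homotopy between the two evaluations gives the result.
  let c : chains.obj (D.sing X) ⟶ chains.obj (D.path X) :=
    faceChainMap (fun n σ => ⟨fun x t => σ.1 (H n x t),
      fun m p q hp hq => σ.2 m _ (hH n m p q hp hq)⟩) fun n i σ =>
        Subtype.ext (funext fun x => funext fun t => congrArg σ.1 (hδ n i x t))
  have e0 : c ≫ chains.map (D.evalPath X 0) = 𝟙 _ := chains_hom_ext fun n σ =>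
    congrArg FreeAbelianGroup.of (Subtype.ext (funext fun x => congrArg σ.1 (h0 n x)))
  have e1 : c ≫ chains.map (D.evalPath X 1) = k := chains_hom_ext fun n σ =>
    (hk n σ ((D.evalPath X 1).app _ _) fun x => rfl).symm
  have h := (chainsHomotopy (D.evalHomotopy X)).compLeft c
  rw [e0, e1] at h
  exact ⟨h.symm⟩

end CosimplicialModel

end CosimplicialModels

/-! ### The smooth map `𝔸ⁿ → Δⁿ` and the homotopy inverse of the restriction -/

section Retraction

/-- The sum of the numbers `expNegInvGlue xᵢ`, where `x` is a point of `𝔸ⁿ`. -/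
def retractDenom {n : ℕ} (x : affineSpace n) : ℝ := ∑ i, expNegInvGlue (x.1 i)

theorem retractDenom_pos {n : ℕ} (x : affineSpace n) : 0 < retractDenom x := by
  obtain ⟨i, -, hi⟩ : ∃ i ∈ Finset.univ, 0 < x.1 i := by
    refine Finset.exists_lt_of_sum_lt (f := fun _ => (0 : ℝ)) ?_
    have h : ∑ i, x.1 i = 1 := x.2
    simp [h]
  exact Finset.sum_pos' (fun i _ => expNegInvGlue.nonneg _)
    ⟨i, Finset.mem_univ _, expNegInvGlue.pos_of_pos hi⟩

/-- The smooth map `𝔸ⁿ → Δⁿ` given by normalizing the coordinates `expNegInvGlue xᵢ`. -/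
def retract (n : ℕ) (x : affineSpace n) : simplexSub n :=
  ⟨⟨WithLp.toLp 2 fun i => expNegInvGlue (x.1 i) / retractDenom x, by
    change ∑ i, expNegInvGlue (x.1 i) / retractDenom x = 1
    rw [← Finset.sum_div]
    exact div_self (retractDenom_pos x).ne'⟩,
    fun _ => div_nonneg (expNegInvGlue.nonneg _) (retractDenom_pos x).le⟩

theorem retract_apply {n : ℕ} (x : affineSpace n) (i : Fin (n + 1)) :
    (retract n x).1.1 i = expNegInvGlue (x.1 i) / retractDenom x := rfl

theorem isPlot_affineSpace {n k : ℕ} {p : EuclideanSpace ℝ (Fin k) → affineSpace n} :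
    IsPlot p ↔ ∀ i, ContDiff ℝ ∞ fun y => (p y).1 i :=
  ⟨fun hp => contDiff_euclidean.1 (IsPlot.contDiff hp : ContDiff ℝ ∞ (Subtype.val ∘ p)),
    fun hp => (contDiff_euclidean.2 hp : ContDiff ℝ ∞ (Subtype.val ∘ p)).isPlot⟩

theorem dSmooth_retract (n : ℕ) : DSmooth (retract n) := by
  intro k p hp
  have hp' := isPlot_affineSpace.1 hp
  suffices h : IsPlot fun y => (retract n (p y)).1 from h
  refine isPlot_affineSpace.2 fun i => ?_
  have h : ∀ i, ContDiff ℝ ∞ fun y => expNegInvGlue ((p y).1 i) :=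
    fun i => expNegInvGlue.contDiff.comp (hp' i)
  exact (h i).div (ContDiff.sum fun i _ => h i) fun y => (retractDenom_pos (p y)).ne'

theorem affineMap_apply {m n : SimplexCategory} (τ : m ⟶ n) (x : affineSpace m.len)
    (j : Fin (n.len + 1)) : (affineMap τ x).1 j = ∑ i with τ i = j, x.1 i := rfl

/-- For injective `τ` each fibre has at most one element, and the empty fibre is covered by
`expNegInvGlue 0 = 0`. Larger fibres would require additivity, hence the restriction to injective
operators. -/
theorem expNegInvGlue_affineMap {m n : SimplexCategory} (τ : m ⟶ n)
    (hτ : Function.Injective fun t => τ t) (x : affineSpace m.len) (j : Fin (n.len + 1)) :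
    expNegInvGlue ((affineMap τ x).1 j) = ∑ i with τ i = j, expNegInvGlue (x.1 i) := by
  rw [affineMap_apply]
  by_cases h : ∃ i, τ i = j
  · obtain ⟨i, rfl⟩ := h
    have : (Finset.univ.filter fun i' => τ i' = τ i) = {i} := by
      ext i'
      simpa using hτ.eq_iff (a := i') (b := i)
    rw [this, Finset.sum_singleton, Finset.sum_singleton]
  · have : (Finset.univ.filter fun i' => τ i' = j) = ∅ :=
      Finset.filter_eq_empty_iff.2 fun i _ hi => h ⟨i, hi⟩
    rw [this, Finset.sum_empty, Finset.sum_empty, expNegInvGlue.zero]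

theorem retract_affineMap {m n : SimplexCategory} (τ : m ⟶ n)
    (hτ : Function.Injective fun t => τ t) (x : affineSpace m.len) :
    retract n.len (affineMap τ x) = simplexMap τ (retract m.len x) := by
  have hd : retractDenom (affineMap τ x) = retractDenom x := by
    rw [retractDenom, Finset.sum_congr rfl fun j _ => expNegInvGlue_affineMap τ hτ x j]
    exact Finset.sum_fiberwise _ _ _
  refine Subtype.ext (Subtype.ext (PiLp.ext fun j => ?_))
  rw [retract_apply, hd, expNegInvGlue_affineMap τ hτ, Finset.sum_div]
  rfl

/-- The straight line homotopy between the points `x` and `y` of `𝔸ⁿ`, parametrized by `𝔸¹`. -/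
def segment {n : ℕ} (x y : affineSpace n) (t : affineSpace 1) : affineSpace n :=
  ⟨t.1 0 • x.1 + t.1 1 • y.1, by
    have hx : ∑ i, x.1 i = 1 := x.2
    have hy : ∑ i, y.1 i = 1 := y.2
    have ht : ∑ i, t.1 i = 1 := t.2
    change ∑ i, (t.1 0 * x.1 i + t.1 1 * y.1 i) = 1
    rw [Finset.sum_add_distrib, ← Finset.mul_sum, ← Finset.mul_sum, hx, hy,
      mul_one, mul_one, ← ht, Fin.sum_univ_two]⟩

theorem segment_apply {n : ℕ} (x y : affineSpace n) (t : affineSpace 1) (i : Fin (n + 1)) :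
    (segment x y t).1 i = t.1 0 * x.1 i + t.1 1 * y.1 i := rfl

theorem affineMap_segment {m n : SimplexCategory} (τ : m ⟶ n) (x y : affineSpace m.len)
    (t : affineSpace 1) :
    affineMap τ (segment x y t) = segment (affineMap τ x) (affineMap τ y) t := by
  refine Subtype.ext (PiLp.ext fun j => ?_)
  simp only [affineMap_apply, segment_apply, Finset.sum_add_distrib, Finset.mul_sum]

/-- The vertices of `𝔸¹`. -/
def edgeVertex (e : Fin 2) : affineSpace 1 :=
  ⟨WithLp.toLp 2 fun i => if i = e then 1 else 0, by
    change ∑ i : Fin 2, (if i = e then 1 else 0 : ℝ) = 1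
    simp⟩

theorem edgeVertex_apply (e i : Fin 2) : (edgeVertex e).1 i = if i = e then 1 else 0 := rfl

theorem affineMap_eq_edgeVertex {n : SimplexCategory} (τ : n ⟶ ⦋1⦌) (e : Fin 2)
    (h : ∀ t, τ t = e) (x : affineSpace n.len) : affineMap τ x = edgeVertex e := by
  refine Subtype.ext (PiLp.ext fun j => ?_)
  rw [affineMap_apply]
  simp only [h]
  by_cases hj : j = e
  · subst hj
    have hx : ∑ i, x.1 i = 1 := x.2
    simpa [edgeVertex_apply] using hx
  · have hj' : ¬ e = j := fun h => hj h.symm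
    simp [edgeVertex_apply, hj, hj']

theorem segment_zero {n : ℕ} (x y : affineSpace n) : segment x y (edgeVertex 0) = x :=
  Subtype.ext (PiLp.ext fun j => by simp [segment_apply, edgeVertex_apply])

theorem segment_one {n : ℕ} (x y : affineSpace n) : segment x y (edgeVertex 1) = y :=
  Subtype.ext (PiLp.ext fun j => by simp [segment_apply, edgeVertex_apply])

theorem isPlot_segment {n k : ℕ} {p q : EuclideanSpace ℝ (Fin k) → affineSpace n}
    {t : EuclideanSpace ℝ (Fin k) → affineSpace 1} (hp : IsPlot p) (hq : IsPlot q)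
    (ht : IsPlot t) : IsPlot fun y => segment (p y) (q y) (t y) :=
  isPlot_affineSpace.2 fun i =>
    ((isPlot_affineSpace.1 ht 0).mul (isPlot_affineSpace.1 hp i)).add
      ((isPlot_affineSpace.1 ht 1).mul (isPlot_affineSpace.1 hq i))

/-- The cosimplicial space `𝔸^•`. -/
def affineModel : CosimplicialModel where
  obj n := affineSpace n.len
  diffeology _ := inferInstance
  map := affineMap
  dSmooth_map := affineMap_dSmooth
  map_id := affineMap_id
  map_comp := affineMap_comp
  vertex := edgeVertex
  map_eq_vertex := affineMap_eq_edgeVertex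

/-- The cosimplicial space `Δ^•_sub`. -/
def simplexModel : CosimplicialModel where
  obj n := simplexSub n.len
  diffeology _ := inferInstance
  map := simplexMap
  dSmooth_map := simplexMap_dSmooth
  map_id n x := Subtype.ext (affineMap_id n x.1)
  map_comp τ ρ x := Subtype.ext (affineMap_comp τ ρ x.1)
  vertex e := ⟨edgeVertex e, fun i => by
    rw [edgeVertex_apply]
    split_ifs <;> simp⟩
  map_eq_vertex τ e h x := Subtype.ext (affineMap_eq_edgeVertex τ e h x.1)

theorem δ_injective {n : ℕ} (i : Fin (n + 2)) :
    Function.Injective fun t : Fin (n + 1) => SimplexCategory.δ i t :=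
  Fin.succAbove_right_injective

variable (X : Type u) [DiffeologicalSpace X]

/-- The chain map `ℤS^D_•(X)_sub → ℤS^D_•(X)` induced by the retractions `𝔸ⁿ → Δⁿ`. -/
def extension : chains.obj (SDsub X) ⟶ chains.obj (SD X) :=
  faceChainMap (fun n σ => ⟨σ.1 ∘ retract n, σ.2.comp (dSmooth_retract n)⟩) fun _ i σ =>
    Subtype.ext (funext fun x => congrArg σ.1
      (retract_affineMap (SimplexCategory.δ i) (δ_injective i) x).symm)

theorem exists_homotopy_restriction_extension :
    Nonempty (Homotopy (chains.map (restriction X) ≫ extension X) (𝟙 (chains.obj (SD X)))) := by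
  refine CosimplicialModel.exists_homotopy_id (D := affineModel) X
    (fun n x t => segment x (retract n x).1 t) (fun n m p q hp hq => ?_) (fun n i x t => ?_)
    (fun n x => segment_zero _ _) _ (fun n σ τ h => ?_)
  · exact isPlot_segment hp (dSmooth_retract n m p hp) hq
  · refine (affineMap_segment _ _ _ _).trans ?_
    exact congrArg (fun z => segment _ z t) (congrArg Subtype.val
      (retract_affineMap (SimplexCategory.δ i) (δ_injective i) x).symm)
  · refine congrArg FreeAbelianGroup.of (Subtype.ext (funext fun x => ?_))
    exact ((h x).trans (congrArg σ.1 (segment_one _ _))).symm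

/-- The segments used on `𝔸ⁿ` stay in `Δⁿ`, by convexity, when both the point and the parameter lie
in simplices. -/
theorem exists_homotopy_extension_restriction :
    Nonempty (Homotopy (extension X ≫ chains.map (restriction X)) (𝟙 (chains.obj (SDsub X)))) := by
  refine CosimplicialModel.exists_homotopy_id (D := simplexModel) X
    (fun n x t => ⟨segment x.1 (retract n x.1).1 t.1, fun i => ?_⟩)
    (fun n m p q hp hq => ?_) (fun n i x t => ?_)
    (fun n x => Subtype.ext (segment_zero _ _)) _ (fun n σ τ h => ?_)
  · exact add_nonneg (mul_nonneg (t.2 0) (x.2 i)) (mul_nonneg (t.2 1) ((retract n x.1).2 i))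
  · exact isPlot_segment (p := fun y => (p y).1) hp
      (dSmooth_retract n m (fun y => (p y).1) hp) hq
  · refine Subtype.ext ((affineMap_segment _ _ _ _).trans ?_)
    exact congrArg (fun z => segment _ z t.1) (congrArg Subtype.val
      (retract_affineMap (SimplexCategory.δ i) (δ_injective i) x.1).symm)
  · refine congrArg FreeAbelianGroup.of (Subtype.ext (funext fun x => ?_))
    exact ((h x).trans (congrArg σ.1 (Subtype.ext (segment_one _ _)))).symm

theorem nonempty_restrictionEquiv : Nonempty (RestrictionEquiv X) := by
  obtain ⟨h⟩ := exists_homotopy_restriction_extension X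
  obtain ⟨h'⟩ := exists_homotopy_extension_restriction X
  exact ⟨⟨⟨chains.map (restriction X), extension X, h, h'⟩, rfl⟩⟩

end Retraction

/-! ### Homotopy inverses of multiplicative cochain maps -/

section AlgebraIso

variable {A B C : CochainAlgebra.{u}}

theorem map_mem_Bd (F : CochainAlgebra.CochainMap A B) {n : ℕ} {a : A.C n} (ha : a ∈ A.Bd n) :
    F.toFun n a ∈ B.Bd n := by
  cases n with
  | zero =>
    obtain rfl : a = 0 := ha
    rw [map_zero]
    exact Submodule.zero_mem _
  | succ n =>
    obtain ⟨b, rfl⟩ := ha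
    exact ⟨F.toFun n b, F.comm n b⟩

theorem map_d_eq_zero (F : CochainAlgebra.CochainMap A B) {n : ℕ} {a : A.C n} (ha : A.d n a = 0) :
    B.d n (F.toFun n a) = 0 := by
  rw [F.comm, ha, map_zero]

theorem mul_sub_mul_mem_Bd {p q n : ℕ} (h : p + q = n) {a a' : A.C p} {b b' : A.C q}
    (ha : A.d p a = 0) (ha' : A.d p a' = 0) (hb : A.d q b = 0) (hb' : A.d q b' = 0)
    (haa : a - a' ∈ A.Bd p) (hbb : b - b' ∈ A.Bd q) :
    A.mul h a b - A.mul h a' b' ∈ A.Bd n := by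
  have h1 : CochainAlgebra.cls (A := A) ⟨a, ha⟩ = CochainAlgebra.cls ⟨a', ha'⟩ := cls_eq_iff.2 haa
  have h2 : CochainAlgebra.cls (A := A) ⟨b, hb⟩ = CochainAlgebra.cls ⟨b', hb'⟩ := cls_eq_iff.2 hbb
  exact cls_eq_iff.1 (congrArg₂ (fun x y => CochainAlgebra.mulH h x y) h1 h2)

/-- The composition of two cochain maps. -/
def compMap (G : CochainAlgebra.CochainMap B C) (F : CochainAlgebra.CochainMap A B) :
    CochainAlgebra.CochainMap A C where
  toFun n := G.toFun n ∘ₗ F.toFun n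
  comm n a := (G.comm n _).trans (congrArg (G.toFun (n + 1)) (F.comm n a))

theorem mapH_compMap (G : CochainAlgebra.CochainMap B C) (F : CochainAlgebra.CochainMap A B)
    (n : ℕ) (x : A.H n) : (compMap G F).mapH n x = G.mapH n (F.mapH n x) := by
  obtain ⟨a, rfl⟩ := Submodule.Quotient.mk_surjective _ x
  rfl

theorem inducesAlgebraIso_compMap {G : CochainAlgebra.CochainMap B C}
    {F : CochainAlgebra.CochainMap A B} (hG : G.InducesAlgebraIso) (hF : F.InducesAlgebraIso) :
    (compMap G F).InducesAlgebraIso where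
  bijective n := by
    rw [show ⇑((compMap G F).mapH n) = G.mapH n ∘ F.mapH n from funext (mapH_compMap G F n)]
    exact (hG.bijective n).comp (hF.bijective n)
  map_mul h x y := by
    rw [mapH_compMap, mapH_compMap, mapH_compMap, hF.map_mul, hG.map_mul]
  map_one := by rw [mapH_compMap, hF.map_one, hG.map_one]

/-- An inverse up to homotopy of a morphism of cochain algebras induces an isomorphism of algebras
on cohomology. -/
theorem inducesAlgebraIso_of_homotopyInverse (G : CochainAlgebra.CochainMap A B)
    (R : CochainAlgebra.CochainMap B A)
    (hRG : ∀ n a, A.d n a = 0 → R.toFun n (G.toFun n a) - a ∈ A.Bd n)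
    (hGR : ∀ n b, B.d n b = 0 → G.toFun n (R.toFun n b) - b ∈ B.Bd n)
    (hmul : ∀ {p q n : ℕ} (h : p + q = n) a b,
      R.toFun n (B.mul h a b) = A.mul h (R.toFun p a) (R.toFun q b))
    (hone : R.toFun 0 B.one = A.one) (hd : B.d 0 B.one = 0) : G.InducesAlgebraIso := by
  refine inducesAlgebraIso_of G (fun n a ha h => ?_) (fun n b hb => ?_)
    (fun {p q n} h a b ha hb => ?_) ?_
  · have h1 := Submodule.sub_mem _ (map_mem_Bd R h) (hRG n a ha)
    rwa [sub_sub_cancel] at h1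
  · exact ⟨R.toFun n b, map_d_eq_zero R hb, hGR n b hb⟩
  · have ha' := map_d_eq_zero G ha
    have hb' := map_d_eq_zero G hb
    have hab : B.d n (B.mul h (G.toFun p a) (G.toFun q b)) = 0 := by
      rw [B.leibniz h (by omega) (by omega), ha', hb']
      simp
    -- Up to coboundaries, `G a * G b` is `G (R (G a * G b)) = G (R (G a) * R (G b))`, and the
    -- product inside is cohomologous to `a * b`.
    have h1 := hGR n _ hab
    rw [hmul] at h1
    have h2 := map_mem_Bd G (mul_sub_mul_mem_Bd h (map_d_eq_zero R ha') ha (map_d_eq_zero R hb') hb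
      (hRG p a ha) (hRG q b hb))
    rw [map_sub] at h2
    have h3 := Submodule.sub_mem _ h1 h2
    rwa [sub_sub_sub_cancel_left] at h3
  · have h1 := hGR 0 _ hd
    rw [hone] at h1
    exact sub_eq_zero.1 h1

end AlgebraIso

/-! ### Assembly of the two isomorphisms -/

section Conclusion

theorem inducesAlgebraIso_integrationMap (K : SSet.{u}) :
    (integrationMap K).InducesAlgebraIso :=
  inducesAlgebraIso_of _ (fun _ a ha h => integration_injective a ha h)
    (fun _ f hf => integration_surjective f hf)
    (fun h a b ha hb => integration_mul_sub_mem_Bd h a b ha hb) integration_one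

variable {K L : SSet.{u}}

theorem pullMap_map_apply (f : K ⟶ L) (p : ℕ) (g : L _⦋p⦌ → ℝ) (σ : K _⦋p⦌) :
    (pullMap (chains.map f)).toFun p g σ = g (f.app _ σ) :=
  FreeAbelianGroup.lift_apply_of _ _

/-- Simplicial maps commute with passage to front and back faces, so the product is preserved
already on cochains. This is what makes homotopy inverses multiplicative on cohomology. -/
theorem pullMap_map_mul (f : K ⟶ L) {p q n : ℕ} (h : p + q = n) (a : (Cochains L).C p)
    (b : (Cochains L).C q) :
    (pullMap (chains.map f)).toFun n ((Cochains L).mul h a b) =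
      (Cochains K).mul h ((pullMap (chains.map f)).toFun p a)
        ((pullMap (chains.map f)).toFun q b) := by
  funext σ
  refine (pullMap_map_apply f n _ σ).trans ?_
  refine (cup_apply h a b _).trans (Eq.trans ?_ (cup_apply h _ _ σ).symm)
  refine Eq.trans ?_ (congrArg₂ (· * ·) (pullMap_map_apply f p a _).symm
    (pullMap_map_apply f q b _).symm)
  exact congrArg₂ (fun x y => a x * b y) (NatTrans.naturality_apply f _ σ).symm
    (NatTrans.naturality_apply f _ σ).symm

theorem cochainD_one : (Cochains K).d 0 (Cochains K).one = 0 := by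
  funext σ
  refine (cochainD_apply (n := 0) (fun _ => 1) σ).trans ?_
  rw [Fin.sum_univ_two]
  norm_num
  rfl

theorem pullAdd_pullAdd_sub_mem_Bd {k : chains.obj K ⟶ chains.obj L} {l : chains.obj L ⟶ chains.obj K}
    (h : Homotopy (k ≫ l) (𝟙 _)) (p : ℕ) (f : K _⦋p⦌ → ℝ)
    (hf : cochainD p f = 0) :
    pullAdd (chainF k p) (pullAdd (chainF l p) f) - f ∈ (Cochains K).Bd p := by
  have h0 : pullAdd (homotopyMap h p) (cochainD p f) = 0 :=
    (congrArg (pullAdd (homotopyMap h p)) hf).trans (map_zero (pullAddₗ (homotopyMap h p)))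
  have h1 := pullAdd_sub_mem_Bd h p f h0
  rw [pullAdd_chainF_comp, pullAdd_id] at h1
  exact h1

/-- A homotopy inverse of the chain map induced by a simplicial map induces an isomorphism of
algebras on cohomology. -/
theorem inducesAlgebraIso_pullMap_inv (f : K ⟶ L)
    (e : HomotopyEquiv (chains.obj K) (chains.obj L)) (he : e.hom = chains.map f) :
    (pullMap e.inv).InducesAlgebraIso := by
  refine inducesAlgebraIso_of_homotopyInverse (pullMap e.inv) (pullMap e.hom)
    (fun p g hg => pullAdd_pullAdd_sub_mem_Bd e.homotopyHomInvId p g hg)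
    (fun p g hg => pullAdd_pullAdd_sub_mem_Bd e.homotopyInvHomId p g hg) ?_ ?_ cochainD_one
  · rw [he]
    exact fun h a b => pullMap_map_mul f h a b
  · rw [he]
    exact funext fun σ => pullMap_map_apply f 0 _ σ

end Conclusion

end DiffDeRham

end

theorem corollary2p2 (X : Type*) [DiffeologicalSpace X] :
    Nonempty (DiffDeRham.RestrictionEquiv X) ∧
    ∀ e : DiffDeRham.RestrictionEquiv X,
      ∃ F : DiffDeRham.CochainAlgebra.CochainMap (DiffDeRham.ADR (DiffDeRham.SD X))
          (DiffDeRham.Cochains (DiffDeRham.SDsub X)),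
        (∀ p Φ, F.toFun p Φ = DiffDeRham.integrationSub e p Φ) ∧ F.InducesAlgebraIso := by
  refine ⟨DiffDeRham.nonempty_restrictionEquiv X, fun e =>
    ⟨DiffDeRham.compMap (DiffDeRham.pullMap e.equiv.inv) (DiffDeRham.integrationMap _),
      fun p Φ => rfl, ?_⟩⟩
  exact DiffDeRham.inducesAlgebraIso_compMap
    (DiffDeRham.inducesAlgebraIso_pullMap_inv (DiffDeRham.restriction X) e.equiv e.hom_eq)
    (DiffDeRham.inducesAlgebraIso_integrationMap _)
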